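/- Conventions. An operator space is a complex normed space $V$ with norms on all $M_n(V)$ satisfying Ruan's axioms. $\mathcal{K}$ is the C*-algebra of compact operators on $\ell^2(\mathbb{N})$. A C*-algebra $A$ is injective if every complete contraction $E\to A$, for $E$ a subspace of an operator space $F$, extends to a complete contraction $F\to A$. Write $A\otimes_{\min}V$ for the completed minimal (spatial) operator space tensor product, with the $A$-bimodule structure $a(b\otimes v)c=abc\otimes v$. Let $A$ be a C*-algebra. An $A$-operator space is an $A$-bimodule $\mathcal{W}$ with a norm such that the linear span of $A\mathcal{W}A$ is dense in $\mathcal{W}$ (the bimodule is essential) and the unit ball is absolutely $A$-convex. A set $X\subseteq\mathcal{W}$ is absolutely $A$-convex if $a_1w_1b_1+a_2w_2b_2\in X$ whenever $w_1,w_2\in X$ and $a_i,b_i\in A$ satisfy $\|a_1a_1^*+a_2a_2^*\|\le 1$ and $\|b_1^*b_1+b_2^*b_2\|\le 1$. Let $\mathcal{B}_A(\mathcal{W},\mathcal{X})$ be the space of bounded linear maps $\varphi$ with $\varphi(awb)=a\varphi(w)b$ for all $a,b\in A$, $w\in\mathcal{W}$. A set $X\subseteq\mathcal{W}$ is $A$-compact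 if it is closed and is contained in the closed absolutely $A$-convex hull of a sequence converging to $0$ in norm. A map $\varphi\in\mathcal{B}_A(\mathcal{W},\mathcal{X})$ is $A$-compact if the closure of the image of the unit ball of $\mathcal{W}$ is $A$-compact. A map $\varphi\in\mathcal{B}_A(\mathcal{W},A\otimes_{\min}V)$ has finite $A$-rank if there are finitely many $\varphi_1,\dots,\varphi_k\in\mathcal{B}_A(\mathcal{W},A)$ and $v_1,\dots,v_k\in V$ with $\varphi(w)=\sum_{i=1}^k\varphi_i(w)\otimes v_i$ for all $w$. The space $\mathcal{V}=A\otimes_{\min}V$ has the $A$-approximation property if for every $A$-compact set $X\subseteq\mathcal{V}$ and every $\varepsilon>0$ there is a finite $A$-rank map $\psi\in\mathcal{B}_A(\mathcal{V},\mathcal{V})$ with $\|\psi(v)-v\|\le\varepsilon$ for all $v\in X$. Theorem. Let $A$ be an injective C*-algebra or $A=\mathcal{K}$, let $V$ be an operator space, and let $\mathcal{V}=A\otimes_{\min}V$. Then $\mathcal{V}$ has the $A$-approximation property if and only if for every $A$-operator space $\mathcal{W}$, every $A$-compact map $\varphi\in\mathcal{B}_A(\mathcal{W},\mathcal{V})$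 and every $\varepsilon>0$ there is a finite $A$-rank map $\psi\in\mathcal{B}_A(\mathcal{W},\mathcal{V})$ with $\|\varphi-\psi\|\le\varepsilon$. -/

import Mathlib

open scoped TensorProduct Topology ComplexOrder

universe u

noncomputable section

/-! ### Operator spaces -/

/-- The product `α x β ∈ M_m(V)` of `x ∈ M_n(V)` with rectangular scalar matrices. -/
def scalarConj {V : Type*} [AddCommGroup V] [Module ℂ V] {m n : ℕ}
    (α : Matrix (Fin m) (Fin n) ℂ) (x : Matrix (Fin n) (Fin n) V)
    (β : Matrix (Fin n) (Fin m) ℂ) : Matrix (Fin m) (Fin m) V :=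
  Matrix.of fun i j => ∑ k, ∑ l, (α i k * β l j) • x k l

/-- The block diagonal matrix `x ⊕ y ∈ M_{n+m}(V)`. -/
def directSumMatrix {V : Type*} [AddCommGroup V] {n m : ℕ}
    (x : Matrix (Fin n) (Fin n) V) (y : Matrix (Fin m) (Fin m) V) :
    Matrix (Fin (n + m)) (Fin (n + m)) V :=
  Matrix.reindex finSumFinEquiv finSumFinEquiv (Matrix.fromBlocks x 0 0 y)

/-- An operator space structure on a complex normed space, in the sense of Ruan's axioms:
a norm on each `M_n(V)` (definiteness follows from the case `n = 1`) such that
`‖x ⊕ y‖ = max ‖x‖ ‖y‖` and `‖α x β‖ ≤ ‖α‖ ‖x‖ ‖β‖`. The norm of a `CStarMatrix` with entries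
in `ℂ` is the operator norm between the Hilbert spaces. -/
class OperatorSpace (V : Type*) [NormedAddCommGroup V] [NormedSpace ℂ V] where
  matNorm : (n : ℕ) → Seminorm ℂ (Matrix (Fin n) (Fin n) V)
  matNorm_one : ∀ x : Matrix (Fin 1) (Fin 1) V, matNorm 1 x = ‖x 0 0‖
  matNorm_directSum : ∀ {n m : ℕ} (x : Matrix (Fin n) (Fin n) V) (y : Matrix (Fin m) (Fin m) V),
    matNorm (n + m) (directSumMatrix x y) = max (matNorm n x) (matNorm m y)
  matNorm_scalarConj_le : ∀ {m n : ℕ} (α : Matrix (Fin m) (Fin n) ℂ)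
    (x : Matrix (Fin n) (Fin n) V) (β : Matrix (Fin n) (Fin m) ℂ),
    matNorm m (scalarConj α x β) ≤
      ‖CStarMatrix.ofMatrix α‖ * matNorm n x * ‖CStarMatrix.ofMatrix β‖

/-- A linear map from an operator space to a C*-algebra is completely contractive if all its
amplifications `M_n(V) → M_n(B)` are contractions. -/
def IsCompletelyContractive {V : Type*} [NormedAddCommGroup V] [NormedSpace ℂ V]
    [OperatorSpace V] {B : Type*} [NonUnitalCStarAlgebra B] [PartialOrder B] [StarOrderedRing B]
    (φ : V →ₗ[ℂ] B) : Prop :=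
  ∀ (n : ℕ) (x : Matrix (Fin n) (Fin n) V),
    ‖CStarMatrix.ofMatrix (x.map φ)‖ ≤ OperatorSpace.matNorm n x

/-- A subspace of an operator space is an operator space with the inherited matrix norms. -/
instance Submodule.instOperatorSpace {V : Type*} [NormedAddCommGroup V] [NormedSpace ℂ V]
    [OperatorSpace V] (E : Submodule ℂ V) : OperatorSpace E where
  matNorm n := (OperatorSpace.matNorm n).comp E.subtype.mapMatrix
  matNorm_one x := by
    simp [Seminorm.comp_apply, OperatorSpace.matNorm_one]
  matNorm_directSum x y := by
    simp only [Seminorm.comp_apply]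
    rw [← OperatorSpace.matNorm_directSum]
    congr 1
    ext i j
    simp only [directSumMatrix, Matrix.reindex_apply, LinearMap.mapMatrix_apply,
      Matrix.map_apply, Matrix.submatrix_apply]
    rcases finSumFinEquiv.symm i with i | i <;> rcases finSumFinEquiv.symm j with j | j <;> simp
  matNorm_scalarConj_le α x β := by
    simp only [Seminorm.comp_apply]
    refine le_trans (le_of_eq ?_) (OperatorSpace.matNorm_scalarConj_le α _ β)
    congr 1
    ext i j
    simp [scalarConj]

/-! ### The two classes of coefficient algebras -/

/-- `A` is an injective C*-algebra: every complete contraction into `A` defined on a subspace of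
an operator space extends to a complete contraction on the whole space. -/
def IsInjectiveCStarAlgebra (A : Type u) [NonUnitalCStarAlgebra A] [PartialOrder A]
    [StarOrderedRing A] : Prop :=
  ∀ (F : Type u) [NormedAddCommGroup F] [NormedSpace ℂ F] [OperatorSpace F]
    (E : Submodule ℂ F) (φ : E →ₗ[ℂ] A), IsCompletelyContractive φ →
    ∃ ψ : F →ₗ[ℂ] A, IsCompletelyContractive ψ ∧ ∀ e : E, ψ e = φ e

/-- `A` is (a copy of) the C*-algebra of compact operators on `ℓ²(ℕ)`. -/
def IsCompactOperatorAlgebra (A : Type*) [NonUnitalCStarAlgebra A] : Prop :=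
  ∃ π : A →⋆ₙₐ[ℂ] (lp (fun _ : ℕ => ℂ) 2 →L[ℂ] lp (fun _ : ℕ => ℂ) 2),
    Function.Injective π ∧ Set.range π = {T : lp (fun _ : ℕ => ℂ) 2 →L[ℂ] lp (fun _ : ℕ => ℂ) 2 |
      IsCompactOperator T}

/-! ### `A`-operator spaces -/

/-- An `A`-operator space: an essential `A`-bimodule with an absolutely `A`-convex norm. Here
`lsmul a w` is `a w` and `rsmul b w` is `w b`. -/
class CStarOperatorSpace (A : Type*) [NonUnitalCStarAlgebra A]
    (W : Type*) [NormedAddCommGroup W] [NormedSpace ℂ W] where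
  lsmul : A →ₗ[ℂ] W →ₗ[ℂ] W
  rsmul : A →ₗ[ℂ] W →ₗ[ℂ] W
  lsmul_mul : ∀ a b w, lsmul (a * b) w = lsmul a (lsmul b w)
  rsmul_mul : ∀ a b w, rsmul (a * b) w = rsmul b (rsmul a w)
  lsmul_rsmul : ∀ a b w, lsmul a (rsmul b w) = rsmul b (lsmul a w)
  essential : Dense (Submodule.span ℂ {v | ∃ a b w, v = lsmul a (rsmul b w)} : Set W)
  norm_convex : ∀ (a₁ a₂ b₁ b₂ : A) (w₁ w₂ : W),
    ‖a₁ * star a₁ + a₂ * star a₂‖ ≤ 1 → ‖star b₁ * b₁ + star b₂ * b₂‖ ≤ 1 →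
    ‖w₁‖ ≤ 1 → ‖w₂‖ ≤ 1 → ‖lsmul a₁ (rsmul b₁ w₁) + lsmul a₂ (rsmul b₂ w₂)‖ ≤ 1

section Bimodules

variable (A : Type*) [NonUnitalCStarAlgebra A]
variable {W : Type*} [NormedAddCommGroup W] [NormedSpace ℂ W] [CStarOperatorSpace A W]
variable {X : Type*} [NormedAddCommGroup X] [NormedSpace ℂ X] [CStarOperatorSpace A X]

/-- The two-sided product `a w b`. -/
def bimul (a : A) (w : W) (b : A) : W :=
  CStarOperatorSpace.lsmul a (CStarOperatorSpace.rsmul b w)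

/-- `φ` is bi-`A`-linear: `φ (a w b) = a φ(w) b`. -/
def IsBilinearOver (φ : W →L[ℂ] X) : Prop :=
  ∀ (a b : A) (w : W), φ (bimul A a w b) = bimul A a (φ w) b

/-- Absolutely `A`-convex sets. -/
def IsAConvex (S : Set W) : Prop :=
  ∀ v₁ ∈ S, ∀ v₂ ∈ S, ∀ a₁ a₂ b₁ b₂ : A,
    ‖a₁ * star a₁ + a₂ * star a₂‖ ≤ 1 → ‖star b₁ * b₁ + star b₂ * b₂‖ ≤ 1 →
    bimul A a₁ v₁ b₁ + bimul A a₂ v₂ b₂ ∈ S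

/-- The closed absolutely `A`-convex hull. -/
def closedAConvexHull (T : Set W) : Set W :=
  closure (⋂₀ {S | IsAConvex A S ∧ T ⊆ S})

/-- `A`-compact sets: closed subsets of the closed `A`-convex hull of a null sequence. -/
def IsACompact (S : Set W) : Prop :=
  IsClosed S ∧ ∃ x : ℕ → W, Filter.Tendsto x Filter.atTop (𝓝 0) ∧
    S ⊆ closedAConvexHull A (Set.range x)

/-- `φ` is an `A`-compact map: it is bi-`A`-linear and the closure of the image of the unit ball
is `A`-compact. -/
def IsACompactMap (φ : W →L[ℂ] X) : Prop :=
  IsBilinearOver A φ ∧ IsACompact A (closure (φ '' Metric.closedBall 0 1))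

end Bimodules

/-! ### The minimal tensor product `A ⊗_min V` -/

section MinTensor

variable {A : Type*} [NonUnitalCStarAlgebra A]
variable {V : Type*} [NormedAddCommGroup V] [NormedSpace ℂ V]

/-- The map `id ⊗ g : A ⊗ V → A ⊗ M_q = M_q(A)` for a linear map `g : V → M_q`. -/
def sliceMap {q : ℕ} (g : V →ₗ[ℂ] CStarMatrix (Fin q) (Fin q) ℂ) :
    A ⊗[ℂ] V →ₗ[ℂ] CStarMatrix (Fin q) (Fin q) A :=
  TensorProduct.lift <| LinearMap.mk₂ ℂ
    (fun a v => CStarMatrix.ofMatrix (Matrix.of fun i j => g v i j • a))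
    (fun a b v => by ext i j; simp)
    (fun c a v => by ext i j; simp [smul_comm c])
    (fun a v w => by ext i j; simp [add_smul])
    (fun c a v => by ext i j; simp [smul_smul])

lemma sliceMap_tmul {q : ℕ} (g : V →ₗ[ℂ] CStarMatrix (Fin q) (Fin q) ℂ) (a : A) (v : V)
    (i j : Fin q) : sliceMap g (a ⊗ₜ v) i j = g v i j • a := by
  simp [sliceMap]

variable (V) in
/-- Left multiplication `a (b ⊗ v) = ab ⊗ v` on `A ⊗ V`. -/
def tensorLeft : A →ₗ[ℂ] A ⊗[ℂ] V →ₗ[ℂ] A ⊗[ℂ] V :=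
  LinearMap.rTensorHom V ∘ₗ LinearMap.mul ℂ A

variable (V) in
/-- Right multiplication `(b ⊗ v) a = ba ⊗ v` on `A ⊗ V`. -/
def tensorRight : A →ₗ[ℂ] A ⊗[ℂ] V →ₗ[ℂ] A ⊗[ℂ] V :=
  LinearMap.rTensorHom V ∘ₗ (LinearMap.mul ℂ A).flip

@[simp] lemma tensorLeft_tmul (a b : A) (v : V) : tensorLeft V a (b ⊗ₜ v) = (a * b) ⊗ₜ v := by
  simp [tensorLeft]

@[simp] lemma tensorRight_tmul (a b : A) (v : V) : tensorRight V a (b ⊗ₜ v) = (b * a) ⊗ₜ v := by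
  simp [tensorRight]

lemma tensorLeft_mul (a b : A) (u : A ⊗[ℂ] V) :
    tensorLeft V (a * b) u = tensorLeft V a (tensorLeft V b u) := by
  induction u with
  | zero => simp
  | tmul c v => simp [mul_assoc]
  | add x y hx hy => simp [hx, hy]

lemma tensorRight_mul (a b : A) (u : A ⊗[ℂ] V) :
    tensorRight V (a * b) u = tensorRight V b (tensorRight V a u) := by
  induction u with
  | zero => simp
  | tmul c v => simp [mul_assoc]
  | add x y hx hy => simp [hx, hy]

lemma tensorLeft_tensorRight (a b : A) (u : A ⊗[ℂ] V) :
    tensorLeft V a (tensorRight V b u) = tensorRight V b (tensorLeft V a u) := by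
  induction u with
  | zero => simp
  | tmul c v => simp [mul_assoc]
  | add x y hx hy => simp [hx, hy]

/-- The diagonal embedding `A → M_q(A)`. -/
def diagHom (q : ℕ) : A →⋆ₙₐ[ℂ] CStarMatrix (Fin q) (Fin q) A where
  toFun a := CStarMatrix.ofMatrix (Matrix.diagonal fun _ => a)
  map_smul' c a := by
    ext i j
    simp [Matrix.diagonal_apply, smul_ite]
  map_zero' := by
    ext i j
    simp
  map_add' a b := by
    ext i j
    by_cases h : i = j <;> simp [h]
  map_mul' a b := by
    ext i j
    simp [CStarMatrix.mul_apply, Matrix.diagonal_apply]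
  map_star' a := by
    ext i j
    by_cases h : i = j
    · simp [h, CStarMatrix.star_apply]
    · simp [h, Ne.symm h, CStarMatrix.star_apply]

lemma diagHom_apply (q : ℕ) (a : A) (i j : Fin q) :
    diagHom q a i j = if i = j then a else 0 := by
  simp [diagHom, Matrix.diagonal_apply]

lemma sliceMap_tensorLeft {q : ℕ} (g : V →ₗ[ℂ] CStarMatrix (Fin q) (Fin q) ℂ) (a : A)
    (u : A ⊗[ℂ] V) : sliceMap g (tensorLeft V a u) = diagHom q a * sliceMap g u := by
  induction u with
  | zero => simp
  | tmul b v =>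
    ext i j
    simp [sliceMap_tmul, CStarMatrix.mul_apply, diagHom_apply, mul_smul_comm]
  | add x y hx hy => simp [hx, hy, mul_add]

lemma sliceMap_tensorRight {q : ℕ} (g : V →ₗ[ℂ] CStarMatrix (Fin q) (Fin q) ℂ) (a : A)
    (u : A ⊗[ℂ] V) : sliceMap g (tensorRight V a u) = sliceMap g u * diagHom q a := by
  induction u with
  | zero => simp
  | tmul b v =>
    ext i j
    simp [sliceMap_tmul, CStarMatrix.mul_apply, diagHom_apply, smul_mul_assoc]
  | add x y hx hy => simp [hx, hy, add_mul]

variable [PartialOrder A] [StarOrderedRing A] [OperatorSpace V]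

variable (V) in
/-- Pairs `(q, g)` of `q : ℕ` and a complete contraction `g : V → M_q`. -/
abbrev MatrixContraction : Type _ :=
  Σ q : ℕ, {g : V →ₗ[ℂ] CStarMatrix (Fin q) (Fin q) ℂ // IsCompletelyContractive g}

variable (A) in
/-- The seminorm `u ↦ ‖(id ⊗ g)(u)‖` on `A ⊗ V`, the norm being that of the C*-algebra
`M_q(A) = A ⊗ M_q`. -/
def sliceSeminorm (p : MatrixContraction V) : Seminorm ℂ (A ⊗[ℂ] V) :=
  (normSeminorm ℂ (CStarMatrix (Fin p.1) (Fin p.1) A)).comp (sliceMap p.2.1)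

variable (A V) in
/-- The minimal operator space tensor norm on `A ⊗ V`: since the complete contractions
`V → M_q`, for all `q`, together embed `V` completely isometrically in the C*-algebra
`∏ M_q`, it is the supremum of the norms of `(id ⊗ g)(u)` in `A ⊗ M_q = M_q(A)`. -/
def minSeminorm : Seminorm ℂ (A ⊗[ℂ] V) := ⨆ p : MatrixContraction V, sliceSeminorm A p

lemma norm_diagHom_le (q : ℕ) (a : A) : ‖diagHom q a‖ ≤ ‖a‖ :=
  NonUnitalStarAlgHom.norm_apply_le (diagHom q) a

lemma norm_apply_le_of_isCompletelyContractive {B : Type*} [NonUnitalCStarAlgebra B]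
    [PartialOrder B] [StarOrderedRing B] {φ : V →ₗ[ℂ] B} (h : IsCompletelyContractive φ) (v : V) :
    ‖φ v‖ ≤ ‖v‖ := by
  have h1 := h 1 (Matrix.of fun _ _ => v)
  rw [OperatorSpace.matNorm_one] at h1
  refine le_trans ?_ h1
  exact CStarMatrix.norm_entry_le_norm (M := CStarMatrix.ofMatrix
    ((Matrix.of fun (_ _ : Fin 1) => v).map φ)) (i := 0) (j := 0)

lemma norm_scalar_smul_le {q : ℕ} (G : CStarMatrix (Fin q) (Fin q) ℂ) (a : A) :
    ‖(CStarMatrix.ofMatrix (Matrix.of fun i j => G i j • a) : CStarMatrix (Fin q) (Fin q) A)‖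
      ≤ ‖G‖ * ‖a‖ := by
  let _ : PartialOrder (Unitization ℂ A) := CStarAlgebra.spectralOrder _
  have : StarOrderedRing (Unitization ℂ A) := CStarAlgebra.spectralOrderedRing _
  let ι : CStarMatrix (Fin q) (Fin q) A →⋆ₙₐ[ℂ] CStarMatrix (Fin q) (Fin q) (Unitization ℂ A) :=
    CStarMatrix.mapₙₐ (Unitization.inrNonUnitalStarAlgHom ℂ A)
  let Φ : CStarMatrix (Fin q) (Fin q) ℂ →⋆ₙₐ[ℂ]
      CStarMatrix (Fin q) (Fin q) (Unitization ℂ A) :=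
    CStarMatrix.mapₙₐ ((StarAlgHom.ofId ℂ (Unitization ℂ A) : ℂ →⋆ₐ[ℂ] Unitization ℂ A) :
      ℂ →⋆ₙₐ[ℂ] Unitization ℂ A)
  have hι : Function.Injective ι := by
    intro x y hxy
    ext i j
    have := congrArg (fun M : CStarMatrix (Fin q) (Fin q) (Unitization ℂ A) => M i j) hxy
    simpa [ι, CStarMatrix.mapₙₐ] using this
  rw [← NonUnitalStarAlgHom.norm_map ι hι]
  have key : ι (CStarMatrix.ofMatrix (Matrix.of fun i j => G i j • a)) =
      Φ G * diagHom q (Unitization.inr a) := by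
    refine CStarMatrix.ext fun i j => ?_
    simp [ι, Φ, CStarMatrix.mul_apply, diagHom_apply, CStarMatrix.mapₙₐ,
      Algebra.algebraMap_eq_smul_one]
  rw [key]
  refine (norm_mul_le _ _).trans ?_
  gcongr
  · exact NonUnitalStarAlgHom.norm_apply_le Φ G
  · exact (norm_diagHom_le q _).trans (by rw [Unitization.norm_inr])

lemma sliceSeminorm_tmul_le (p : MatrixContraction V) (a : A) (v : V) :
    sliceSeminorm A p (a ⊗ₜ v) ≤ ‖a‖ * ‖v‖ := by
  have h : sliceMap p.2.1 (a ⊗ₜ v) =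
      CStarMatrix.ofMatrix (Matrix.of fun i j => p.2.1 v i j • a) := by
    ext i j; simp [sliceMap]
  simp only [sliceSeminorm, Seminorm.comp_apply, coe_normSeminorm, h]
  refine (norm_scalar_smul_le _ _).trans ?_
  rw [mul_comm]
  gcongr
  exact norm_apply_le_of_isCompletelyContractive p.2.2 v

lemma bddAbove_sliceSeminorm :
    BddAbove (Set.range fun p : MatrixContraction V => sliceSeminorm A p) := by
  rw [Seminorm.bddAbove_range_iff]
  intro u
  induction u with
  | zero => exact ⟨0, by rintro _ ⟨p, rfl⟩; simp⟩
  | tmul a v => exact ⟨‖a‖ * ‖v‖, by rintro _ ⟨p, rfl⟩; exact sliceSeminorm_tmul_le p a v⟩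
  | add x y hx hy =>
    obtain ⟨c, hc⟩ := hx
    obtain ⟨d, hd⟩ := hy
    refine ⟨c + d, ?_⟩
    rintro _ ⟨p, rfl⟩
    exact (map_add_le_add _ x y).trans (add_le_add (hc ⟨p, rfl⟩) (hd ⟨p, rfl⟩))

instance : Nonempty (MatrixContraction V) :=
  ⟨⟨0, 0, fun n x => by
    have : CStarMatrix.ofMatrix (x.map (0 : V →ₗ[ℂ] CStarMatrix (Fin 0) (Fin 0) ℂ)) = 0 := by
      ext i j k; exact k.elim0
    rw [this, norm_zero]
    exact apply_nonneg _ _⟩⟩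

lemma minSeminorm_apply (u : A ⊗[ℂ] V) :
    minSeminorm A V u = ⨆ p : MatrixContraction V, sliceSeminorm A p u :=
  Seminorm.iSup_apply bddAbove_sliceSeminorm

lemma sliceSeminorm_le_minSeminorm (p : MatrixContraction V) (u : A ⊗[ℂ] V) :
    sliceSeminorm A p u ≤ minSeminorm A V u :=
  le_ciSup (f := fun p : MatrixContraction V => sliceSeminorm A p)
    bddAbove_sliceSeminorm p u

lemma minSeminorm_le {u : A ⊗[ℂ] V} {c : ℝ}
    (h : ∀ p : MatrixContraction V, sliceSeminorm A p u ≤ c) : minSeminorm A V u ≤ c := by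
  rw [minSeminorm_apply]
  exact ciSup_le h

/-- Balls of a C*-algebra are absolutely convex over the algebra. -/
lemma norm_row_col_le (a₁ a₂ b₁ b₂ x₁ x₂ : A) (c : ℝ)
    (ha : ‖a₁ * star a₁ + a₂ * star a₂‖ ≤ 1) (hb : ‖star b₁ * b₁ + star b₂ * b₂‖ ≤ 1)
    (h₁ : ‖x₁‖ ≤ c) (h₂ : ‖x₂‖ ≤ c) : ‖a₁ * (x₁ * b₁) + a₂ * (x₂ * b₂)‖ ≤ c := by
  have hc : 0 ≤ c := (norm_nonneg _).trans h₁
  let X : WithCStarModule A (A × A) := (WithCStarModule.equiv A (A × A)).symm (a₁, a₂)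
  let Y : WithCStarModule A (A × A) :=
    (WithCStarModule.equiv A (A × A)).symm (star (x₁ * b₁), star (x₂ * b₂))
  have hXY : inner A Y X = a₁ * (x₁ * b₁) + a₂ * (x₂ * b₂) := by
    simp [X, Y, WithCStarModule.prod_inner, WithCStarModule.inner_def]
  have hX : ‖X‖ ≤ 1 := by
    rw [← sq_le_one_iff₀ (norm_nonneg _), WithCStarModule.prod_norm_sq]
    simpa [X, WithCStarModule.inner_def] using ha
  have hxb : ∀ x b : A, ‖x‖ ≤ c → star (x * b) * (x * b) ≤ c ^ 2 • (star b * b) := by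
    intro x b hx
    have h := CStarAlgebra.star_left_conjugate_le_norm_smul (a := b) (b := star x * x)
      (IsSelfAdjoint.star_mul_self x)
    have e : star (x * b) * (x * b) = star b * (star x * x) * b := by
      simp [mul_assoc]
    rw [e]
    refine h.trans (smul_le_smul_of_nonneg_right ?_ (star_mul_self_nonneg b))
    rw [CStarRing.norm_star_mul_self, sq]
    gcongr
  have hY : ‖Y‖ ≤ c := by
    rw [← sq_le_sq₀ (norm_nonneg _) hc, WithCStarModule.prod_norm_sq]
    have e : inner A Y.1 Y.1 + inner A Y.2 Y.2 =
        star (x₁ * b₁) * (x₁ * b₁) + star (x₂ * b₂) * (x₂ * b₂) := by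
      simp [Y, WithCStarModule.inner_def]
    rw [e]
    have hle := add_le_add (hxb x₁ b₁ h₁) (hxb x₂ b₂ h₂)
    rw [← smul_add] at hle
    refine (CStarAlgebra.norm_le_norm_of_nonneg_of_le
      (add_nonneg (star_mul_self_nonneg _) (star_mul_self_nonneg _)) hle).trans ?_
    rw [norm_smul, Real.norm_of_nonneg (by positivity)]
    exact mul_le_of_le_one_right (by positivity) hb
  rw [← hXY]
  refine (CStarModule.norm_inner_le _).trans ?_
  calc ‖Y‖ * ‖X‖ ≤ c * 1 := by gcongr
    _ = c := mul_one c

lemma minSeminorm_tensorLeft_le (a : A) (u : A ⊗[ℂ] V) :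
    minSeminorm A V (tensorLeft V a u) ≤ ‖a‖ * minSeminorm A V u := by
  refine minSeminorm_le fun p => ?_
  refine le_trans ?_ (mul_le_mul_of_nonneg_left (sliceSeminorm_le_minSeminorm p u) (norm_nonneg a))
  simp only [sliceSeminorm, Seminorm.comp_apply, coe_normSeminorm, sliceMap_tensorLeft]
  exact (norm_mul_le _ _).trans (by gcongr; exact norm_diagHom_le _ a)

lemma minSeminorm_tensorRight_le (a : A) (u : A ⊗[ℂ] V) :
    minSeminorm A V (tensorRight V a u) ≤ ‖a‖ * minSeminorm A V u := by
  refine minSeminorm_le fun p => ?_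
  refine le_trans ?_ (mul_le_mul_of_nonneg_left (sliceSeminorm_le_minSeminorm p u) (norm_nonneg a))
  simp only [sliceSeminorm, Seminorm.comp_apply, coe_normSeminorm, sliceMap_tensorRight]
  rw [mul_comm]
  exact (norm_mul_le _ _).trans (by gcongr; exact norm_diagHom_le _ a)

lemma minSeminorm_convex (a₁ a₂ b₁ b₂ : A) (u₁ u₂ : A ⊗[ℂ] V)
    (ha : ‖a₁ * star a₁ + a₂ * star a₂‖ ≤ 1) (hb : ‖star b₁ * b₁ + star b₂ * b₂‖ ≤ 1) :
    minSeminorm A V (tensorLeft V a₁ (tensorRight V b₁ u₁) +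
      tensorLeft V a₂ (tensorRight V b₂ u₂)) ≤ max (minSeminorm A V u₁) (minSeminorm A V u₂) := by
  refine minSeminorm_le fun p => ?_
  simp only [sliceSeminorm, Seminorm.comp_apply, coe_normSeminorm, map_add, sliceMap_tensorLeft,
    sliceMap_tensorRight]
  refine norm_row_col_le _ _ _ _ _ _ _ ?_ ?_
    ((sliceSeminorm_le_minSeminorm p u₁).trans (le_max_left _ _))
    ((sliceSeminorm_le_minSeminorm p u₂).trans (le_max_right _ _))
  · simp only [← map_star, ← map_mul, ← map_add]
    exact (norm_diagHom_le _ _).trans ha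
  · simp only [← map_star, ← map_mul, ← map_add]
    exact (norm_diagHom_le _ _).trans hb

variable (A V)

/-- The algebraic tensor product `A ⊗ V` with the minimal operator space tensor norm. -/
def AlgMinTensor : Type _ := A ⊗[ℂ] V

instance : AddCommGroup (AlgMinTensor A V) := inferInstanceAs (AddCommGroup (A ⊗[ℂ] V))

instance : Module ℂ (AlgMinTensor A V) := inferInstanceAs (Module ℂ (A ⊗[ℂ] V))

instance : SeminormedAddCommGroup (AlgMinTensor A V) :=
  AddGroupSeminorm.toSeminormedAddCommGroup
    (E := AlgMinTensor A V) (minSeminorm A V).toAddGroupSeminorm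

instance : NormedSpace ℂ (AlgMinTensor A V) where
  norm_smul_le c u := (map_smul_eq_mul (minSeminorm A V) c u).le

/-- The complete minimal tensor product of the C*-algebra `A` and the operator space `V`. -/
abbrev MinTensor : Type _ := UniformSpace.Completion (AlgMinTensor A V)

variable {A V}

lemma AlgMinTensor.norm_def (u : AlgMinTensor A V) : ‖u‖ = minSeminorm A V u := rfl

/-- The elementary tensor `a ⊗ v` in `A ⊗_min V`. -/
def minTmul (a : A) (v : V) : MinTensor A V :=
  UniformSpace.Completion.coe' (show AlgMinTensor A V from a ⊗ₜ[ℂ] v)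

/-- Left multiplication by `a` as a bounded operator. -/
def algLeft (a : A) : AlgMinTensor A V →L[ℂ] AlgMinTensor A V :=
  LinearMap.mkContinuous (E := AlgMinTensor A V) (F := AlgMinTensor A V) (tensorLeft V a) ‖a‖
    (minSeminorm_tensorLeft_le a)

/-- Right multiplication by `a` as a bounded operator. -/
def algRight (a : A) : AlgMinTensor A V →L[ℂ] AlgMinTensor A V :=
  LinearMap.mkContinuous (E := AlgMinTensor A V) (F := AlgMinTensor A V) (tensorRight V a) ‖a‖
    (minSeminorm_tensorRight_le a)

lemma algLeft_apply (a : A) (u : AlgMinTensor A V) : algLeft a u = tensorLeft V a u := rfl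

lemma algRight_apply (a : A) (u : AlgMinTensor A V) : algRight a u = tensorRight V a u := rfl

lemma norm_minTmul_le (a : A) (v : V) : ‖minTmul a v‖ ≤ ‖a‖ * ‖v‖ := by
  rw [minTmul, UniformSpace.Completion.norm_coe]
  exact minSeminorm_le fun p => sliceSeminorm_tmul_le p a v

lemma completion_eq {f g : MinTensor A V →L[ℂ] MinTensor A V}
    (h : ∀ u : AlgMinTensor A V, f u = g u) : f = g := by
  ext x
  induction x using UniformSpace.Completion.induction_on with
  | hp => exact isClosed_eq f.continuous g.continuous
  | ih u => exact h u

variable (A V) in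
/-- Left multiplication on `A ⊗_min V`. -/
def minLeft : A →ₗ[ℂ] MinTensor A V →ₗ[ℂ] MinTensor A V :=
  ContinuousLinearMap.coeLM ℂ ∘ₗ
    ({ toFun := fun a => (algLeft a).completion
       map_add' := fun a b => completion_eq fun u => by
        rw [add_apply, ContinuousLinearMap.completion_apply_coe,
          ContinuousLinearMap.completion_apply_coe, ContinuousLinearMap.completion_apply_coe,
          ← UniformSpace.Completion.coe_add]
        exact congrArg _ (LinearMap.congr_fun ((tensorLeft V).map_add a b) u)
       map_smul' := fun c a => completion_eq fun u => by
        rw [RingHom.id_apply, smul_apply,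
          ContinuousLinearMap.completion_apply_coe, ContinuousLinearMap.completion_apply_coe,
          ← UniformSpace.Completion.coe_smul]
        exact congrArg _ (LinearMap.congr_fun ((tensorLeft V).map_smul c a) u) } :
      A →ₗ[ℂ] MinTensor A V →L[ℂ] MinTensor A V)

variable (A V) in
/-- Right multiplication on `A ⊗_min V`. -/
def minRight : A →ₗ[ℂ] MinTensor A V →ₗ[ℂ] MinTensor A V :=
  ContinuousLinearMap.coeLM ℂ ∘ₗ
    ({ toFun := fun a => (algRight a).completion
       map_add' := fun a b => completion_eq fun u => by
        rw [add_apply, ContinuousLinearMap.completion_apply_coe,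
          ContinuousLinearMap.completion_apply_coe, ContinuousLinearMap.completion_apply_coe,
          ← UniformSpace.Completion.coe_add]
        exact congrArg _ (LinearMap.congr_fun ((tensorRight V).map_add a b) u)
       map_smul' := fun c a => completion_eq fun u => by
        rw [RingHom.id_apply, smul_apply,
          ContinuousLinearMap.completion_apply_coe, ContinuousLinearMap.completion_apply_coe,
          ← UniformSpace.Completion.coe_smul]
        exact congrArg _ (LinearMap.congr_fun ((tensorRight V).map_smul c a) u) } :
      A →ₗ[ℂ] MinTensor A V →L[ℂ] MinTensor A V)

lemma minLeft_coe (a : A) (u : AlgMinTensor A V) :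
    minLeft A V a (u : MinTensor A V) = (algLeft a u : AlgMinTensor A V) :=
  ContinuousLinearMap.completion_apply_coe _ _

lemma minRight_coe (a : A) (u : AlgMinTensor A V) :
    minRight A V a (u : MinTensor A V) = (algRight a u : AlgMinTensor A V) :=
  ContinuousLinearMap.completion_apply_coe _ _

lemma continuous_minLeft (a : A) : Continuous (minLeft A V a) :=
  (algLeft a).completion.continuous

lemma continuous_minRight (a : A) : Continuous (minRight A V a) :=
  (algRight a).completion.continuous

lemma minLeft_minTmul (a b : A) (v : V) : minLeft A V a (minTmul b v) = minTmul (a * b) v := by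
  rw [minTmul, minLeft_coe, algLeft_apply, tensorLeft_tmul]
  rfl

lemma minRight_minTmul (a b : A) (v : V) : minRight A V a (minTmul b v) = minTmul (b * a) v := by
  rw [minTmul, minRight_coe, algRight_apply, tensorRight_tmul]
  rfl

lemma minTmul_sub (a b : A) (v : V) :
    minTmul (a - b) v = minTmul a v - minTmul b v := by
  rw [minTmul, minTmul, minTmul, TensorProduct.sub_tmul, ← UniformSpace.Completion.coe_sub]
  rfl

/-- The two-sided products of an approximate unit. -/
lemma tendsto_approx (a : A) :
    Filter.Tendsto (fun e : A => e * (a * e)) (CStarAlgebra.approximateUnit A) (𝓝 a) := by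
  have hu := CStarAlgebra.increasingApproximateUnit A
  rw [tendsto_iff_norm_sub_tendsto_zero]
  have h1 := tendsto_iff_norm_sub_tendsto_zero.1 (hu.tendsto_mul_left a)
  have h2 := tendsto_iff_norm_sub_tendsto_zero.1 (hu.tendsto_mul_right a)
  refine squeeze_zero' (Filter.Eventually.of_forall fun _ => norm_nonneg _) ?_
    (by simpa using h1.add h2)
  filter_upwards [hu.eventually_norm] with e he
  have : e * (a * e) - a = e * (a * e - a) + (e * a - a) := by noncomm_ring
  rw [this]
  refine (norm_add_le _ _).trans ?_
  have := norm_mul_le e (a * e - a)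
  nlinarith [norm_nonneg (a * e - a)]

lemma minTensor_essential :
    Dense (Submodule.span ℂ {v | ∃ a b w, v = minLeft A V a (minRight A V b w)} :
      Set (MinTensor A V)) := by
  set S := Submodule.span ℂ {v | ∃ a b w, v = minLeft A V a (minRight A V b w)} with hS
  have key : ∀ (a : A) (v : V), minTmul a v ∈ S.topologicalClosure := by
    intro a v
    have ht : Filter.Tendsto (fun e : A => minTmul (e * (a * e)) v)
        (CStarAlgebra.approximateUnit A) (𝓝 (minTmul a v)) := by
      rw [tendsto_iff_norm_sub_tendsto_zero]
      have h := (tendsto_iff_norm_sub_tendsto_zero.1 (tendsto_approx a)).mul_const ‖v‖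
      rw [zero_mul] at h
      refine squeeze_zero (fun _ => norm_nonneg _) (fun e => ?_) h
      rw [← minTmul_sub]
      exact norm_minTmul_le _ _
    refine mem_closure_of_tendsto ht (Filter.Eventually.of_forall fun e => ?_)
    exact Submodule.subset_span ⟨e, e, minTmul a v, by rw [minRight_minTmul, minLeft_minTmul]⟩
  have hall : ∀ u : AlgMinTensor A V, (u : MinTensor A V) ∈ S.topologicalClosure := by
    intro u
    induction (u : A ⊗[ℂ] V) using TensorProduct.induction_on with
    | zero => exact S.topologicalClosure.zero_mem
    | tmul a v => exact key a v
    | add x y hx hy =>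
      have := S.topologicalClosure.add_mem hx hy
      exact (congrArg (· ∈ S.topologicalClosure)
        (UniformSpace.Completion.coe_add (α := AlgMinTensor A V) x y)).mpr this
  intro x
  change x ∈ S.topologicalClosure
  induction x using UniformSpace.Completion.induction_on with
  | hp => exact S.isClosed_topologicalClosure
  | ih u => exact hall u

lemma minTensor_convex (a₁ a₂ b₁ b₂ : A) (w₁ w₂ : MinTensor A V)
    (ha : ‖a₁ * star a₁ + a₂ * star a₂‖ ≤ 1) (hb : ‖star b₁ * b₁ + star b₂ * b₂‖ ≤ 1) :
    ‖minLeft A V a₁ (minRight A V b₁ w₁) + minLeft A V a₂ (minRight A V b₂ w₂)‖ ≤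
      max ‖w₁‖ ‖w₂‖ := by
  induction w₁, w₂ using UniformSpace.Completion.induction_on₂ with
  | hp =>
    refine isClosed_le (Continuous.norm (Continuous.add ?_ ?_)) ?_
    · exact (continuous_minLeft a₁).comp ((continuous_minRight b₁).comp continuous_fst)
    · exact (continuous_minLeft a₂).comp ((continuous_minRight b₂).comp continuous_snd)
    · exact continuous_fst.norm.max continuous_snd.norm
  | ih u₁ u₂ =>
    simp only [minRight_coe, minLeft_coe, ← UniformSpace.Completion.coe_add,
      UniformSpace.Completion.norm_coe]
    exact minSeminorm_convex a₁ a₂ b₁ b₂ u₁ u₂ ha hb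

/-- `A ⊗_min V` is an `A`-operator space with `a (b ⊗ v) c = abc ⊗ v`. -/
instance : CStarOperatorSpace A (MinTensor A V) where
  lsmul := minLeft A V
  rsmul := minRight A V
  lsmul_mul a b w := by
    induction w using UniformSpace.Completion.induction_on with
    | hp => exact isClosed_eq (continuous_minLeft _)
              ((continuous_minLeft _).comp (continuous_minLeft _))
    | ih u =>
      rw [minLeft_coe, minLeft_coe, minLeft_coe]
      exact congrArg _ (tensorLeft_mul a b u)
  rsmul_mul a b w := by
    induction w using UniformSpace.Completion.induction_on with
    | hp => exact isClosed_eq (continuous_minRight _)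
              ((continuous_minRight _).comp (continuous_minRight _))
    | ih u =>
      rw [minRight_coe, minRight_coe, minRight_coe]
      exact congrArg _ (tensorRight_mul a b u)
  lsmul_rsmul a b w := by
    induction w using UniformSpace.Completion.induction_on with
    | hp => exact isClosed_eq ((continuous_minLeft _).comp (continuous_minRight _))
              ((continuous_minRight _).comp (continuous_minLeft _))
    | ih u =>
      rw [minRight_coe, minLeft_coe, minLeft_coe, minRight_coe]
      exact congrArg _ (tensorLeft_tensorRight a b u)
  essential := minTensor_essential
  norm_convex a₁ a₂ b₁ b₂ w₁ w₂ ha hb h₁ h₂ :=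
    (minTensor_convex a₁ a₂ b₁ b₂ w₁ w₂ ha hb).trans (max_le h₁ h₂)

/-- `A` is an `A`-operator space under multiplication. -/
instance : CStarOperatorSpace A A where
  lsmul := LinearMap.mul ℂ A
  rsmul := (LinearMap.mul ℂ A).flip
  lsmul_mul a b w := by simp [mul_assoc]
  rsmul_mul a b w := by simp [mul_assoc]
  lsmul_rsmul a b w := by simp [mul_assoc]
  essential a := by
    refine mem_closure_of_tendsto (tendsto_approx a) (Filter.Eventually.of_forall fun e => ?_)
    exact Submodule.subset_span ⟨e, e, a, by simp⟩
  norm_convex a₁ a₂ b₁ b₂ w₁ w₂ ha hb h₁ h₂ := by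
    simpa using norm_row_col_le a₁ a₂ b₁ b₂ w₁ w₂ 1 ha hb h₁ h₂

/-! ### Finite `A`-rank and the `A`-approximation property -/

/-- A bounded bi-`A`-linear map `φ : W → A ⊗_min V` has finite `A`-rank if it can be written as
`φ = ∑ φᵢ ⊗ vᵢ`, a finite sum with `vᵢ ∈ V` and bounded bi-`A`-linear maps `φᵢ : W → A`. -/
def HasFiniteARank {W : Type*} [NormedAddCommGroup W] [NormedSpace ℂ W]
    [CStarOperatorSpace A W] (φ : W →L[ℂ] MinTensor A V) : Prop :=
  IsBilinearOver A φ ∧ ∃ (k : ℕ) (f : Fin k → W →L[ℂ] A) (v : Fin k → V),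
    (∀ i, IsBilinearOver A (f i)) ∧ ∀ w, φ w = ∑ i, minTmul (f i w) (v i)

variable (A V) in
/-- `A ⊗_min V` has the `A`-approximation property: the identity can be approximated uniformly
on `A`-compact sets by bounded bi-`A`-linear maps of finite `A`-rank. -/
def HasAApproximationProperty : Prop :=
  ∀ S : Set (MinTensor A V), IsACompact A S → ∀ ε : ℝ, 0 < ε →
    ∃ ψ : MinTensor A V →L[ℂ] MinTensor A V, HasFiniteARank ψ ∧ ∀ v ∈ S, ‖ψ v - v‖ ≤ ε

end MinTensor

end

open scoped TensorProduct Topology ComplexOrder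

noncomputable section

set_option linter.unusedSectionVars false

/-! ### Geometry of `A`-convex sets -/

section AConvex

variable {A : Type*} [NonUnitalCStarAlgebra A]
variable {W : Type*} [NormedAddCommGroup W] [NormedSpace ℂ W] [CStarOperatorSpace A W]

/-! One direction is formal: a finite rank `ψ` that is uniformly close to the identity on the
`A`-compact set `closure (φ '' closedBall 0 1)` makes `ψ ∘ φ` close to `φ`.

For the converse it suffices to approximate the identity on a null sequence `y`, since for a
bimodule map `ψ` the set `{v | ‖ψ v - v‖ ≤ ε}` is closed and absolutely `A`-convex. By
`exists_null_sequence_dense` the `y k` may be taken to be algebraic tensors. Write `y k = l k • z k`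
with `l` and `z` both null and `z k ∈ A ⊗ E k`, where `E k ⊆ V` is finite-dimensional. The idea is
to enclose the `z k` in a closed hull `K` of a null sequence, to let `K` be the unit ball of a new
`A`-operator space `W` (`GaugeData`), and to apply the hypothesis to the inclusion `W → A ⊗ V`,
which is `A`-compact by construction. This gives `∑ f i ⊗ v i` close to the inclusion, but the `f i`
are bounded for the gauge norm only, not for the minimal norm, and must be replaced by bounded
bimodule maps on `A ⊗ V`.

This replacement (`exists_approximate_extension`) is the heart of the proof. For fixed `v`, the map
`a ↦ f (a ⊗ v)` is a bimodule map of `A`, that is, an element of a commutative C*-algebra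
`bimoduleMultipliers A ≅ C(T)`. Thus `f` has a symbol `v ↦ M v ∈ C(T)`. At each `t ∈ T` the symbol
is a scalar functional on a finite-dimensional space, and Hahn–Banach extends it to `V` with control
on a convex set of vectors (`exists_dual_extension_bounded_on`). A partition of unity `h i` on `T`
glues finitely many of these functionals `g i` into `∑ h i • (id ⊗ g i)`, which is bounded on all of
`A ⊗ V`. For finitely many `k` it is close to `f` on `z k`; for the others a uniform bound suffices,
because of the factor `l k → 0`. The uniform bound needs `K` to contain `a ⊗ v` for all `‖a‖ ≤ 1`
and all `v ∈ E k` with `‖v‖ ≤ r k`, where `r k ≥ ‖z k‖`.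

Only this last demand on `K` uses the assumption on `A`. The set `K` must remain the hull of a null
sequence, so the unit ball of `A` has to be the closed absolutely `A`-convex hull of a single
element (`IsUnitBallGenerator`). In an injective algebra the unit does this, once injectivity is
shown to force a unit; in the compact operators a minimal projection does. -/

lemma bimul_add (a b : A) (v w : W) : bimul A a (v + w) b = bimul A a v b + bimul A a w b := by
  simp [bimul]

lemma bimul_sub (a b : A) (v w : W) : bimul A a (v - w) b = bimul A a v b - bimul A a w b := by
  simp [bimul]

lemma bimul_smul (c : ℂ) (a b : A) (w : W) : bimul A a (c • w) b = c • bimul A a w b := by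
  simp [bimul]

lemma smul_bimul (c : ℂ) (a b : A) (w : W) : bimul A (c • a) w b = c • bimul A a w b := by
  simp [bimul]

lemma bimul_smul_right (c : ℂ) (a b : A) (w : W) : bimul A a w (c • b) = c • bimul A a w b := by
  simp [bimul]

lemma bimul_zero (a b : A) : bimul A a (0 : W) b = 0 := by
  simp [bimul]

lemma zero_bimul (b : A) (w : W) : bimul A (0 : A) w b = 0 := by
  simp [bimul]

lemma sub_bimul (a a' b : A) (w : W) : bimul A (a - a') w b = bimul A a w b - bimul A a' w b := by
  simp [bimul]

lemma bimul_sub_right (a b b' : A) (w : W) :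
    bimul A a w (b - b') = bimul A a w b - bimul A a w b' := by
  simp [bimul]

lemma bimul_bimul (a a' b b' : A) (w : W) :
    bimul A a (bimul A a' w b') b = bimul A (a * a') w (b' * b) := by
  simp only [bimul]
  rw [← CStarOperatorSpace.lsmul_rsmul, ← CStarOperatorSpace.lsmul_mul,
    CStarOperatorSpace.rsmul_mul]

/-- Closed balls are absolutely `A`-convex. -/
lemma norm_bimul_add_bimul_le {a₁ a₂ b₁ b₂ : A} {w₁ w₂ : W} {r : ℝ}
    (ha : ‖a₁ * star a₁ + a₂ * star a₂‖ ≤ 1) (hb : ‖star b₁ * b₁ + star b₂ * b₂‖ ≤ 1)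
    (h₁ : ‖w₁‖ ≤ r) (h₂ : ‖w₂‖ ≤ r) : ‖bimul A a₁ w₁ b₁ + bimul A a₂ w₂ b₂‖ ≤ r := by
  -- Rescaling by a strictly larger `s` avoids dividing by `r`, which may be zero.
  refine le_of_forall_gt_imp_ge_of_dense fun s hs => ?_
  have hs0 : 0 < s := (norm_nonneg w₁).trans_lt (h₁.trans_lt hs)
  have key : ∀ w : W, ‖w‖ ≤ r → ‖((s⁻¹ : ℝ) : ℂ) • w‖ ≤ 1 := by
    intro w hw
    rw [norm_smul, Complex.norm_real, norm_inv, Real.norm_of_nonneg hs0.le,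
      inv_mul_le_one₀ hs0]
    exact hw.trans hs.le
  have h := CStarOperatorSpace.norm_convex a₁ a₂ b₁ b₂ _ _ ha hb (key w₁ h₁) (key w₂ h₂)
  change ‖bimul A a₁ _ b₁ + bimul A a₂ _ b₂‖ ≤ 1 at h
  rw [bimul_smul, bimul_smul, ← smul_add, norm_smul, Complex.norm_real, norm_inv,
    Real.norm_of_nonneg hs0.le, inv_mul_le_one₀ hs0] at h
  exact h

lemma norm_mul_star_self_le_one {a : A} (ha : ‖a‖ ≤ 1) : ‖a * star a‖ ≤ 1 := by
  rw [CStarRing.norm_self_mul_star]; nlinarith [norm_nonneg a]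

lemma norm_star_mul_self_le_one {a : A} (ha : ‖a‖ ≤ 1) : ‖star a * a‖ ≤ 1 := by
  rw [CStarRing.norm_star_mul_self]; nlinarith [norm_nonneg a]

lemma norm_bimul_le_of_le_one {a b : A} (ha : ‖a‖ ≤ 1) (hb : ‖b‖ ≤ 1) (w : W) :
    ‖bimul A a w b‖ ≤ ‖w‖ := by
  have := norm_bimul_add_bimul_le (a₁ := a) (a₂ := 0) (b₁ := b) (b₂ := 0) (w₁ := w) (w₂ := w)
    (r := ‖w‖) (by simpa using norm_mul_star_self_le_one ha)
    (by simpa using norm_star_mul_self_le_one hb) le_rfl le_rfl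
  simpa [zero_bimul] using this

lemma norm_bimul_le (a b : A) (w : W) : ‖bimul A a w b‖ ≤ ‖a‖ * ‖b‖ * ‖w‖ := by
  have key : ∀ c : A, ∃ d : A, ‖d‖ ≤ 1 ∧ c = ((‖c‖ : ℝ) : ℂ) • d := by
    intro c
    by_cases hc : c = 0
    · exact ⟨0, by simp, by simp [hc]⟩
    · have hn : ‖c‖ ≠ 0 := norm_ne_zero_iff.2 hc
      refine ⟨((‖c‖⁻¹ : ℝ) : ℂ) • c, ?_, ?_⟩
      · rw [norm_smul, Complex.norm_real, norm_inv, norm_norm, inv_mul_cancel₀ hn]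
      · rw [smul_smul, ← Complex.ofReal_mul, mul_inv_cancel₀ hn]; simp
  obtain ⟨a', ha', ha⟩ := key a
  obtain ⟨b', hb', hb⟩ := key b
  have e : bimul A a w b = (((‖a‖ : ℝ) : ℂ) * ((‖b‖ : ℝ) : ℂ)) • bimul A a' w b' := by
    conv_lhs => rw [ha, hb]
    rw [smul_bimul, bimul_smul_right, smul_smul]
  rw [e, norm_smul, norm_mul, Complex.norm_real, Complex.norm_real, norm_norm, norm_norm]
  gcongr
  exact norm_bimul_le_of_le_one ha' hb' w

lemma continuous_bimul (a b : A) : Continuous fun w : W => bimul A a w b :=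
  AddMonoidHomClass.continuous_of_bound
    (CStarOperatorSpace.lsmul a ∘ₗ CStarOperatorSpace.rsmul b : W →ₗ[ℂ] W) (‖a‖ * ‖b‖)
    fun w => norm_bimul_le a b w

lemma IsAConvex.closure {S : Set W} (hS : IsAConvex A S) : IsAConvex A (closure S) := by
  intro v₁ h₁ v₂ h₂ a₁ a₂ b₁ b₂ ha hb
  exact map_mem_closure₂ (f := fun v w => bimul A a₁ v b₁ + bimul A a₂ w b₂)
    (((continuous_bimul a₁ b₁).comp continuous_fst).add
      ((continuous_bimul a₂ b₂).comp continuous_snd)) h₁ h₂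
    fun v hv w hw => hS v hv w hw a₁ a₂ b₁ b₂ ha hb

lemma isAConvex_closedBall (r : ℝ) : IsAConvex A (Metric.closedBall (0 : W) r) := by
  intro v₁ h₁ v₂ h₂ a₁ a₂ b₁ b₂ ha hb
  rw [mem_closedBall_zero_iff] at *
  exact norm_bimul_add_bimul_le ha hb h₁ h₂

lemma isClosed_closedAConvexHull (T : Set W) : IsClosed (closedAConvexHull A T) :=
  isClosed_closure

lemma isAConvex_closedAConvexHull (T : Set W) : IsAConvex A (closedAConvexHull A T) := by
  refine IsAConvex.closure fun v₁ h₁ v₂ h₂ a₁ a₂ b₁ b₂ ha hb => ?_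
  rintro S ⟨hS, hT⟩
  exact hS _ (h₁ S ⟨hS, hT⟩) _ (h₂ S ⟨hS, hT⟩) _ _ _ _ ha hb

lemma subset_closedAConvexHull (T : Set W) : T ⊆ closedAConvexHull A T :=
  fun _ hw => subset_closure fun _ hS => hS.2 hw

lemma closedAConvexHull_subset {T S : Set W} (hc : IsClosed S) (hS : IsAConvex A S)
    (hT : T ⊆ S) : closedAConvexHull A T ⊆ S :=
  closure_minimal (Set.sInter_subset_of_mem ⟨hS, hT⟩) hc

lemma closedAConvexHull_mono {S T : Set W} (h : S ⊆ closedAConvexHull A T) :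
    closedAConvexHull A S ⊆ closedAConvexHull A T :=
  closedAConvexHull_subset (isClosed_closedAConvexHull T) (isAConvex_closedAConvexHull T) h

lemma IsAConvex.bimul_mem {S : Set W} (hS : IsAConvex A S) {w : W} (hw : w ∈ S) {a b : A}
    (ha : ‖a‖ ≤ 1) (hb : ‖b‖ ≤ 1) : bimul A a w b ∈ S := by
  have := hS w hw w hw a 0 b 0 (by simpa using norm_mul_star_self_le_one ha)
    (by simpa using norm_star_mul_self_le_one hb)
  simpa [zero_bimul] using this

variable [PartialOrder A] [StarOrderedRing A]

/-- In an essential bimodule the two-sided products with an approximate unit converge. -/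
lemma tendsto_bimul_approximateUnit (w : W) :
    Filter.Tendsto (fun e : A => bimul A e w e) (CStarAlgebra.approximateUnit A) (𝓝 w) := by
  have hu := CStarAlgebra.increasingApproximateUnit A
  let S : Submodule ℂ W :=
    { carrier := {w | Filter.Tendsto (fun e : A => bimul A e w e)
        (CStarAlgebra.approximateUnit A) (𝓝 w)}
      add_mem' := fun {v w} hv hw => by
        simpa only [bimul_add, Set.mem_ofPred_eq] using Filter.Tendsto.add hv hw
      zero_mem' := by simp [bimul_zero]
      smul_mem' := fun c w hw => by
        simpa only [bimul_smul, Set.mem_ofPred_eq] using Filter.Tendsto.const_smul hw c }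
  have hgen : Submodule.span ℂ {v : W | ∃ (a b : A) (w : W), v = CStarOperatorSpace.lsmul a
      (CStarOperatorSpace.rsmul b w)} ≤ S := by
    rw [Submodule.span_le]
    rintro _ ⟨a, b, w, rfl⟩
    change Filter.Tendsto (fun e : A => bimul A e (bimul A a w b) e) _ (𝓝 (bimul A a w b))
    simp only [bimul_bimul]
    rw [tendsto_iff_norm_sub_tendsto_zero]
    have h1 := (tendsto_iff_norm_sub_tendsto_zero.1 (hu.tendsto_mul_right a)).mul_const
      (‖b‖ * ‖w‖)
    have h2 := (tendsto_iff_norm_sub_tendsto_zero.1 (hu.tendsto_mul_left b)).mul_const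
      (‖a‖ * ‖w‖)
    refine squeeze_zero' (Filter.Eventually.of_forall fun _ => norm_nonneg _) ?_
      (by simpa using h1.add h2)
    filter_upwards [hu.eventually_norm] with e he
    have e1 : bimul A (e * a) w (b * e) - bimul A a w b =
        bimul A (e * a - a) w (b * e) + bimul A a w (b * e - b) := by
      rw [sub_bimul, bimul_sub_right]; abel
    rw [e1]
    refine (norm_add_le _ _).trans (add_le_add ?_ ?_)
    · refine (norm_bimul_le _ _ _).trans ?_
      have : ‖b * e‖ ≤ ‖b‖ := (norm_mul_le _ _).trans (by nlinarith [norm_nonneg b])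
      rw [← mul_assoc]
      gcongr
    · refine (norm_bimul_le _ _ _).trans (le_of_eq (by ring))
  -- Convergence passes from the dense subspace to `w` because the maps `w ↦ e w e` are
  -- contractions, uniformly in `e`.
  have hcl : w ∈ closure (S : Set W) :=
    closure_mono hgen ((CStarOperatorSpace.essential (A := A) (W := W)) w)
  rw [Metric.tendsto_nhds]
  intro ε hε
  obtain ⟨v, hv, hvw⟩ := Metric.mem_closure_iff.1 hcl (ε / 3) (by positivity)
  filter_upwards [hu.eventually_norm,
    (Metric.tendsto_nhds.1 hv) (ε / 3) (by positivity)] with e he h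
  rw [dist_eq_norm] at *
  have e1 : bimul A e w e - w = bimul A e (w - v) e + (bimul A e v e - v) + (v - w) := by
    rw [bimul_sub]; abel
  rw [e1]
  have h3 := norm_bimul_le_of_le_one he he (w - v)
  have h4 : ‖v - w‖ < ε / 3 := by rwa [norm_sub_rev]
  have h5 := norm_add_le (bimul A e (w - v) e + (bimul A e v e - v)) (v - w)
  have h6 := norm_add_le (bimul A e (w - v) e) (bimul A e v e - v)
  linarith

/-- Without a unit in `A` the scalar `c` has to be imitated by the coefficient `c • e` with `e` in
an approximate unit; essentiality and closedness allow the passage to the limit. -/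
lemma IsAConvex.balanced {S : Set W} (hS : IsAConvex A S) (hc : IsClosed S) : Balanced ℂ S := by
  rintro c hc1 _ ⟨w, hw, rfl⟩
  have hu := CStarAlgebra.increasingApproximateUnit A
  have := (tendsto_bimul_approximateUnit (A := A) w).const_smul c
  refine hc.mem_of_tendsto this ?_
  filter_upwards [hu.eventually_norm] with e he
  rw [← smul_bimul]
  refine hS.bimul_mem hw ?_ he
  rw [norm_smul]
  nlinarith [norm_nonneg e, norm_nonneg c]

/-- The coefficients `√s • e` and `√t • e`, used on both sides, satisfy the row and column
conditions since `s + t = 1`, and `e` tends to a unit. -/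
lemma IsAConvex.convex {S : Set W} (hS : IsAConvex A S) (hc : IsClosed S) : Convex ℝ S := by
  intro v hv w hw s t hs ht hst
  have hu := CStarAlgebra.increasingApproximateUnit A
  have h := ((tendsto_bimul_approximateUnit (A := A) v).const_smul ((s : ℝ) : ℂ)).add
    ((tendsto_bimul_approximateUnit (A := A) w).const_smul ((t : ℝ) : ℂ))
  rw [Complex.coe_smul, Complex.coe_smul] at h
  refine hc.mem_of_tendsto h ?_
  filter_upwards [hu.eventually_norm] with e he
  have sq : ∀ s : ℝ, 0 ≤ s → ((s : ℝ) : ℂ) = ((√s : ℝ) : ℂ) * ((√s : ℝ) : ℂ) := by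
    intro s hs
    rw [← Complex.ofReal_mul, Real.mul_self_sqrt hs]
  have e1 : ∀ (s : ℝ) (w : W), 0 ≤ s → ((s : ℝ) : ℂ) • bimul A e w e =
      bimul A (((√s : ℝ) : ℂ) • e) w (((√s : ℝ) : ℂ) • e) := by
    intro s w hs
    rw [smul_bimul, bimul_smul_right, smul_smul, ← sq s hs]
  rw [e1 s v hs, e1 t w ht]
  have e2 : ∀ f : A, ‖((s : ℝ) : ℂ) • f + ((t : ℝ) : ℂ) • f‖ = ‖f‖ := by
    intro f
    rw [← add_smul, ← Complex.ofReal_add, hst]; simp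
  refine hS v hv w hw _ _ _ _ ?_ ?_
  · simp only [star_smul, smul_mul_smul_comm, Complex.star_def, Complex.conj_ofReal]
    rw [← sq s hs, ← sq t ht, e2]
    exact norm_mul_star_self_le_one he
  · simp only [star_smul, smul_mul_smul_comm, Complex.star_def, Complex.conj_ofReal]
    rw [← sq s hs, ← sq t ht, e2]
    exact norm_star_mul_self_le_one he

lemma IsAConvex.smul_add_smul_mem {S : Set W} (hS : IsAConvex A S) (hc : IsClosed S) {v w : W}
    (hv : v ∈ S) (hw : w ∈ S) {s t : ℝ} (hs : 0 ≤ s) (ht : 0 ≤ t) (hst : s + t ≤ 1) :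
    ((s : ℝ) : ℂ) • v + ((t : ℝ) : ℂ) • w ∈ S := by
  have h0 : (0 : W) ∈ S := (hS.balanced hc).zero_mem ⟨v, hv⟩
  by_cases h : s + t = 0
  · have h1 : s = 0 := by linarith
    have h2 : t = 0 := by linarith
    simpa [h1, h2] using h0
  · have hp : 0 < s + t := lt_of_le_of_ne (by positivity) (Ne.symm h)
    have h1 := hS.convex hc hv hw (a := s / (s + t)) (b := t / (s + t)) (by positivity)
      (by positivity) (by field_simp)
    have h2 := (hS.convex hc) h1 h0 (a := s + t) (b := 1 - (s + t)) hp.le (by linarith) (by ring)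
    have e : (s + t) • ((s / (s + t)) • v + (t / (s + t)) • w) + (1 - (s + t)) • (0 : W) =
        s • v + t • w := by
      rw [smul_zero, add_zero, smul_add, smul_smul, smul_smul]
      congr 2 <;> field_simp
    rw [e] at h2
    simpa only [Complex.coe_smul] using h2

/-- A closed `A`-convex set contains the sums of its series `∑ 2⁻ᵏ⁻¹ yₖ`. -/
lemma IsAConvex.mem_of_tendsto_sum {S : Set W} (hS : IsAConvex A S) (hc : IsClosed S)
    {y : ℕ → W} (hy : ∀ k, y k ∈ S) {x : W}
    (hx : Filter.Tendsto (fun m => ∑ k ∈ Finset.range m, (((1 / 2) ^ (k + 1) : ℝ) : ℂ) • y k)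
      Filter.atTop (𝓝 x)) : x ∈ S := by
  have h0 : (0 : W) ∈ S := (hS.balanced hc).zero_mem ⟨_, hy 0⟩
  -- The first `m` weights add up to `1 - 2⁻ᵐ`, so each partial sum is that multiple of a point of
  -- `S`.
  have key : ∀ (m : ℕ), ∃ w ∈ S, (((1 - (1 / 2) ^ m : ℝ)) : ℂ) • w =
      ∑ k ∈ Finset.range m, (((1 / 2) ^ (k + 1) : ℝ) : ℂ) • y k := by
    intro m
    induction m with
    | zero => exact ⟨0, h0, by simp⟩
    | succ m ih =>
      obtain ⟨w, hw, hwe⟩ := ih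
      rw [Finset.sum_range_succ, ← hwe]
      have hp : (0 : ℝ) < 1 - (1 / 2) ^ (m + 1) := by
        have : ((1 : ℝ) / 2) ^ (m + 1) < 1 := pow_lt_one₀ (by norm_num) (by norm_num) (by simp)
        linarith
      have hq : (0 : ℝ) ≤ 1 - (1 / 2) ^ m := by
        have : ((1 : ℝ) / 2) ^ m ≤ 1 := pow_le_one₀ (by norm_num) (by norm_num)
        linarith
      refine ⟨_, hS.smul_add_smul_mem hc hw (hy m)
        (s := (1 - (1 / 2) ^ m) / (1 - (1 / 2) ^ (m + 1)))
        (t := (1 / 2) ^ (m + 1) / (1 - (1 / 2) ^ (m + 1))) (by positivity) (by positivity) ?_, ?_⟩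
      · rw [← add_div, div_le_one hp, pow_succ]
        linarith
      · simp only [smul_add, smul_smul, ← Complex.ofReal_mul]
        congr 3 <;> field_simp
  refine hc.mem_of_tendsto hx (Filter.Eventually.of_forall fun m => ?_)
  obtain ⟨w, hw, hwe⟩ := key m
  rw [← hwe]
  refine (hS.balanced hc).smul_mem ?_ hw
  rw [Complex.norm_real, Real.norm_eq_abs, abs_le]
  have h1 : ((1 : ℝ) / 2) ^ m ≤ 1 := pow_le_one₀ (by norm_num) (by norm_num)
  have h2 : (0 : ℝ) ≤ (1 / 2) ^ m := by positivity
  constructor <;> linarith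

end AConvex

/-! ### Convex geometry of normed spaces -/

section NormedSpaceGeometry

variable {V : Type*} [NormedAddCommGroup V] [NormedSpace ℂ V]

/-- If `½ C` contains an `r / 2`-net of the `r`-ball of `E`, then `C` contains this ball. -/
lemma ball_subset_of_net {C : Set V} (hc : IsClosed C) (hconv : Convex ℝ C) (h0 : (0 : V) ∈ C)
    (E : Submodule ℂ V) {r : ℝ} {F : Set V} (hFE : F ⊆ E) (hFC : ∀ f ∈ F, (2 : ℝ) • f ∈ C)
    (hF : ∀ x ∈ E, ‖x‖ ≤ r → ∃ f ∈ F, ‖x - f‖ ≤ r / 2) {x : V} (hx : x ∈ E) (hxr : ‖x‖ ≤ r) :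
    x ∈ C := by
  -- Since `x = ½ (2 f) + ½ (2 (x - f))` and `2 (x - f)` lies again in the `r`-ball of `E`, each
  -- repetition halves the error.
  have key : ∀ (n : ℕ) (x : V), x ∈ E → ‖x‖ ≤ r → ∃ c ∈ C, ‖x - c‖ ≤ r * (1 / 2) ^ n := by
    intro n
    induction n with
    | zero => exact fun x _ hx => ⟨0, h0, by simpa using hx⟩
    | succ n ih =>
      intro x hx hxr
      obtain ⟨f, hf, hxf⟩ := hF x hx hxr
      obtain ⟨c, hcC, hcx⟩ := ih ((2 : ℝ) • (x - f))
        (by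
          rw [← Complex.coe_smul]
          exact E.smul_mem _ (E.sub_mem hx (hFE hf)))
        (by rw [norm_smul]; norm_num; linarith)
      refine ⟨(1 / 2 : ℝ) • (2 : ℝ) • f + (1 / 2 : ℝ) • c,
        hconv (hFC f hf) hcC (by norm_num) (by norm_num) (by norm_num), ?_⟩
      have e : x - ((1 / 2 : ℝ) • (2 : ℝ) • f + (1 / 2 : ℝ) • c) =
          (1 / 2 : ℝ) • ((2 : ℝ) • (x - f) - c) := by
        module
      rw [e, norm_smul, pow_succ]
      norm_num at hcx ⊢
      linarith
  rw [← hc.closure_eq, Metric.mem_closure_iff]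
  intro ε hε
  obtain ⟨n, hn⟩ : ∃ n : ℕ, r * (1 / 2) ^ n < ε := by
    have : Filter.Tendsto (fun n : ℕ => r * (1 / 2) ^ n) Filter.atTop (𝓝 (r * 0)) :=
      (tendsto_pow_atTop_nhds_zero_of_lt_one (by norm_num) (by norm_num)).const_mul r
    rw [mul_zero] at this
    exact (this.eventually (gt_mem_nhds hε)).exists
  obtain ⟨c, hcC, hcx⟩ := key n x hx hxr
  exact ⟨c, hcC, by rw [dist_eq_norm]; exact hcx.trans_lt hn⟩

/-- Balls of finite-dimensional subspaces have finite nets. -/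
lemma exists_finite_net (E : Submodule ℂ V) [FiniteDimensional ℂ E] (r : ℝ) (hr : 0 < r) :
    ∃ F : Set V, F.Finite ∧ F ⊆ E ∧ (∀ f ∈ F, ‖f‖ ≤ r) ∧
      ∀ x ∈ E, ‖x‖ ≤ r → ∃ f ∈ F, ‖x - f‖ ≤ r / 2 := by
  have : ProperSpace E := FiniteDimensional.proper ℂ E
  obtain ⟨t, hts, htf, ht⟩ := (isCompact_closedBall (0 : E) r).finite_cover_balls
    (half_pos hr)
  refine ⟨Subtype.val '' t, htf.image _, ?_, ?_, ?_⟩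
  · rintro _ ⟨f, _, rfl⟩
    exact f.2
  · rintro _ ⟨f, hf, rfl⟩
    simpa using hts hf
  · intro x hx hxr
    have hx' : (⟨x, hx⟩ : E) ∈ Metric.closedBall (0 : E) r := by simpa using hxr
    obtain ⟨f, hf, hxf⟩ := Set.mem_iUnion₂.1 (ht hx')
    refine ⟨f, ⟨f, hf, rfl⟩, ?_⟩
    rw [Metric.mem_ball, dist_eq_norm] at hxf
    exact hxf.le

open scoped Pointwise in
/-- A functional on a finite-dimensional subspace `E` which is bounded by `C` on the trace of a
closed bounded absolutely convex set `K` extends to a continuous functional on the whole space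
which is bounded by `2 C` on `K`. -/
lemma exists_dual_extension_bounded_on {K : Set V} (hc : IsClosed K) (hconv : Convex ℝ K)
    (hbal : Balanced ℂ K) (h0 : (0 : V) ∈ K) {R : ℝ} (hR : ∀ x ∈ K, ‖x‖ ≤ R)
    (E : Submodule ℂ V) [FiniteDimensional ℂ E] (f : E →ₗ[ℂ] ℂ) {C : ℝ} (hC : 0 < C)
    (hf : ∀ e : E, (e : V) ∈ K → ‖f e‖ ≤ C) :
    ∃ g : StrongDual ℂ V, (∀ e : E, g e = f e) ∧ ∀ x ∈ K, ‖g x‖ ≤ 2 * C := by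
  -- `K` has no interior in general, so it is thickened by `δ`; the factor 2 pays for this. If no
  -- `δ` worked, there would be bounded `e n ∈ E` at distance tending to 0 from `K` with `‖f (e n)‖
  -- > 2 C`; a cluster point lies in `K ∩ E` and violates `hf`.
  obtain ⟨δ, hδ, hfδ⟩ : ∃ δ > 0, ∀ e : E, ∀ k ∈ K, ‖(e : V) - k‖ ≤ δ → ‖f e‖ ≤ 2 * C := by
    by_contra! hcon
    have hpos : ∀ n : ℕ, (0 : ℝ) < 1 / (n + 1) := fun n => by positivity
    choose e k hk hek hfe using fun n : ℕ => hcon _ (hpos n)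
    have : ProperSpace E := FiniteDimensional.proper ℂ E
    have hb : ∀ n, e n ∈ Metric.closedBall (0 : E) (R + 1) := by
      intro n
      rw [mem_closedBall_zero_iff]
      have h1 : ‖(e n : V)‖ ≤ ‖(e n : V) - k n‖ + ‖k n‖ := by
        simpa using norm_add_le ((e n : V) - k n) (k n)
      have h2 : (1 : ℝ) / (n + 1) ≤ 1 := by
        rw [div_le_one (by positivity)]; linarith [(Nat.cast_nonneg n : (0 : ℝ) ≤ n)]
      have h3 := hR _ (hk n)
      have h4 := hek n
      change ‖(e n : V)‖ ≤ R + 1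
      linarith
    obtain ⟨x, _, φ, hφ, hx⟩ := (isCompact_closedBall (0 : E) (R + 1)).tendsto_subseq hb
    have hxV : Filter.Tendsto (fun n => (e (φ n) : V)) Filter.atTop (𝓝 (x : V)) :=
      (continuous_subtype_val.tendsto x).comp hx
    have hd : Filter.Tendsto (fun n => (e (φ n) : V) - k (φ n)) Filter.atTop (𝓝 0) := by
      refine squeeze_zero_norm (fun n => hek (φ n)) ?_
      exact tendsto_one_div_add_atTop_nhds_zero_nat.comp hφ.tendsto_atTop
    have hkx : Filter.Tendsto (fun n => k (φ n)) Filter.atTop (𝓝 (x : V)) := by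
      simpa using hxV.sub hd
    have hxK : (x : V) ∈ K := hc.mem_of_tendsto hkx (Filter.Eventually.of_forall fun n => hk _)
    have hlim : Filter.Tendsto (fun n => ‖f (e (φ n))‖) Filter.atTop (𝓝 ‖f x‖) :=
      ((f.continuous_of_finiteDimensional.tendsto x).comp hx).norm
    have hge : 2 * C ≤ ‖f x‖ :=
      ge_of_tendsto hlim (Filter.Eventually.of_forall fun n => (hfe (φ n)).le)
    linarith [hf x hxK]
  have hUconv : Convex ℝ (K + Metric.ball (0 : V) δ) := hconv.add (convex_ball 0 δ)
  have hUbal : Balanced ℂ (K + Metric.ball (0 : V) δ) := hbal.add balanced_ball_zero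
  have hU0 : K + Metric.ball (0 : V) δ ∈ 𝓝 (0 : V) := by
    refine Filter.mem_of_superset (Metric.ball_mem_nhds 0 hδ) fun x hx => ?_
    exact Set.mem_add.2 ⟨0, h0, x, hx, zero_add x⟩
  have hUabs : Absorbent ℝ (K + Metric.ball (0 : V) δ) := absorbent_nhds_zero hU0
  -- The gauge of the thickened set is a continuous seminorm, at most 1 on `K`, so Hahn–Banach under
  -- `2 C` times the gauge gives a continuous extension.
  let p : Seminorm ℂ V :=
    (2 * C).toNNReal • gaugeSeminorm hUbal hUconv hUabs
  have hp : ∀ x, p x = 2 * C * gauge (K + Metric.ball (0 : V) δ) x := by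
    intro x
    have : ((2 * C).toNNReal : ℝ) = 2 * C := Real.coe_toNNReal _ (by positivity)
    change ((2 * C).toNNReal : ℝ) * _ = _
    rw [this]
    rfl
  have hpc : Continuous p := by
    rw [show (p : V → ℝ) = fun x => 2 * C * gauge (K + Metric.ball (0 : V) δ) x from funext hp]
    exact continuous_const.mul (continuous_gauge hUconv hU0)
  have hpf : ∀ e : E, ‖f e‖ ≤ p e := by
    intro e
    rw [hp]
    suffices h : ∀ r, gauge (K + Metric.ball (0 : V) δ) e < r → ‖f e‖ ≤ 2 * C * r by
      have h1 : ‖f e‖ / (2 * C) ≤ gauge (K + Metric.ball (0 : V) δ) e := by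
        refine le_of_forall_gt_imp_ge_of_dense fun r hr => ?_
        rw [div_le_iff₀ (by positivity), mul_comm]
        exact h r hr
      rwa [div_le_iff₀ (by positivity), mul_comm] at h1
    intro r hr
    obtain ⟨s, hs0, hsr, x, hx, hxe⟩ := exists_lt_of_gauge_lt hUabs hr
    obtain ⟨k, hk, b, hb, rfl⟩ := Set.mem_add.1 hx
    have h1 := hfδ ((((s⁻¹ : ℝ)) : ℂ) • e) k hk (by
      have : ((((s⁻¹ : ℝ)) : ℂ) • e : E) - k = b := by
        rw [Submodule.coe_smul, ← hxe, Complex.coe_smul]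
        simp only []
        rw [smul_smul, inv_mul_cancel₀ hs0.ne', one_smul, add_sub_cancel_left]
      rw [this]
      exact (mem_ball_zero_iff.1 hb).le)
    rw [map_smul, norm_smul, Complex.norm_real, norm_inv, Real.norm_of_nonneg hs0.le,
      inv_mul_le_iff₀ hs0] at h1
    nlinarith
  obtain ⟨g, hg, hgp⟩ := Module.Dual.exists_continuous_extension_of_le_seminorm E f hpc hpf
  refine ⟨g, hg, fun x hx => (hgp x).trans ?_⟩
  rw [hp]
  have : gauge (K + Metric.ball (0 : V) δ) x ≤ 1 :=
    gauge_le_one_of_mem (Set.mem_add.2 ⟨x, hx, 0, Metric.mem_ball_self hδ, add_zero x⟩)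
  nlinarith

end NormedSpaceGeometry

/-- A family over a countably infinite index set which vanishes at infinity can be enumerated as
a null sequence. -/
lemma exists_null_sequence_range_eq {V : Type*} [NormedAddCommGroup V] {ι : Type*}
    [Countable ι] [Infinite ι] {x : ι → V} (hx : Filter.Tendsto x Filter.cofinite (𝓝 0)) :
    ∃ y : ℕ → V, Filter.Tendsto y Filter.atTop (𝓝 0) ∧ Set.range y = Set.range x := by
  obtain ⟨_⟩ := nonempty_denumerable ι
  refine ⟨x ∘ (Denumerable.eqv ι).symm, ?_, (Denumerable.eqv ι).symm.surjective.range_comp x⟩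
  rw [← Nat.cofinite_eq_atTop]
  exact hx.comp (Denumerable.eqv ι).symm.injective.tendsto_cofinite

/-! ### Slice maps of the minimal tensor product -/

section RectangularMatrices

variable {B : Type*} [NonUnitalCStarAlgebra B] [PartialOrder B] [StarOrderedRing B]
variable {l m n : Type*} [Fintype l] [Fintype m] [Fintype n]

lemma CStarMatrix.toCLM_mul (M : CStarMatrix l m B) (N : CStarMatrix m n B) :
    CStarMatrix.toCLM (M * N) = (CStarMatrix.toCLM N).comp (CStarMatrix.toCLM M) := by
  ext v j
  simp only [CStarMatrix.toCLM_apply_eq_sum, CStarMatrix.mul_apply, ContinuousLinearMap.comp_apply]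
  simp only [WithCStarModule.equiv_symm_pi_apply, Finset.mul_sum, Finset.sum_mul, mul_assoc]
  exact Finset.sum_comm

lemma CStarMatrix.norm_rectangular_mul_le (M : CStarMatrix l m B) (N : CStarMatrix m n B) :
    ‖M * N‖ ≤ ‖M‖ * ‖N‖ := by
  simp only [CStarMatrix.norm_def, CStarMatrix.toCLM_mul]
  rw [mul_comm]
  exact ContinuousLinearMap.opNorm_comp_le _ _

/-- A row matrix has at most the norm of the vector. -/
lemma CStarMatrix.norm_row_le {m : ℕ} (v : WithCStarModule ℂ (Fin m → ℂ)) :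
    ‖CStarMatrix.ofMatrix (Matrix.of fun (_ : Fin 1) (i : Fin m) => v i)‖ ≤ ‖v‖ := by
  rw [CStarMatrix.norm_def]
  refine ContinuousLinearMap.opNorm_le_bound _ (norm_nonneg _) fun u => ?_
  have e : CStarMatrix.toCLM (CStarMatrix.ofMatrix
      (Matrix.of fun (_ : Fin 1) (i : Fin m) => v i)) u = u 0 • v := by
    ext j
    simp [CStarMatrix.toCLM_apply_eq_sum]
  rw [e, norm_smul, mul_comm]
  gcongr
  exact WithCStarModule.norm_apply_le_norm u 0

/-- A column matrix has at most the norm of the vector. -/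
lemma CStarMatrix.norm_col_le {m : ℕ} (w : WithCStarModule ℂ (Fin m → ℂ)) :
    ‖CStarMatrix.ofMatrix (Matrix.of fun (i : Fin m) (_ : Fin 1) => star (w i))‖ ≤ ‖w‖ := by
  rw [CStarMatrix.norm_def]
  refine ContinuousLinearMap.opNorm_le_bound _ (norm_nonneg _) fun u => ?_
  refine (WithCStarModule.pi_norm_le_sum_norm _).trans ?_
  have e : CStarMatrix.toCLM (CStarMatrix.ofMatrix
      (Matrix.of fun (i : Fin m) (_ : Fin 1) => star (w i))) u 0 = inner ℂ w u := by
    simp [CStarMatrix.toCLM_apply_eq_sum, WithCStarModule.pi_inner]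
  rw [Fin.sum_univ_one, e]
  exact CStarModule.norm_inner_le _

end RectangularMatrices

/-! ### Functionals as complete contractions. -/

section Functional

variable {V : Type*} [NormedAddCommGroup V] [NormedSpace ℂ V] [OperatorSpace V]

/-- Contractive functionals on an operator space are completely contractive. -/
lemma norm_map_functional_le (g : StrongDual ℂ V) (hg : ‖g‖ ≤ 1) (n : ℕ)
    (x : Matrix (Fin n) (Fin n) V) :
    ‖CStarMatrix.ofMatrix (x.map g)‖ ≤ OperatorSpace.matNorm n x := by
  have := CStarMatrix.norm_le_of_forall_inner_le (M := CStarMatrix.ofMatrix (x.map g))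
    (C := ⟨OperatorSpace.matNorm n x, apply_nonneg _ _⟩) fun v w => ?_
  · exact this
  -- The matrix coefficients of the amplification are `g` evaluated at the `1 × 1` compressions of
  -- `x`, whose norm Ruan's second axiom controls.
  have e : inner ℂ w (CStarMatrix.toCLM (CStarMatrix.ofMatrix (x.map g)) v) =
      g (scalarConj (Matrix.of fun (_ : Fin 1) (i : Fin n) => v i) x
        (Matrix.of fun (i : Fin n) (_ : Fin 1) => star (w i)) 0 0) := by
    simp [scalarConj, CStarMatrix.toCLM_apply_eq_sum, WithCStarModule.pi_inner,
      Finset.sum_mul]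
    rw [Finset.sum_comm]
    refine Finset.sum_congr rfl fun i _ => Finset.sum_congr rfl fun j _ => by ring
  rw [e]
  refine (g.le_of_opNorm_le hg _).trans ?_
  rw [one_mul, ← OperatorSpace.matNorm_one]
  refine (OperatorSpace.matNorm_scalarConj_le _ _ _).trans ?_
  calc _ ≤ ‖v‖ * OperatorSpace.matNorm n x * ‖w‖ := by
        gcongr
        · exact CStarMatrix.norm_row_le v
        · exact CStarMatrix.norm_col_le w
    _ = _ := by
        change _ = OperatorSpace.matNorm n x * ‖v‖ * ‖w‖
        ring

/-- A functional as a map into the `1 × 1` matrices. -/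
def functionalMatrix (g : StrongDual ℂ V) : V →ₗ[ℂ] CStarMatrix (Fin 1) (Fin 1) ℂ where
  toFun v := diagHom 1 (g v)
  map_add' v w := by rw [map_add, map_add]
  map_smul' c v := by rw [map_smul, map_smul, RingHom.id_apply]

lemma functionalMatrix_apply (g : StrongDual ℂ V) (v : V) (i j : Fin 1) :
    functionalMatrix g v i j = g v := by
  rw [functionalMatrix, LinearMap.coe_mk, AddHom.coe_mk, diagHom_apply,
    if_pos (Subsingleton.elim i j)]

lemma isCompletelyContractive_functionalMatrix (g : StrongDual ℂ V) (hg : ‖g‖ ≤ 1) :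
    IsCompletelyContractive (functionalMatrix g) := by
  intro n x
  refine le_trans ?_ (norm_map_functional_le g hg n x)
  let Φ : CStarMatrix (Fin n) (Fin n) ℂ →⋆ₙₐ[ℂ]
      CStarMatrix (Fin n) (Fin n) (CStarMatrix (Fin 1) (Fin 1) ℂ) := CStarMatrix.mapₙₐ (diagHom 1)
  have e : CStarMatrix.ofMatrix (x.map (functionalMatrix g)) =
      Φ (CStarMatrix.ofMatrix (x.map g)) := rfl
  rw [e]
  exact NonUnitalStarAlgHom.norm_apply_le Φ _

end Functional

/-! ### Slicing `A ⊗_min V` by functionals of `V`. -/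

section Slices

variable {A : Type*} [NonUnitalCStarAlgebra A] [PartialOrder A] [StarOrderedRing A]
variable {V : Type*} [NormedAddCommGroup V] [NormedSpace ℂ V] [OperatorSpace V]

variable (A) in
/-- The slice map `id ⊗ g : A ⊗ V → A` on the algebraic tensor product. -/
def tensorSlice (g : StrongDual ℂ V) : A ⊗[ℂ] V →ₗ[ℂ] A :=
  (TensorProduct.rid ℂ A).toLinearMap ∘ₗ LinearMap.lTensor A g.toLinearMap

@[simp] lemma tensorSlice_tmul (g : StrongDual ℂ V) (a : A) (v : V) :
    tensorSlice A g (a ⊗ₜ v) = g v • a := by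
  simp [tensorSlice]

lemma tensorSlice_smul (c : ℂ) (g : StrongDual ℂ V) (u : A ⊗[ℂ] V) :
    tensorSlice A (c • g) u = c • tensorSlice A g u := by
  induction u with
  | zero => simp
  | tmul a v => simp [smul_smul]
  | add x y hx hy => rw [map_add, map_add, hx, hy, smul_add]

lemma tensorSlice_zero (u : A ⊗[ℂ] V) : tensorSlice A (0 : StrongDual ℂ V) u = 0 := by
  induction u with
  | zero => simp
  | tmul a v => simp
  | add x y hx hy => rw [map_add, hx, hy, add_zero]

lemma tensorSlice_eq_sliceMap (g : StrongDual ℂ V) (u : A ⊗[ℂ] V) :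
    tensorSlice A g u = sliceMap (functionalMatrix g) u 0 0 := by
  induction u with
  | zero => simp
  | tmul a v => rw [sliceMap_tmul, functionalMatrix_apply, tensorSlice_tmul]
  | add x y hx hy => rw [map_add, map_add, CStarMatrix.add_apply, hx, hy]

/-- A contractive functional is one of the complete contractions `V → M_q` (with `q = 1`) over which
the minimal norm takes its supremum. -/
lemma norm_tensorSlice_le (g : StrongDual ℂ V) (u : A ⊗[ℂ] V) :
    ‖tensorSlice A g u‖ ≤ ‖g‖ * minSeminorm A V u := by
  have key : ∀ h : StrongDual ℂ V, ‖h‖ ≤ 1 → ‖tensorSlice A h u‖ ≤ minSeminorm A V u := by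
    intro h hh
    rw [tensorSlice_eq_sliceMap]
    exact CStarMatrix.norm_entry_le_norm.trans (sliceSeminorm_le_minSeminorm (A := A)
      (⟨1, functionalMatrix h, isCompletelyContractive_functionalMatrix h hh⟩ :
        MatrixContraction V) u)
  by_cases hg : g = 0
  · rw [hg, tensorSlice_zero, norm_zero, norm_zero, zero_mul]
  · have hn : ‖g‖ ≠ 0 := norm_ne_zero_iff.2 hg
    have h1 := key (((‖g‖⁻¹ : ℝ) : ℂ) • g) (by
      rw [norm_smul, Complex.norm_real, norm_inv, norm_norm, inv_mul_cancel₀ hn])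
    rw [tensorSlice_smul, norm_smul, Complex.norm_real, norm_inv, norm_norm,
      inv_mul_le_iff₀ (lt_of_le_of_ne (norm_nonneg g) hn.symm)] at h1
    exact h1

variable (A) in
/-- The slice map on `A ⊗ V` with the minimal norm. -/
def algSlice (g : StrongDual ℂ V) : AlgMinTensor A V →ₗ[ℂ] A := tensorSlice A g

lemma norm_algSlice_le (g : StrongDual ℂ V) (u : AlgMinTensor A V) :
    ‖algSlice A g u‖ ≤ ‖g‖ * ‖u‖ :=
  norm_tensorSlice_le g u

variable (A) in
/-- The slice map `id ⊗ g : A ⊗_min V → A` of a bounded functional `g` on `V`. -/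
def minSlice (g : StrongDual ℂ V) : MinTensor A V →L[ℂ] A :=
  (algSlice A g).extendOfNorm
    (UniformSpace.Completion.toComplL (𝕜 := ℂ) (E := AlgMinTensor A V)).toLinearMap

lemma minSlice_coe (g : StrongDual ℂ V) (u : AlgMinTensor A V) :
    minSlice A g u = algSlice A g u :=
  LinearMap.extendOfNorm_eq (UniformSpace.Completion.denseRange_coe)
    ⟨‖g‖, fun u => by simpa using norm_algSlice_le g u⟩ u

lemma minSlice_minTmul (g : StrongDual ℂ V) (a : A) (v : V) :
    minSlice A g (minTmul a v) = g v • a := by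
  rw [minTmul, minSlice_coe]
  exact tensorSlice_tmul g a v

lemma norm_minSlice_le (g : StrongDual ℂ V) (x : MinTensor A V) :
    ‖minSlice A g x‖ ≤ ‖g‖ * ‖x‖ :=
  LinearMap.norm_extendOfNorm_apply_le (UniformSpace.Completion.denseRange_coe) ‖g‖
    (fun u => by simpa using norm_algSlice_le g u) x

variable (A V) in
/-- The bilinear map `(a, v) ↦ a ⊗ v` into `A ⊗_min V`. -/
def minTmulL : A →ₗ[ℂ] V →ₗ[ℂ] MinTensor A V :=
  (TensorProduct.mk ℂ A V).compr₂
    (UniformSpace.Completion.toComplL (𝕜 := ℂ) (E := AlgMinTensor A V)).toLinearMap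

lemma continuous_minTmul_left (v : V) : Continuous fun a : A => minTmul a v :=
  AddMonoidHomClass.continuous_of_bound ((minTmulL A V).flip v) ‖v‖ fun a => by
    rw [mul_comm]; exact norm_minTmul_le a v

lemma continuous_minTmul_right (a : A) : Continuous fun v : V => minTmul a v :=
  AddMonoidHomClass.continuous_of_bound (minTmulL A V a) ‖a‖ fun v => norm_minTmul_le a v

lemma bimul_minTmul (a b c : A) (v : V) : bimul A a (minTmul b v) c = minTmul (a * b * c) v := by
  change minLeft A V a (minRight A V c (minTmul b v)) = _
  rw [minRight_minTmul, minLeft_minTmul, mul_assoc]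

lemma bimul_self (a b c : A) : bimul A a b c = a * b * c := by
  change a * (b * c) = _
  rw [mul_assoc]

/-- The algebraic tensors are finite sums of elementary tensors. -/
lemma coe_algMinTensor_eq_sum (u : AlgMinTensor A V) :
    ∃ (k : ℕ) (a : Fin k → A) (v : Fin k → V), (u : MinTensor A V) = ∑ i, minTmul (a i) (v i) := by
  induction (u : A ⊗[ℂ] V) using TensorProduct.induction_on with
  | zero =>
    refine ⟨0, 0, 0, ?_⟩
    rw [Finset.univ_eq_empty, Finset.sum_empty]
    exact UniformSpace.Completion.coe_zero (α := AlgMinTensor A V)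
  | tmul a v => exact ⟨1, fun _ => a, fun _ => v, by simp [minTmul]⟩
  | add x y hx hy =>
    obtain ⟨k, a, v, h⟩ := hx
    obtain ⟨k', a', v', h'⟩ := hy
    refine ⟨k + k', Fin.append a a', Fin.append v v', ?_⟩
    rw [Fin.sum_univ_add]
    simp only [Fin.append_left, Fin.append_right]
    rw [← h, ← h']
    exact UniformSpace.Completion.coe_add (α := AlgMinTensor A V) x y

/-- A closed condition stable under sums that holds for elementary tensors holds everywhere. -/
lemma minTensor_induction {p : MinTensor A V → Prop} (hp : IsClosed {x | p x})
    (hadd : ∀ x y, p x → p y → p (x + y)) (h0 : p 0) (h : ∀ a v, p (minTmul a v))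
    (x : MinTensor A V) : p x := by
  induction x using UniformSpace.Completion.induction_on with
  | hp => exact hp
  | ih u =>
    obtain ⟨k, a, v, hu⟩ := coe_algMinTensor_eq_sum u
    rw [hu]
    exact Finset.sum_induction _ p hadd h0 fun i _ => h _ _

lemma isBilinearOver_minSlice (g : StrongDual ℂ V) : IsBilinearOver A (minSlice A g) := by
  intro a b w
  refine minTensor_induction (p := fun w => minSlice A g (bimul A a w b) =
    bimul A a (minSlice A g w) b) ?_ ?_ ?_ ?_ w
  · exact isClosed_eq ((minSlice A g).continuous.comp (continuous_bimul a b))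
      ((continuous_bimul a b).comp (minSlice A g).continuous)
  · intro x y hx hy
    rw [bimul_add, map_add, hx, hy, map_add, bimul_add]
  · rw [bimul_zero, map_zero, bimul_zero]
  · intro c v
    rw [bimul_minTmul, minSlice_minTmul, minSlice_minTmul, bimul_smul, bimul_self]

end Slices

/-! ### Bimodule maps of a C*-algebra -/

section BimoduleMultipliers

open scoped MultiplierAlgebra

variable {A : Type*} [NonUnitalCStarAlgebra A] [PartialOrder A] [StarOrderedRing A]

lemma eq_of_forall_mul_left {x y : A} (h : ∀ z, z * x = z * y) : x = y := by
  have h1 := h (star (x - y))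
  rw [← sub_eq_zero, ← mul_sub, CStarRing.star_mul_self_eq_zero_iff] at h1
  exact sub_eq_zero.1 h1

lemma eq_of_forall_mul_right {x y : A} (h : ∀ z, x * z = y * z) : x = y := by
  have h1 := h (star (x - y))
  rw [← sub_eq_zero, ← sub_mul, CStarRing.mul_star_self_eq_zero_iff] at h1
  exact sub_eq_zero.1 h1

/-- Bilinearity only speaks of two-sided products. Multiplying by arbitrary `z` and `w` from the two
sides makes it applicable, and both factors can be cancelled because no nonzero element of a
C*-algebra annihilates it from either side. -/
lemma IsBilinearOver.map_mul_left {L : A →L[ℂ] A} (hL : IsBilinearOver A L) (x y : A) :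
    L (x * y) = x * L y := by
  have h : ∀ a b c : A, L (a * b * c) = a * L b * c := by
    intro a b c
    have := hL a c b
    change L (a * (b * c)) = a * (L b * c) at this
    rw [mul_assoc, this, mul_assoc]
  refine eq_of_forall_mul_left fun z => eq_of_forall_mul_right fun w => ?_
  rw [← h, ← mul_assoc z x y, h, mul_assoc z x]

lemma IsBilinearOver.map_mul_right {L : A →L[ℂ] A} (hL : IsBilinearOver A L) (x y : A) :
    L (x * y) = L x * y := by
  have h : ∀ a b c : A, L (a * b * c) = a * L b * c := by
    intro a b c
    have := hL a c b
    change L (a * (b * c)) = a * (L b * c) at this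
    rw [mul_assoc, this, mul_assoc]
  refine eq_of_forall_mul_left fun z => eq_of_forall_mul_right fun w => ?_
  rw [← h, mul_assoc z (x * y) w, mul_assoc x y w, ← mul_assoc z x (y * w), h]
  simp only [mul_assoc]

lemma doubleCentralizer_fst_mul (m : 𝓜(ℂ, A)) (x y : A) :
    m.fst (x * y) = m.fst x * y := by
  refine eq_of_forall_mul_left fun z => ?_
  rw [← m.central, ← mul_assoc, m.central, mul_assoc]

lemma mul_fst_of_fst_eq_snd {m : 𝓜(ℂ, A)} (hm : m.fst = m.snd) (x y : A) :
    m.fst (x * y) = x * m.fst y := by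
  rw [doubleCentralizer_fst_mul m, ← m.central, hm]

/-- A bimodule map can be moved from one factor of a product to the other: after multiplication by
`y`, both composites equal `n.fst x * m.fst y`. -/
lemma fst_comm_of_fst_eq_snd {m : 𝓜(ℂ, A)} (hm : m.fst = m.snd) (n : 𝓜(ℂ, A)) :
    m.fst * n.fst = n.fst * m.fst := by
  ext x
  refine eq_of_forall_mul_right fun y => ?_
  change m.fst (n.fst x) * y = n.fst (m.fst x) * y
  rw [← doubleCentralizer_fst_mul m (n.fst x) y, mul_fst_of_fst_eq_snd hm,
    ← doubleCentralizer_fst_mul n (m.fst x) y, ← doubleCentralizer_fst_mul m x y,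
    mul_fst_of_fst_eq_snd hm, doubleCentralizer_fst_mul n]

variable (A) in
/-- The multipliers of `A` whose left and right actions agree, that is, the bounded bimodule
maps from `A` to `A`. -/
def bimoduleMultipliers : StarSubalgebra ℂ 𝓜(ℂ, A) where
  carrier := {m | m.fst = m.snd}
  mul_mem' {m n} hm hn := by
    change (m * n).fst = (m * n).snd
    rw [DoubleCentralizer.mul_fst, DoubleCentralizer.mul_snd, fst_comm_of_fst_eq_snd hm n,
      show m.fst = m.snd from hm, show n.fst = n.snd from hn]
  add_mem' {m n} hm hn := by
    change (m + n).fst = (m + n).snd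
    rw [DoubleCentralizer.add_fst, DoubleCentralizer.add_snd,
      show m.fst = m.snd from hm, show n.fst = n.snd from hn]
  algebraMap_mem' c := by
    change (algebraMap ℂ 𝓜(ℂ, A) c).fst = (algebraMap ℂ 𝓜(ℂ, A) c).snd
    rw [DoubleCentralizer.algebraMap_fst, DoubleCentralizer.algebraMap_snd]
  star_mem' {m} hm := by
    change (star m).fst = (star m).snd
    ext b
    rw [DoubleCentralizer.star_fst, DoubleCentralizer.star_snd, show m.fst = m.snd from hm]

instance isClosed_bimoduleMultipliers : IsClosed (bimoduleMultipliers A : Set 𝓜(ℂ, A)) := by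
  have h1 : Continuous fun m : 𝓜(ℂ, A) => m.fst - m.snd := by
    refine AddMonoidHomClass.continuous_of_bound
      ({ toFun := fun m : 𝓜(ℂ, A) => m.fst - m.snd
         map_zero' := by simp
         map_add' := fun m n => by
          rw [DoubleCentralizer.add_fst, DoubleCentralizer.add_snd]; abel } :
        𝓜(ℂ, A) →+ (A →L[ℂ] A)) 2 fun m => ?_
    refine (norm_sub_le _ _).trans ?_
    rw [DoubleCentralizer.norm_fst, DoubleCentralizer.norm_snd, two_mul]
  have h2 : (bimoduleMultipliers A : Set 𝓜(ℂ, A)) = {m | m.fst - m.snd = 0} := by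
    ext m
    exact sub_eq_zero.symm
  rw [h2]
  exact isClosed_eq h1 continuous_const

/-- Commutativity opens the way to Gelfand duality: bimodule maps of `A` become continuous functions
on a compact space, where they can be treated pointwise. -/
instance : CommCStarAlgebra (bimoduleMultipliers A) where
  mul_comm m n := by
    refine Subtype.ext (DoubleCentralizer.ext ℂ A _ _ (Prod.ext ?_ ?_))
    · exact fst_comm_of_fst_eq_snd m.2 (n : 𝓜(ℂ, A))
    · have := fst_comm_of_fst_eq_snd n.2 (m : 𝓜(ℂ, A))
      rw [m.2, n.2] at this
      exact this
  toCompleteSpace := (isClosed_bimoduleMultipliers (A := A)).completeSpace_coe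
  norm_mul_self_le x := CStarRing.norm_star_mul_self (x := (x : 𝓜(ℂ, A))) |>.symm.le

/-- A bounded bimodule map as a multiplier. -/
def toBimoduleMultiplier (L : A →L[ℂ] A) (hL : IsBilinearOver A L) : bimoduleMultipliers A :=
  ⟨⟨(L, L), fun x y => by
    change L x * y = x * L y
    rw [← hL.map_mul_left, hL.map_mul_right]⟩, rfl⟩

/-- The action of a bimodule multiplier on `A`. -/
def bimoduleMultiplierAction : bimoduleMultipliers A →ₗ[ℂ] A →L[ℂ] A where
  toFun m := (m : 𝓜(ℂ, A)).fst
  map_add' _ _ := rfl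
  map_smul' _ _ := rfl

lemma bimoduleMultiplierAction_toBimoduleMultiplier (L : A →L[ℂ] A) (hL : IsBilinearOver A L) :
    bimoduleMultiplierAction (toBimoduleMultiplier L hL) = L := rfl

lemma norm_bimoduleMultiplierAction (m : bimoduleMultipliers A) :
    ‖bimoduleMultiplierAction m‖ = ‖m‖ :=
  DoubleCentralizer.norm_fst _

lemma bimoduleMultiplierAction_injective :
    Function.Injective (bimoduleMultiplierAction (A := A)) := by
  intro m n h
  rw [← sub_eq_zero, ← norm_eq_zero, ← norm_bimoduleMultiplierAction, map_sub, h, sub_self,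
    norm_zero]

lemma bimoduleMultiplierAction_mul_left (m : bimoduleMultipliers A) (x y : A) :
    bimoduleMultiplierAction m (x * y) = x * bimoduleMultiplierAction m y :=
  mul_fst_of_fst_eq_snd m.2 x y

lemma bimoduleMultiplierAction_mul_right (m : bimoduleMultipliers A) (x y : A) :
    bimoduleMultiplierAction m (x * y) = bimoduleMultiplierAction m x * y :=
  doubleCentralizer_fst_mul _ x y

lemma bimoduleMultiplierAction_mul (m n : bimoduleMultipliers A) (x : A) :
    bimoduleMultiplierAction (m * n) x =
      bimoduleMultiplierAction m (bimoduleMultiplierAction n x) := rfl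

lemma bimoduleMultiplierAction_one (x : A) :
    bimoduleMultiplierAction (1 : bimoduleMultipliers A) x = x := rfl

lemma star_bimoduleMultiplierAction (m : bimoduleMultipliers A) (x : A) :
    star (bimoduleMultiplierAction m x) = bimoduleMultiplierAction (star m) (star x) := by
  change star ((m : 𝓜(ℂ, A)).fst x) = (star (m : 𝓜(ℂ, A))).fst (star x)
  rw [DoubleCentralizer.star_fst, star_star, show (m : 𝓜(ℂ, A)).fst = _ from m.2]

variable {W : Type*} [NormedAddCommGroup W] [NormedSpace ℂ W] [CStarOperatorSpace A W]

lemma IsBilinearOver.action_comp {φ : W →L[ℂ] A} (hφ : IsBilinearOver A φ)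
    (m : bimoduleMultipliers A) : IsBilinearOver A ((bimoduleMultiplierAction m).comp φ) := by
  intro a b w
  rw [ContinuousLinearMap.comp_apply, hφ, ContinuousLinearMap.comp_apply]
  change bimoduleMultiplierAction m (a * (φ w * b)) = a * (bimoduleMultiplierAction m (φ w) * b)
  rw [bimoduleMultiplierAction_mul_left, bimoduleMultiplierAction_mul_right]

lemma IsBilinearOver.sum {ι : Type*} {X : Type*} [NormedAddCommGroup X] [NormedSpace ℂ X]
    [CStarOperatorSpace A X] (s : Finset ι) {φ : ι → W →L[ℂ] X}
    (hφ : ∀ i ∈ s, IsBilinearOver A (φ i)) : IsBilinearOver A (∑ i ∈ s, φ i) := by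
  classical
  induction s using Finset.induction_on with
  | empty =>
    intro a b w
    simp [bimul_zero]
  | insert i s his ih =>
    intro a b w
    rw [Finset.sum_insert his, _root_.add_apply, _root_.add_apply, bimul_add,
      hφ i (Finset.mem_insert_self i s), ih fun j hj => hφ j (Finset.mem_insert_of_mem hj)]

/-- The norm estimate for a row times a diagonal matrix times a column. -/
lemma norm_sum_row_col_le {ι : Type*} [Fintype ι] (a b x : ι → A) {c : ℝ} (hc : 0 ≤ c)
    (ha : ‖∑ i, a i * star (a i)‖ ≤ 1) (hb : ‖∑ i, star (b i) * b i‖ ≤ 1)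
    (hx : ∀ i, ‖x i‖ ≤ c) : ‖∑ i, a i * (x i * b i)‖ ≤ c := by
  -- The bound is Cauchy–Schwarz in the Hilbert module `Aᶥ`, with the `x i` absorbed into the
  -- column.
  let X : WithCStarModule A (ι → A) := (WithCStarModule.equiv A (ι → A)).symm a
  let Y : WithCStarModule A (ι → A) :=
    (WithCStarModule.equiv A (ι → A)).symm fun i => star (x i * b i)
  have hXY : inner A Y X = ∑ i, a i * (x i * b i) := by
    simp [X, Y, WithCStarModule.pi_inner, WithCStarModule.inner_def]
  have hX : ‖X‖ ≤ 1 := by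
    rw [← sq_le_one_iff₀ (norm_nonneg _), WithCStarModule.pi_norm_sq]
    simpa [X, WithCStarModule.inner_def] using ha
  have hxb : ∀ i, star (x i * b i) * (x i * b i) ≤ c ^ 2 • (star (b i) * b i) := by
    intro i
    have h := CStarAlgebra.star_left_conjugate_le_norm_smul (a := b i) (b := star (x i) * x i)
      (IsSelfAdjoint.star_mul_self (x i))
    have e : star (x i * b i) * (x i * b i) = star (b i) * (star (x i) * x i) * b i := by
      simp [mul_assoc]
    rw [e]
    refine h.trans (smul_le_smul_of_nonneg_right ?_ (star_mul_self_nonneg (b i)))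
    rw [CStarRing.norm_star_mul_self, sq]
    have := hx i
    gcongr
  have hY : ‖Y‖ ≤ c := by
    rw [← sq_le_sq₀ (norm_nonneg _) hc, WithCStarModule.pi_norm_sq]
    have e : ∑ i, inner A (Y i) (Y i) = ∑ i, star (x i * b i) * (x i * b i) := by
      simp [Y, WithCStarModule.inner_def]
    rw [e]
    refine (CStarAlgebra.norm_le_norm_of_nonneg_of_le
      (Finset.sum_nonneg fun i _ => star_mul_self_nonneg _)
      (Finset.sum_le_sum fun i _ => hxb i)).trans ?_
    rw [← Finset.smul_sum, norm_smul, Real.norm_of_nonneg (by positivity)]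
    nlinarith [sq_nonneg c]
  rw [← hXY]
  refine (CStarModule.norm_inner_le _).trans ?_
  nlinarith [norm_nonneg X, norm_nonneg Y]

/-- The operator of multiplication by a continuous function on the spectrum of the algebra of
bimodule multipliers. -/
def functionAction :
    C(WeakDual.characterSpace ℂ (bimoduleMultipliers A), ℂ) →ₗ[ℂ] A →L[ℂ] A :=
  bimoduleMultiplierAction ∘ₗ
    (gelfandStarTransform (bimoduleMultipliers A)).symm.toAlgEquiv.toLinearMap

lemma functionAction_apply (h : C(WeakDual.characterSpace ℂ (bimoduleMultipliers A), ℂ)) :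
    functionAction h =
      bimoduleMultiplierAction ((gelfandStarTransform (bimoduleMultipliers A)).symm h) := rfl

/-- Convex combinations with continuous coefficients do not increase the norm. -/
lemma norm_sum_functionAction_le {ι : Type*} [Fintype ι]
    (h : ι → C(WeakDual.characterSpace ℂ (bimoduleMultipliers A), ℝ))
    (hnonneg : ∀ i t, 0 ≤ h i t) (hsum : ∀ t, ∑ i, h i t = 1) (x : ι → A) {c : ℝ}
    (hc : 0 ≤ c) (hx : ∀ i, ‖x i‖ ≤ c) :
    ‖∑ i, functionAction ((⟨Complex.ofReal, Complex.continuous_ofReal⟩ : C(ℝ, ℂ)).comp (h i))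
      (x i)‖ ≤ c := by
  let G := gelfandStarTransform (bimoduleMultipliers A)
  -- The square roots of the weights give self-adjoint multipliers `S i` with `∑ S i * S i = 1`. As
  -- the `S i` need not lie in `A`, the row and column coefficients below are `S i` applied to an
  -- approximate unit.
  let k : ι → C(WeakDual.characterSpace ℂ (bimoduleMultipliers A), ℂ) := fun i =>
    (⟨Complex.ofReal, Complex.continuous_ofReal⟩ : C(ℝ, ℂ)).comp
      ((⟨Real.sqrt, Real.continuous_sqrt⟩ : C(ℝ, ℝ)).comp (h i))
  have hk : ∀ i, k i * k i =
      (⟨Complex.ofReal, Complex.continuous_ofReal⟩ : C(ℝ, ℂ)).comp (h i) := by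
    intro i
    ext t
    simp only [k, ContinuousMap.mul_apply, ContinuousMap.comp_apply, ContinuousMap.coe_mk]
    rw [← Complex.ofReal_mul, Real.mul_self_sqrt (hnonneg i t)]
  have hks : ∀ i, star (k i) = k i := by
    intro i
    ext t
    simp [k]
  have hk1 : ∑ i, k i * k i = 1 := by
    ext t
    simp only [hk, ContinuousMap.coe_sum, Finset.sum_apply, ContinuousMap.comp_apply,
      ContinuousMap.coe_mk, ContinuousMap.one_apply]
    rw [← Complex.ofReal_sum, hsum, Complex.ofReal_one]
  let S : ι → bimoduleMultipliers A := fun i => G.symm (k i)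
  have hSs : ∀ i, star (S i) = S i := fun i => by
    simp only [S]
    rw [← map_star, hks]
  have hS1 : ∑ i, S i * S i = 1 := by
    simp only [S, ← map_mul, ← map_sum, hk1, map_one]
  have hSx : ∀ (i) (y z w : A), bimoduleMultiplierAction (S i) y *
      (z * bimoduleMultiplierAction (S i) w) =
      y * (bimoduleMultiplierAction (S i * S i) z * w) := by
    intro i y z w
    rw [← bimoduleMultiplierAction_mul_left, ← bimoduleMultiplierAction_mul_right,
      ← bimoduleMultiplierAction_mul_left, ← bimoduleMultiplierAction_mul,
      bimoduleMultiplierAction_mul_left, bimoduleMultiplierAction_mul_right]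
  have hsumS : ∀ z : A, ∑ i, bimoduleMultiplierAction (S i * S i) z = z := by
    intro z
    have : bimoduleMultiplierAction (∑ i, S i * S i) z = z := by
      rw [hS1, bimoduleMultiplierAction_one]
    rwa [map_sum, _root_.sum_apply] at this
  have hu := CStarAlgebra.increasingApproximateUnit A
  set z := ∑ i, functionAction
    ((⟨Complex.ofReal, Complex.continuous_ofReal⟩ : C(ℝ, ℂ)).comp (h i)) (x i) with hz
  have hz' : z = ∑ i, bimoduleMultiplierAction (S i * S i) (x i) := by
    rw [hz]
    refine Finset.sum_congr rfl fun i _ => ?_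
    rw [← hk, functionAction_apply, map_mul]
  refine le_of_tendsto (tendsto_approx z).norm ?_
  filter_upwards [hu.eventually_norm, hu.eventually_star_eq] with e he hes
  have hsq : ‖e * e‖ ≤ 1 := (norm_mul_le _ _).trans (by nlinarith [norm_nonneg e])
  have hSe : ∀ i, bimoduleMultiplierAction (S i) e * bimoduleMultiplierAction (S i) e =
      bimoduleMultiplierAction (S i * S i) (e * e) := by
    intro i
    rw [← bimoduleMultiplierAction_mul_left, ← bimoduleMultiplierAction_mul_right,
      ← bimoduleMultiplierAction_mul]
  have hse : ∀ i, star (bimoduleMultiplierAction (S i) e) = bimoduleMultiplierAction (S i) e := by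
    intro i
    rw [star_bimoduleMultiplierAction, hSs, hes]
  have key := norm_sum_row_col_le (fun i => bimoduleMultiplierAction (S i) e)
    (fun i => bimoduleMultiplierAction (S i) e) x hc
    (by simp only [hse, hSe, hsumS]; exact hsq) (by simp only [hse, hSe, hsumS]; exact hsq) hx
  simp only [hSx] at key
  rw [← Finset.mul_sum, ← Finset.sum_mul, ← hz'] at key
  exact key

end BimoduleMultipliers

/-! ### The gauge of an `A`-convex set -/

section GaugeSpace

variable {A : Type*} [NonUnitalCStarAlgebra A] [PartialOrder A] [StarOrderedRing A]

variable (A) in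
/-- A bounded closed absolutely `A`-convex set and a sub-bimodule in which its trace is absorbing,
such that the sub-bimodule is essential with respect to the gauge of the set. -/
structure GaugeData (X : Type*) [NormedAddCommGroup X] [NormedSpace ℂ X]
    [CStarOperatorSpace A X] where
  ball : Set X
  space : Submodule ℂ X
  bound : ℝ
  isClosed_ball : IsClosed ball
  isAConvex_ball : IsAConvex A ball
  norm_le_bound : ∀ x ∈ ball, ‖x‖ ≤ bound
  zero_mem_ball : (0 : X) ∈ ball
  lsmul_mem : ∀ (a : A), ∀ x ∈ space, (CStarOperatorSpace.lsmul a x : X) ∈ space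
  rsmul_mem : ∀ (a : A), ∀ x ∈ space, (CStarOperatorSpace.rsmul a x : X) ∈ space
  absorbing : ∀ x ∈ space, ∃ r : ℝ, 0 < r ∧ ∃ k ∈ ball, x = (r : ℂ) • k
  essential : ∀ x ∈ space, ∀ ε : ℝ, 0 < ε →
    ∃ y ∈ Submodule.span ℂ {v : X | ∃ (a b : A), ∃ w ∈ space, v = bimul A a w b},
      ∃ k ∈ ball, x - y = (ε : ℂ) • k

namespace GaugeData

variable {X : Type*} [NormedAddCommGroup X] [NormedSpace ℂ X] [CStarOperatorSpace A X]
variable (d : GaugeData A X)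

/-- The sub-bimodule, normed by the gauge of the set. -/
def Carrier : Type _ := d.space

instance : AddCommGroup d.Carrier := inferInstanceAs (AddCommGroup d.space)

instance : Module ℂ d.Carrier := inferInstanceAs (Module ℂ d.space)

/-- The inclusion of the gauge space in the ambient space. -/
def incl : d.Carrier →ₗ[ℂ] X := d.space.subtype

lemma incl_mem (w : d.Carrier) : d.incl w ∈ d.space := Subtype.property (p := (· ∈ d.space)) w

lemma incl_injective : Function.Injective d.incl := Subtype.val_injective

/-- An element of the sub-bimodule as an element of the gauge space. -/
def ofMem (x : X) (hx : x ∈ d.space) : d.Carrier := (⟨x, hx⟩ : d.space)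

@[simp] lemma incl_ofMem (x : X) (hx : x ∈ d.space) : d.incl (d.ofMem x hx) = x := rfl

/-- The trace of the set on the sub-bimodule. -/
def unitBall : Set d.Carrier := d.incl ⁻¹' d.ball

lemma balanced_unitBall : Balanced ℂ d.unitBall := by
  rintro c hc _ ⟨w, hw, rfl⟩
  change d.incl (c • w) ∈ d.ball
  rw [map_smul]
  exact (d.isAConvex_ball.balanced d.isClosed_ball).smul_mem hc hw

lemma convex_unitBall : Convex ℝ d.unitBall := by
  intro v hv w hw s t hs ht hst
  change d.incl (s • v + t • w) ∈ d.ball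
  have e : d.incl (s • v + t • w) = s • d.incl v + t • d.incl w := by
    rw [← Complex.coe_smul, ← Complex.coe_smul, map_add, map_smul, map_smul, Complex.coe_smul,
      Complex.coe_smul]
  rw [e]
  exact d.isAConvex_ball.convex d.isClosed_ball hv hw hs ht hst

lemma absorbent_unitBall : Absorbent ℝ d.unitBall := by
  rw [absorbent_iff_eventually_nhdsNE_zero]
  intro w
  obtain ⟨r, hr, k, hk, hw⟩ := d.absorbing _ (d.incl_mem w)
  have h1 : Metric.ball (0 : ℝ) (1 / r) ∈ 𝓝 (0 : ℝ) := Metric.ball_mem_nhds _ (by positivity)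
  filter_upwards [nhdsWithin_le_nhds h1] with c hc
  change d.incl (c • w) ∈ d.ball
  rw [← Complex.coe_smul, map_smul, hw, smul_smul]
  refine (d.isAConvex_ball.balanced d.isClosed_ball).smul_mem ?_ hk
  rw [mem_ball_zero_iff, lt_div_iff₀ hr] at hc
  rw [norm_mul, Complex.norm_real, Complex.norm_real, Real.norm_of_nonneg hr.le]
  exact hc.le

/-- The gauge seminorm. -/
def seminorm : Seminorm ℂ d.Carrier :=
  gaugeSeminorm d.balanced_unitBall d.convex_unitBall d.absorbent_unitBall

lemma seminorm_le_of_eq_smul {w : d.Carrier} {r : ℝ} (hr : 0 ≤ r) {k : X} (hk : k ∈ d.ball)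
    (hw : d.incl w = (r : ℂ) • k) : d.seminorm w ≤ r := by
  rcases hr.eq_or_lt with rfl | hr
  · have : w = 0 := d.incl_injective (by rw [hw, map_zero]; simp)
    rw [this, map_zero]
  · refine gauge_le_of_mem hr.le ⟨(((r⁻¹ : ℝ)) : ℂ) • w, ?_, ?_⟩
    · change d.incl _ ∈ d.ball
      rw [map_smul, hw, smul_smul, ← Complex.ofReal_mul, inv_mul_cancel₀ hr.ne']
      simpa using hk
    · simp only []
      rw [← Complex.coe_smul, smul_smul, ← Complex.ofReal_mul, mul_inv_cancel₀ hr.ne']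
      simp

/-- Every `r⁻¹ • w` with `r > 1` is in the ball, and the ball is closed in the ambient norm. -/
lemma mem_ball_of_seminorm_le {w : d.Carrier} (hw : d.seminorm w ≤ 1) : d.incl w ∈ d.ball := by
  have h : ∀ r : ℝ, 1 < r → ((r⁻¹ : ℝ) : ℂ) • d.incl w ∈ d.ball := by
    intro r hr
    obtain ⟨s, hs0, hsr, k, hk, hkw⟩ := exists_lt_of_gauge_lt d.absorbent_unitBall
      (lt_of_le_of_lt hw hr)
    have hkw' : w = (s : ℂ) • k := by rw [Complex.coe_smul]; exact hkw.symm
    rw [hkw', map_smul, smul_smul, ← Complex.ofReal_mul]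
    refine (d.isAConvex_ball.balanced d.isClosed_ball).smul_mem ?_ hk
    have hr0 : 0 < r := by linarith
    rw [Complex.norm_real, Real.norm_of_nonneg (by positivity), inv_mul_le_one₀ hr0]
    exact hsr.le
  have hlim : Filter.Tendsto (fun r : ℝ => ((r⁻¹ : ℝ) : ℂ) • d.incl w) (𝓝[>] 1)
      (𝓝 (((1⁻¹ : ℝ) : ℂ) • d.incl w)) := by
    refine Filter.Tendsto.smul_const ?_ _
    refine (Complex.continuous_ofReal.tendsto _).comp ?_
    exact (tendsto_inv₀ one_ne_zero).mono_left nhdsWithin_le_nhds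
  simp only [inv_one, Complex.ofReal_one, one_smul] at hlim
  exact d.isClosed_ball.mem_of_tendsto hlim (eventually_nhdsWithin_of_forall fun r hr => h r hr)

lemma norm_incl_le_seminorm (w : d.Carrier) : ‖d.incl w‖ ≤ d.bound * d.seminorm w := by
  have hb : 0 ≤ d.bound := (norm_nonneg _).trans (d.norm_le_bound 0 d.zero_mem_ball)
  have h : ∀ r : ℝ, d.seminorm w < r → ‖d.incl w‖ ≤ d.bound * r := by
    intro r hr
    obtain ⟨s, hs0, hsr, k, hk, hkw⟩ := exists_lt_of_gauge_lt d.absorbent_unitBall hr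
    have hkw' : w = (s : ℂ) • k := by rw [Complex.coe_smul]; exact hkw.symm
    rw [hkw', map_smul, norm_smul, Complex.norm_real, Real.norm_of_nonneg hs0.le]
    have := d.norm_le_bound _ hk
    nlinarith [norm_nonneg (d.incl k)]
  have hlim : Filter.Tendsto (fun r : ℝ => d.bound * r) (𝓝[>] (d.seminorm w))
      (𝓝 (d.bound * d.seminorm w)) :=
    ((continuous_const.mul continuous_id).tendsto _).mono_left nhdsWithin_le_nhds
  exact ge_of_tendsto hlim (eventually_nhdsWithin_of_forall fun r hr => h r hr)

/-- The gauge is definite because the ball is bounded in the ambient norm. -/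
instance : NormedAddCommGroup d.Carrier :=
  AddGroupNorm.toNormedAddCommGroup
    { d.seminorm.toAddGroupSeminorm with
      eq_zero_of_map_eq_zero' := fun w hw => by
        have h := d.norm_incl_le_seminorm w
        rw [show d.seminorm w = 0 from hw, mul_zero] at h
        exact d.incl_injective (by rw [norm_le_zero_iff.1 h, map_zero]) }

instance : NormedSpace ℂ d.Carrier where
  norm_smul_le c w := (map_smul_eq_mul d.seminorm c w).le

lemma norm_le_one_iff {w : d.Carrier} : ‖w‖ ≤ 1 ↔ d.incl w ∈ d.ball :=
  ⟨d.mem_ball_of_seminorm_le, fun h => d.seminorm_le_of_eq_smul zero_le_one h (by simp)⟩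

lemma norm_le_of_eq_smul {w : d.Carrier} {r : ℝ} (hr : 0 ≤ r) {k : X} (hk : k ∈ d.ball)
    (hw : d.incl w = (r : ℂ) • k) : ‖w‖ ≤ r :=
  d.seminorm_le_of_eq_smul hr hk hw

/-- The inclusion as a bounded map. -/
def inclL : d.Carrier →L[ℂ] X := d.incl.mkContinuous d.bound d.norm_incl_le_seminorm

@[simp] lemma inclL_apply (w : d.Carrier) : d.inclL w = d.incl w := rfl

/-- Left multiplication on the gauge space. -/
def left : A →ₗ[ℂ] d.Carrier →ₗ[ℂ] d.Carrier :=
  LinearMap.mk₂ ℂ (fun a w => d.ofMem (CStarOperatorSpace.lsmul a (d.incl w))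
      (d.lsmul_mem a _ (d.incl_mem w)))
    (fun a b w => d.incl_injective (by simp))
    (fun c a w => d.incl_injective (by simp))
    (fun a v w => d.incl_injective (by simp))
    (fun c a w => d.incl_injective (by simp))

/-- Right multiplication on the gauge space. -/
def right : A →ₗ[ℂ] d.Carrier →ₗ[ℂ] d.Carrier :=
  LinearMap.mk₂ ℂ (fun a w => d.ofMem (CStarOperatorSpace.rsmul a (d.incl w))
      (d.rsmul_mem a _ (d.incl_mem w)))
    (fun a b w => d.incl_injective (by simp))
    (fun c a w => d.incl_injective (by simp))
    (fun a v w => d.incl_injective (by simp))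
    (fun c a w => d.incl_injective (by simp))

@[simp] lemma incl_left (a : A) (w : d.Carrier) :
    d.incl (d.left a w) = CStarOperatorSpace.lsmul a (d.incl w) := rfl

@[simp] lemma incl_right (a : A) (w : d.Carrier) :
    d.incl (d.right a w) = CStarOperatorSpace.rsmul a (d.incl w) := rfl

lemma exists_span_lift {y : X} (hy : y ∈ Submodule.span ℂ
    {v : X | ∃ (a b : A), ∃ w ∈ d.space, v = bimul A a w b}) :
    ∃ w ∈ Submodule.span ℂ {v : d.Carrier | ∃ a b w, v = d.left a (d.right b w)},
      d.incl w = y := by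
  induction hy using Submodule.span_induction with
  | mem y hy =>
    obtain ⟨a, b, w, hw, rfl⟩ := hy
    exact ⟨_, Submodule.subset_span ⟨a, b, d.ofMem w hw, rfl⟩, rfl⟩
  | zero => exact ⟨0, Submodule.zero_mem _, map_zero _⟩
  | add x y _ _ hx hy =>
    obtain ⟨v, hv, rfl⟩ := hx
    obtain ⟨w, hw, rfl⟩ := hy
    exact ⟨v + w, Submodule.add_mem _ hv hw, map_add _ _ _⟩
  | smul c x _ hx =>
    obtain ⟨v, hv, rfl⟩ := hx
    exact ⟨c • v, Submodule.smul_mem _ c hv, map_smul _ _ _⟩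

/-- The gauge norm is finer than the ambient one, so essentiality is not inherited and comes from
the separate field of `GaugeData`; norm convexity is exactly the `A`-convexity of the ball. -/
instance : CStarOperatorSpace A d.Carrier where
  lsmul := d.left
  rsmul := d.right
  lsmul_mul a b w := d.incl_injective (by simp [CStarOperatorSpace.lsmul_mul])
  rsmul_mul a b w := d.incl_injective (by simp [CStarOperatorSpace.rsmul_mul])
  lsmul_rsmul a b w := d.incl_injective (by simp [CStarOperatorSpace.lsmul_rsmul])
  essential w := by
    rw [Metric.mem_closure_iff]
    intro ε hε
    obtain ⟨y, hy, k, hk, hyk⟩ := d.essential _ (d.incl_mem w) (ε / 2) (by positivity)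
    obtain ⟨v, hv, rfl⟩ := d.exists_span_lift hy
    refine ⟨v, hv, ?_⟩
    rw [dist_eq_norm]
    refine lt_of_le_of_lt (d.norm_le_of_eq_smul (r := ε / 2) (by positivity) hk ?_) (by linarith)
    rw [map_sub, hyk]
  norm_convex a₁ a₂ b₁ b₂ w₁ w₂ ha hb h₁ h₂ := by
    rw [norm_le_one_iff] at *
    exact d.isAConvex_ball _ h₁ _ h₂ _ _ _ _ ha hb

lemma incl_bimul (a b : A) (w : d.Carrier) :
    d.incl (bimul A a w b) = bimul A a (d.incl w) b := rfl

lemma isBilinearOver_inclL : IsBilinearOver A d.inclL := fun _ _ _ => rfl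

end GaugeData

end GaugeSpace

/-! ### A compact gauge space generated by algebraic tensors -/

section NullSequences

/-- A sequence of finite nonempty sets of norm tending to zero can be enumerated as a null
sequence. -/
lemma exists_null_sequence_iUnion {X : Type*} [NormedAddCommGroup X] {T : ℕ → Set X} {s : ℕ → ℝ}
    (hfin : ∀ k, (T k).Finite) (hne : ∀ k, (T k).Nonempty) (hT : ∀ k, ∀ x ∈ T k, ‖x‖ ≤ s k)
    (hs : Filter.Tendsto s Filter.atTop (𝓝 0)) :
    ∃ y : ℕ → X, Filter.Tendsto y Filter.atTop (𝓝 0) ∧ Set.range y = ⋃ k, T k := by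
  have : ∀ k, Finite (T k) := fun k => (hfin k).to_subtype
  have hinf : Infinite (Σ k, T k) := by
    choose x hx using hne
    exact Infinite.of_injective (fun k => (⟨k, x k, hx k⟩ : Σ k, T k)) fun k l h =>
      congrArg Sigma.fst h
  obtain ⟨y, hy, hr⟩ := exists_null_sequence_range_eq (x := fun i : Σ k, T k => (i.2 : X)) (by
    rw [Metric.tendsto_nhds]
    intro ε hε
    have h1 := hs.eventually (gt_mem_nhds hε)
    rw [← Nat.cofinite_eq_atTop, Filter.eventually_cofinite] at h1
    rw [Filter.eventually_cofinite]
    refine (h1.biUnion (t := fun k => Set.range fun x : T k => (⟨k, x⟩ : Σ k, T k))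
      fun k _ => Set.finite_range _).subset ?_
    rintro ⟨k, x⟩ hx
    refine Set.mem_biUnion (x := k) ?_ ⟨x, rfl⟩
    intro hk
    apply hx
    rw [dist_zero_right]
    exact (hT k x x.2).trans_lt hk)
  refine ⟨y, hy, hr.trans ?_⟩
  ext x
  simp

end NullSequences

/-! ### A gauge ball that is the hull of a null sequence. -/

section CompactGauge

variable {A : Type*} [NonUnitalCStarAlgebra A] [PartialOrder A] [StarOrderedRing A]
variable {V : Type*} [NormedAddCommGroup V] [NormedSpace ℂ V] [OperatorSpace V]

/-- The sub-bimodule of `A ⊗_min V` spanned by the `a ⊗ v` with `v` in one of the given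
subspaces. -/
def tensorSpan (E : ℕ → Submodule ℂ V) : Submodule ℂ (MinTensor A V) :=
  Submodule.span ℂ {x | ∃ (k : ℕ) (a : A), ∃ v ∈ E k, x = minTmul a v}

lemma minTmul_smul (c : ℂ) (a : A) (v : V) : minTmul a (c • v) = c • minTmul a v :=
  (minTmulL A V a).map_smul c v

lemma smul_minTmul (c : ℂ) (a : A) (v : V) : minTmul (c • a) v = c • minTmul a v :=
  ((minTmulL A V).flip v).map_smul c a

lemma minTmul_add (a : A) (v w : V) : minTmul a (v + w) = minTmul a v + minTmul a w :=
  (minTmulL A V a).map_add v w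

lemma minTmul_zero (a : A) : minTmul a (0 : V) = 0 :=
  (minTmulL A V a).map_zero

/-- Shifting scalars across the tensor sign bounds the gauge of `a ⊗ v` by `‖a‖ ‖v‖ / r`. -/
lemma mem_smul_of_norm_mul_le {K : Set (MinTensor A V)} {E : Submodule ℂ V} {r : ℝ} (hr : 0 < r)
    (h0 : (0 : MinTensor A V) ∈ K)
    (hK : ∀ (a : A), ∀ v ∈ E, ‖a‖ ≤ 1 → ‖v‖ ≤ r → minTmul a v ∈ K) {a : A} {v : V} (hv : v ∈ E)
    {ε : ℝ} (hε : 0 < ε) (h : ‖a‖ * ‖v‖ ≤ ε * r) : ∃ k ∈ K, minTmul a v = (ε : ℂ) • k := by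
  by_cases hv0 : v = 0
  · exact ⟨0, h0, by rw [hv0, minTmul_zero, smul_zero]⟩
  have hvn : 0 < ‖v‖ := norm_pos_iff.2 hv0
  refine ⟨minTmul (((‖v‖ / (ε * r) : ℝ) : ℂ) • a) (((r / ‖v‖ : ℝ) : ℂ) • v),
    hK _ _ (E.smul_mem _ hv) ?_ ?_, ?_⟩
  · rw [norm_smul, Complex.norm_real, Real.norm_of_nonneg (by positivity), div_mul_eq_mul_div,
      div_le_one (by positivity), mul_comm]
    exact h
  · rw [norm_smul, Complex.norm_real, Real.norm_of_nonneg (by positivity),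
      div_mul_cancel₀ _ hvn.ne']
  · rw [smul_minTmul, minTmul_smul, smul_smul, smul_smul, ← Complex.ofReal_mul,
      ← Complex.ofReal_mul]
    have : ε * (‖v‖ / (ε * r) * (r / ‖v‖)) = 1 := by field_simp
    rw [← mul_assoc] at this
    rw [this, Complex.ofReal_one, one_smul]

/-- A bounded closed `A`-convex set which contains multiples of the balls of the `A ⊗ Eₖ` defines
gauge data on the span of these. -/
def tensorGaugeData (E : ℕ → Submodule ℂ V) (r : ℕ → ℝ) (hr : ∀ k, 0 < r k)
    (K : Set (MinTensor A V)) (hc : IsClosed K) (hconv : IsAConvex A K) (h0 : 0 ∈ K) (R : ℝ)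
    (hR : ∀ x ∈ K, ‖x‖ ≤ R)
    (hK : ∀ k, ∀ (a : A), ∀ v ∈ E k, ‖a‖ ≤ 1 → ‖v‖ ≤ r k → minTmul a v ∈ K) :
    GaugeData A (MinTensor A V) where
  ball := K
  space := tensorSpan E
  bound := R
  isClosed_ball := hc
  isAConvex_ball := hconv
  norm_le_bound := hR
  zero_mem_ball := h0
  lsmul_mem a x hx := by
    refine (Submodule.span_le (p := (tensorSpan E).comap (minLeft A V a))).2 ?_ hx
    rintro _ ⟨k, b, v, hv, rfl⟩
    refine Submodule.subset_span ⟨k, a * b, v, hv, ?_⟩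
    rw [minLeft_minTmul]
  rsmul_mem a x hx := by
    refine (Submodule.span_le (p := (tensorSpan E).comap (minRight A V a))).2 ?_ hx
    rintro _ ⟨k, b, v, hv, rfl⟩
    refine Submodule.subset_span ⟨k, b * a, v, hv, ?_⟩
    rw [minRight_minTmul]
  absorbing x hx := by
    have hbal := hconv.balanced hc
    induction hx using Submodule.span_induction with
    | mem x hx =>
      obtain ⟨k, a, v, hv, rfl⟩ := hx
      -- The summand 1 keeps the multiple positive when the tensor vanishes.
      refine ⟨‖a‖ * ‖v‖ / r k + 1, by have := hr k; positivity,
        mem_smul_of_norm_mul_le (hr k) h0 (hK k) hv (by have := hr k; positivity) ?_⟩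
      rw [add_mul, div_mul_cancel₀ _ (hr k).ne']
      linarith [hr k]
    | zero => exact ⟨1, one_pos, 0, h0, by simp⟩
    | add x y _ _ hx hy =>
      obtain ⟨s, hs, k, hk, rfl⟩ := hx
      obtain ⟨t, ht, l, hl, rfl⟩ := hy
      refine ⟨s + t, by positivity, _, hconv.smul_add_smul_mem hc hk hl
        (s := s / (s + t)) (t := t / (s + t)) (by positivity) (by positivity) ?_, ?_⟩
      · rw [← add_div, div_self (by positivity)]
      · rw [smul_add, smul_smul, smul_smul, ← Complex.ofReal_mul, ← Complex.ofReal_mul]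
        congr 3 <;> field_simp
    | smul c x _ hx =>
      obtain ⟨s, hs, k, hk, rfl⟩ := hx
      refine ⟨(‖c‖ + 1) * s, by positivity, ((‖c‖ + 1 : ℝ) : ℂ)⁻¹ • c • k, ?_, ?_⟩
      · rw [smul_smul]
        refine hbal.smul_mem ?_ hk
        rw [norm_mul, norm_inv, Complex.norm_real, Real.norm_of_nonneg (by positivity),
          inv_mul_le_one₀ (by positivity)]
        linarith
      · have : ((‖c‖ + 1 : ℝ) : ℂ) ≠ 0 := by
          rw [Complex.ofReal_ne_zero]; positivity
        rw [smul_smul, smul_smul, smul_smul, Complex.ofReal_mul]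
        congr 1
        field_simp
  essential x hx := by
    have hbal := hconv.balanced hc
    induction hx using Submodule.span_induction with
    | mem x hx =>
      intro ε hε
      obtain ⟨k, a, v, hv, rfl⟩ := hx
      -- Norm convergence `e a e → a` in `A` already gives gauge convergence of the tensors with
      -- `v`, as the gauge on `A ⊗ v` is controlled by the norm of the first factor.
      have hlim := (tendsto_iff_norm_sub_tendsto_zero.1 (tendsto_approx a)).mul_const ‖v‖
      rw [zero_mul] at hlim
      obtain ⟨e, he⟩ := (hlim.eventually (gt_mem_nhds (mul_pos hε (hr k)))).exists
      refine ⟨bimul A e (minTmul a v) e, Submodule.subset_span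
        ⟨e, e, _, Submodule.subset_span ⟨k, a, v, hv, rfl⟩, rfl⟩, ?_⟩
      rw [bimul_minTmul, ← minTmul_sub]
      refine mem_smul_of_norm_mul_le (hr k) h0 (hK k) hv hε ?_
      rw [norm_sub_rev, mul_assoc]
      exact he.le
    | zero => exact fun ε _ => ⟨0, Submodule.zero_mem _, 0, h0, by simp⟩
    | add x y _ _ hx hy =>
      intro ε hε
      obtain ⟨u, hu, k, hk, huk⟩ := hx (ε / 2) (by positivity)
      obtain ⟨w, hw, l, hl, hwl⟩ := hy (ε / 2) (by positivity)
      refine ⟨u + w, Submodule.add_mem _ hu hw, _, hconv.smul_add_smul_mem hc hk hl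
        (s := 1 / 2) (t := 1 / 2) (by norm_num) (by norm_num) (by norm_num), ?_⟩
      rw [add_sub_add_comm, huk, hwl, smul_add, smul_smul, smul_smul, ← Complex.ofReal_mul]
      congr 3 <;> ring
    | smul c x _ hx =>
      intro ε hε
      obtain ⟨u, hu, k, hk, huk⟩ := hx (ε / (‖c‖ + 1)) (by positivity)
      refine ⟨c • u, Submodule.smul_mem _ c hu, ((‖c‖ + 1 : ℝ) : ℂ)⁻¹ • c • k, ?_, ?_⟩
      · rw [smul_smul]
        refine hbal.smul_mem ?_ hk
        rw [norm_mul, norm_inv, Complex.norm_real, Real.norm_of_nonneg (by positivity),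
          inv_mul_le_one₀ (by positivity)]
        linarith
      · rw [← smul_sub, huk, smul_smul, smul_smul, smul_smul, Complex.ofReal_div]
        congr 1
        ring

/-- A single element generates the unit ball of `A` as a closed absolutely `A`-convex set. -/
def IsUnitBallGenerator (p : A) : Prop :=
  ∀ a : A, ‖a‖ ≤ 1 → a ∈ closedAConvexHull A {p}

/-- If `A` has a unit ball generator, every null sequence in `A ⊗_min V` of tensors over
finite-dimensional subspaces `Eₖ` of `V` is contained in a closed `A`-convex hull of a null sequence
which also contains multiples of the balls of the `A ⊗ Eₖ`. -/
lemma exists_hull_of_null_sequence {p : A} (hp : IsUnitBallGenerator p) (E : ℕ → Submodule ℂ V)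
    [∀ k, FiniteDimensional ℂ (E k)] (z : ℕ → MinTensor A V)
    (hz : Filter.Tendsto z Filter.atTop (𝓝 0)) :
    ∃ (r : ℕ → ℝ) (x : ℕ → MinTensor A V), (∀ k, 0 < r k) ∧ (∀ k, ‖z k‖ ≤ r k) ∧
      Filter.Tendsto r Filter.atTop (𝓝 0) ∧ Filter.Tendsto x Filter.atTop (𝓝 0) ∧
      (∀ k, z k ∈ closedAConvexHull A (Set.range x)) ∧
      ∀ k, ∀ (a : A), ∀ v ∈ E k, ‖a‖ ≤ 1 → ‖v‖ ≤ r k →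
        minTmul a v ∈ closedAConvexHull A (Set.range x) := by
  -- The radii tend to 0 but stay positive even where `z k = 0`.
  let r : ℕ → ℝ := fun k => ‖z k‖ + 1 / (k + 1)
  have hr : ∀ k, 0 < r k := fun k => by positivity
  have hzr : ∀ k, ‖z k‖ ≤ r k := fun k => by
    have : (0 : ℝ) ≤ 1 / (k + 1) := by positivity
    simp only [r]; linarith
  have hr0 : Filter.Tendsto r Filter.atTop (𝓝 0) := by
    simpa [r] using hz.norm.add tendsto_one_div_add_atTop_nhds_zero_nat
  choose F hFfin hFE hFr hF using fun k => exists_finite_net (E k) (r k) (hr k)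
  -- Finitely many generators per stage: `z k` itself and `p ⊗ 2f` for `f` in a finite net of the `r
  -- k`-ball of `E k`, doubled as `ball_subset_of_net` requires.
  let T : ℕ → Set (MinTensor A V) := fun k =>
    insert (z k) ((fun f => minTmul p ((2 : ℝ) • f)) '' F k)
  obtain ⟨x, hx, hxT⟩ := exists_null_sequence_iUnion (T := T)
    (s := fun k => r k + ‖p‖ * (2 * r k)) (fun k => ((hFfin k).image _).insert _)
    (fun k => ⟨z k, Set.mem_insert _ _⟩) (by
      rintro k _ (rfl | ⟨f, hf, rfl⟩)
      · have := hr k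
        have : 0 ≤ ‖p‖ * (2 * r k) := by positivity
        linarith [hzr k]
      · refine (norm_minTmul_le _ _).trans ?_
        have h1 : ‖(2 : ℝ) • f‖ ≤ 2 * r k := by
          rw [norm_smul, Real.norm_of_nonneg (by norm_num)]
          linarith [hFr k f hf]
        have h2 := mul_le_mul_of_nonneg_left h1 (norm_nonneg p)
        linarith [hr k])
    (by simpa using hr0.add ((hr0.const_mul 2).const_mul ‖p‖))
  have hTx : ∀ k, T k ⊆ closedAConvexHull A (Set.range x) := fun k =>
    (Set.subset_iUnion T k).trans (hxT ▸ subset_closedAConvexHull (A := A) _)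
  have hcl := isClosed_closedAConvexHull (A := A) (Set.range x)
  have hcv := isAConvex_closedAConvexHull (A := A) (Set.range x)
  refine ⟨r, x, hr, hzr, hr0, hx, fun k => hTx k (Set.mem_insert _ _), fun k a v hv ha hvr => ?_⟩
  -- The net gives `p ⊗ v` for every `v` in the ball of `E k`.
  have hpv : v ∈ {v : V | minTmul p v ∈ closedAConvexHull A (Set.range x)} := by
    refine ball_subset_of_net ?_ ?_ ?_ (E k) (hFE k) ?_ (hF k) hv hvr
    · exact hcl.preimage (continuous_minTmul_right p)
    · intro v hv w hw s t hs ht hst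
      have := hcv.convex hcl hv hw hs ht hst
      simp only [← Complex.coe_smul, ← minTmul_smul, ← minTmul_add] at this
      simpa only [Set.mem_ofPred_eq, ← Complex.coe_smul] using this
    · rw [Set.mem_ofPred_eq]
      rw [minTmul_zero]
      exact (hcv.balanced hcl).zero_mem ⟨_, hTx 0 (Set.mem_insert _ _)⟩
    · exact fun f hf => hTx k (Set.mem_insert_of_mem _ ⟨f, hf, rfl⟩)
  -- For fixed `v` the admissible `a` form a closed absolutely `A`-convex set containing `p`, hence
  -- the whole unit ball of `A`.
  have hsub : closedAConvexHull A {p} ⊆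
      {a : A | minTmul a v ∈ closedAConvexHull A (Set.range x)} := by
    refine closedAConvexHull_subset (hcl.preimage (continuous_minTmul_left v)) ?_
      (Set.singleton_subset_iff.2 hpv)
    intro b₁ h₁ b₂ h₂ c₁ c₂ d₁ d₂ hc hd
    have h := hcv _ h₁ _ h₂ _ _ _ _ hc hd
    rw [bimul_minTmul, bimul_minTmul] at h
    have e : minTmul (bimul A c₁ b₁ d₁ + bimul A c₂ b₂ d₂) v =
        minTmul (c₁ * b₁ * d₁) v + minTmul (c₂ * b₂ * d₂) v := by
      rw [bimul_self, bimul_self]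
      exact ((minTmulL A V).flip v).map_add _ _
    exact (congrArg (· ∈ closedAConvexHull A (Set.range x)) e).mpr h
  exact hsub (hp a ha)

end CompactGauge

/-! ### Approximation of bimodule maps on the gauge space -/

section Approximation

variable {A : Type*} [NonUnitalCStarAlgebra A] [PartialOrder A] [StarOrderedRing A]
variable {V : Type*} [NormedAddCommGroup V] [NormedSpace ℂ V] [OperatorSpace V]

/-- The norm of a slice of `z` only depends on the functional on a subspace carrying `z`. -/
lemma norm_minSlice_sum_le (g : StrongDual ℂ V) (E : Submodule ℂ V) {c : ℝ} (hc : 0 ≤ c)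
    (hg : ∀ e ∈ E, ‖g e‖ ≤ c * ‖e‖) {n : ℕ} (a : Fin n → A) (e : Fin n → V) (he : ∀ j, e j ∈ E) :
    ‖minSlice A g (∑ j, minTmul (a j) (e j))‖ ≤ c * ‖∑ j, minTmul (a j) (e j)‖ := by
  -- The slice of a tensor over `E` sees only `g` on `E`, so `g` may be exchanged for a
  -- norm-preserving extension of its restriction.
  obtain ⟨h, hhg, hh⟩ := exists_extension_norm_eq E (g.comp E.subtypeL)
  have e1 : minSlice A g (∑ j, minTmul (a j) (e j)) =
      minSlice A h (∑ j, minTmul (a j) (e j)) := by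
    simp only [map_sum, minSlice_minTmul]
    refine Finset.sum_congr rfl fun j _ => ?_
    rw [hhg ⟨e j, he j⟩]
    rfl
  rw [e1]
  refine (norm_minSlice_le _ _).trans ?_
  gcongr
  rw [hh]
  exact ContinuousLinearMap.opNorm_le_bound _ hc fun x => hg x x.2

lemma norm_bimoduleMultiplier_le {m : bimoduleMultipliers A} {c : ℝ} (hc : 0 ≤ c)
    (h : ∀ t, ‖gelfandStarTransform (bimoduleMultipliers A) m t‖ ≤ c) : ‖m‖ ≤ c := by
  have h1 : ‖gelfandStarTransform (bimoduleMultipliers A) m‖ = ‖m‖ :=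
    (AddMonoidHomClass.isometry_iff_norm _).1 (gelfandTransform_isometry (bimoduleMultipliers A)) m
  rw [← h1]
  exact (ContinuousMap.norm_le _ hc).2 h

lemma norm_gelfand_apply_le (m : bimoduleMultipliers A)
    (t : WeakDual.characterSpace ℂ (bimoduleMultipliers A)) :
    ‖gelfandStarTransform (bimoduleMultipliers A) m t‖ ≤ ‖m‖ := by
  have h1 : ‖gelfandStarTransform (bimoduleMultipliers A) m‖ = ‖m‖ :=
    (AddMonoidHomClass.isometry_iff_norm _).1 (gelfandTransform_isometry (bimoduleMultipliers A)) m
  rw [← h1]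
  exact ContinuousMap.norm_coe_le_norm _ t

/-- The complexification of a real continuous function. -/
def complexify {T : Type*} [TopologicalSpace T] (h : C(T, ℝ)) : C(T, ℂ) :=
  (⟨Complex.ofReal, Complex.continuous_ofReal⟩ : C(ℝ, ℂ)).comp h

lemma gelfand_sum_smul_sub_apply {ι : Type*} [Fintype ι] (c : ι → ℂ)
    (k : ι → C(WeakDual.characterSpace ℂ (bimoduleMultipliers A), ℂ)) (m : bimoduleMultipliers A)
    (t : WeakDual.characterSpace ℂ (bimoduleMultipliers A)) :
    gelfandStarTransform (bimoduleMultipliers A)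
      (∑ i, c i • (gelfandStarTransform (bimoduleMultipliers A)).symm (k i) - m) t =
      ∑ i, c i * k i t - gelfandStarTransform (bimoduleMultipliers A) m t := by
  have h : gelfandStarTransform (bimoduleMultipliers A)
      (∑ i, c i • (gelfandStarTransform (bimoduleMultipliers A)).symm (k i)) =
      ∑ i, c i • k i := by
    rw [map_sum]
    refine Finset.sum_congr rfl fun i _ => ?_
    rw [map_smul, StarAlgEquiv.apply_symm_apply]
  rw [map_sub, h, ContinuousMap.sub_apply, ContinuousMap.sum_apply]
  rfl

/-- Finitely many continuous functions on a compact space are approximated by combinations of their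
values at finitely many points, with a partition of unity as coefficients. -/
lemma exists_partition_of_unity_approximation {T X : Type*} [TopologicalSpace T] [CompactSpace T]
    [T2Space T] (F : X → C(T, ℂ)) {S : Set X} (hS : S.Finite) {η : ℝ} (hη : 0 < η) :
    ∃ (s : Finset T) (h : s → C(T, ℝ)), (∀ i t, 0 ≤ h i t) ∧ (∀ t, ∑ i, h i t = 1) ∧
      ∀ e ∈ S, ∀ t, ‖∑ i : s, F e i * (h i t : ℂ) - F e t‖ ≤ η := by
  let U : T → Set T := fun t => ⋂ e ∈ S, {s | ‖F e s - F e t‖ < η}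
  have hUo : ∀ t, IsOpen (U t) := fun t => hS.isOpen_biInter fun e _ =>
    isOpen_lt (((F e).continuous.sub continuous_const).norm) continuous_const
  have hUt : ∀ t, t ∈ U t := fun t => Set.mem_iInter₂.2 fun e _ => by simpa using hη
  obtain ⟨s, _, hs⟩ := isCompact_univ.elim_nhds_subcover U fun t _ => (hUo t).mem_nhds (hUt t)
  obtain ⟨ρ, hρ⟩ := PartitionOfUnity.exists_isSubordinate isClosed_univ (fun i : s => U i)
    (fun i => hUo i) (hs.trans (Set.iUnion₂_subset fun t ht =>
      Set.subset_iUnion (fun i : s => U i) ⟨t, ht⟩))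
  have hsum : ∀ t, ∑ i, ρ i t = 1 := fun t => by
    rw [← finsum_eq_sum_of_fintype]; exact ρ.sum_eq_one (Set.mem_univ t)
  refine ⟨s, fun i => ρ i, fun i t => ρ.nonneg i t, hsum, fun e he t => ?_⟩
  have e1 : ∑ i : s, F e i * (ρ i t : ℂ) - F e t =
      ∑ i : s, ((ρ i t : ℝ) : ℂ) * (F e i - F e t) := by
    simp only [mul_sub, Finset.sum_sub_distrib]
    rw [← Finset.sum_mul, ← Complex.ofReal_sum, hsum, Complex.ofReal_one, one_mul]
    congr 1
    exact Finset.sum_congr rfl fun i _ => mul_comm _ _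
  rw [e1]
  refine (norm_sum_le _ _).trans ?_
  calc ∑ i : s, ‖((ρ i t : ℝ) : ℂ) * (F e i - F e t)‖ ≤ ∑ i : s, ρ i t * η := by
        refine Finset.sum_le_sum fun i _ => ?_
        rw [norm_mul, Complex.norm_real, Real.norm_of_nonneg (ρ.nonneg i t)]
        by_cases hi : ρ i t = 0
        · simp [hi]
        · have hti : t ∈ U i := hρ i (subset_tsupport _ hi)
          have := Set.mem_iInter₂.1 hti e he
          rw [norm_sub_rev]
          exact mul_le_mul_of_nonneg_left (le_of_lt this) (ρ.nonneg i t)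
    _ = η := by rw [← Finset.sum_mul, hsum, one_mul]

/-- The value of the Gelfand transform of a multiplier valued map at a character. -/
def gelfandEval {E : Type*} [AddCommGroup E] [Module ℂ E] (M : E →ₗ[ℂ] bimoduleMultipliers A)
    (t : WeakDual.characterSpace ℂ (bimoduleMultipliers A)) : E →ₗ[ℂ] ℂ where
  toFun e := gelfandStarTransform (bimoduleMultipliers A) (M e) t
  map_add' x y := by rw [map_add, map_add, ContinuousMap.add_apply]
  map_smul' c x := by
    rw [map_smul, map_smul, ContinuousMap.smul_apply, RingHom.id_apply]

/-- A multiplier valued map on a finite-dimensional subspace `E` that is bounded on the trace of a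
bounded closed absolutely convex set `K` is approximately a convex combination, with continuous
coefficients, of functionals bounded on `K`. -/
lemma exists_partition_approximation {K : Set V} (hc : IsClosed K) (hconv : Convex ℝ K)
    (hbal : Balanced ℂ K) (h0 : (0 : V) ∈ K) {R : ℝ} (hR : ∀ x ∈ K, ‖x‖ ≤ R)
    (E : Submodule ℂ V) [FiniteDimensional ℂ E] (M : E →ₗ[ℂ] bimoduleMultipliers A) {C : ℝ}
    (hC : 0 < C) (hM : ∀ e : E, (e : V) ∈ K → ‖M e‖ ≤ C) {S : Set E} (hS : S.Finite) {η : ℝ}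
    (hη : 0 < η) :
    ∃ (s : Finset (WeakDual.characterSpace ℂ (bimoduleMultipliers A)))
      (h : s → C(WeakDual.characterSpace ℂ (bimoduleMultipliers A), ℝ)) (g : s → StrongDual ℂ V),
      (∀ i t, 0 ≤ h i t) ∧ (∀ t, ∑ i, h i t = 1) ∧ (∀ i, ∀ x ∈ K, ‖g i x‖ ≤ 2 * C) ∧
      ∀ e ∈ S, ‖∑ i, g i e •
        (gelfandStarTransform (bimoduleMultipliers A)).symm (complexify (h i)) - M e‖ ≤ η := by
  -- Evaluation at a character turns `M` into a scalar functional with the same bound on `K`, which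
  -- then extends to `V`.
  have hloc : ∀ t : WeakDual.characterSpace ℂ (bimoduleMultipliers A), ∃ g : StrongDual ℂ V,
      (∀ e : E, g e = gelfandEval M t e) ∧ ∀ x ∈ K, ‖g x‖ ≤ 2 * C := fun t =>
    exists_dual_extension_bounded_on hc hconv hbal h0 hR E (gelfandEval M t) hC fun e he =>
      (norm_gelfand_apply_le _ t).trans (hM e he)
  choose g hgE hgK using hloc
  obtain ⟨s, h, hh0, hh1, hh⟩ := exists_partition_of_unity_approximation
    (fun e => gelfandStarTransform (bimoduleMultipliers A) (M e)) hS hη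
  refine ⟨s, h, fun i => g i, hh0, hh1, fun i => hgK i, fun e he =>
    norm_bimoduleMultiplier_le hη.le fun t => ?_⟩
  refine le_of_eq_of_le (congrArg norm ?_) (hh e he t)
  refine (gelfand_sum_smul_sub_apply (fun i : s => g i e) (fun i => complexify (h i))
    (M e) t).trans ?_
  simp only [hgE]
  rfl

/-! ### The symbol of a bimodule map on a gauge space. -/

namespace GaugeData

variable (d : GaugeData A (MinTensor A V))

/-- The vectors `v` for which `a ↦ a ⊗ v` is a bounded map into the gauge space. -/
def boundedSpace : Submodule ℂ V where
  carrier := {v | ∃ R : ℝ, ∀ a : A, ∃ h : minTmul a v ∈ d.space, ‖d.ofMem _ h‖ ≤ R * ‖a‖}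
  add_mem' := by
    rintro v w ⟨R, hR⟩ ⟨S, hS⟩
    refine ⟨R + S, fun a => ?_⟩
    obtain ⟨h, hr⟩ := hR a
    obtain ⟨k, hk⟩ := hS a
    refine ⟨by rw [minTmul_add]; exact Submodule.add_mem _ h k, ?_⟩
    have e : d.ofMem (minTmul a (v + w)) (by rw [minTmul_add]; exact Submodule.add_mem _ h k) =
        d.ofMem _ h + d.ofMem _ k := d.incl_injective (by simp [minTmul_add])
    rw [e, add_mul]
    exact (norm_add_le _ _).trans (add_le_add hr hk)
  zero_mem' := ⟨0, fun a => ⟨by rw [minTmul_zero]; exact Submodule.zero_mem _, by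
    have e : d.ofMem (minTmul a (0 : V)) (by rw [minTmul_zero]; exact Submodule.zero_mem _) = 0 :=
      d.incl_injective (by simp [minTmul_zero])
    rw [e, norm_zero, zero_mul]⟩⟩
  smul_mem' := by
    rintro c v ⟨R, hR⟩
    refine ⟨‖c‖ * R, fun a => ?_⟩
    obtain ⟨h, hr⟩ := hR a
    refine ⟨by rw [minTmul_smul]; exact Submodule.smul_mem _ c h, ?_⟩
    have e : d.ofMem (minTmul a (c • v)) (by rw [minTmul_smul]; exact Submodule.smul_mem _ c h) =
        c • d.ofMem _ h := d.incl_injective (by simp [minTmul_smul])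
    rw [e, norm_smul, mul_assoc]
    gcongr

lemma minTmul_mem_space (a : A) (v : d.boundedSpace) : minTmul a (v : V) ∈ d.space := by
  obtain ⟨R, hR⟩ := v.2
  exact (hR a).1

/-- The elementary tensor `a ⊗ v` in the gauge space. -/
def tmul (a : A) (v : d.boundedSpace) : d.Carrier := d.ofMem _ (d.minTmul_mem_space a v)

@[simp] lemma incl_tmul (a : A) (v : d.boundedSpace) : d.incl (d.tmul a v) = minTmul a (v : V) :=
  rfl

lemma tmul_bound (v : d.boundedSpace) : ∃ R, ∀ a, ‖d.tmul a v‖ ≤ R * ‖a‖ := by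
  obtain ⟨R, hR⟩ := v.2
  exact ⟨R, fun a => (hR a).2⟩

/-- The bounded map `a ↦ a ⊗ v` into the gauge space. -/
def tmulL (v : d.boundedSpace) : A →L[ℂ] d.Carrier :=
  LinearMap.mkContinuousOfExistsBound
    { toFun := fun a => d.tmul a v
      map_add' := fun a b => d.incl_injective (by
        rw [map_add]; exact ((minTmulL A V).flip (v : V)).map_add a b)
      map_smul' := fun c a => d.incl_injective (by
        rw [RingHom.id_apply, map_smul]; exact smul_minTmul c a (v : V)) }
    (d.tmul_bound v)

@[simp] lemma tmulL_apply (v : d.boundedSpace) (a : A) : d.tmulL v a = d.tmul a v := rfl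

variable {d}
variable {φ : d.Carrier →L[ℂ] A}

lemma isBilinearOver_comp_tmulL (hφ : IsBilinearOver A φ) (v : d.boundedSpace) :
    IsBilinearOver A (φ.comp (d.tmulL v)) := by
  intro a b c
  rw [ContinuousLinearMap.comp_apply, ContinuousLinearMap.comp_apply, ← hφ]
  congr 1
  refine d.incl_injective ?_
  rw [incl_bimul, tmulL_apply, tmulL_apply, incl_tmul, incl_tmul, bimul_minTmul, bimul_self]

/-- The multiplier valued map `v ↦ (a ↦ φ (a ⊗ v))` of a bimodule map `φ`. -/
def symbol (hφ : IsBilinearOver A φ) : d.boundedSpace →ₗ[ℂ] bimoduleMultipliers A where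
  toFun v := toBimoduleMultiplier _ (isBilinearOver_comp_tmulL hφ v)
  map_add' v w := bimoduleMultiplierAction_injective (by
    ext a
    rw [map_add, _root_.add_apply]
    simp only [bimoduleMultiplierAction_toBimoduleMultiplier, ContinuousLinearMap.comp_apply,
      tmulL_apply, ← map_add]
    congr 1
    exact d.incl_injective (by simp [minTmul_add]))
  map_smul' c v := bimoduleMultiplierAction_injective (by
    ext a
    rw [RingHom.id_apply, map_smul, _root_.smul_apply]
    simp only [bimoduleMultiplierAction_toBimoduleMultiplier, ContinuousLinearMap.comp_apply,
      tmulL_apply, ← map_smul]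
    congr 1
    exact d.incl_injective (by simp [minTmul_smul]))

lemma action_symbol (hφ : IsBilinearOver A φ) (v : d.boundedSpace) (a : A) :
    bimoduleMultiplierAction (symbol hφ v) a = φ (d.tmul a v) := rfl

lemma norm_symbol_le (hφ : IsBilinearOver A φ) (v : d.boundedSpace)
    (hv : ∀ a : A, ‖a‖ ≤ 1 → minTmul a (v : V) ∈ d.ball) : ‖symbol hφ v‖ ≤ ‖φ‖ := by
  rw [← norm_bimoduleMultiplierAction]
  refine ContinuousLinearMap.opNorm_le_of_unit_norm (norm_nonneg _) fun a ha => ?_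
  rw [action_symbol]
  have : ‖d.tmul a v‖ ≤ 1 := d.norm_le_one_iff.2 (hv a ha.le)
  exact (φ.le_opNorm _).trans (mul_le_of_le_one_right (norm_nonneg _) this)

end GaugeData

end Approximation

/-! ### Extending bimodule maps from the gauge space -/

section Extension

variable {A : Type*} [NonUnitalCStarAlgebra A] [PartialOrder A] [StarOrderedRing A]
variable {V : Type*} [NormedAddCommGroup V] [NormedSpace ℂ V] [OperatorSpace V]

lemma norm_apply_le_of_bounded_on_ball {g : StrongDual ℂ V} {E : Submodule ℂ V} {r c : ℝ}
    (hr : 0 < r) (hg : ∀ e ∈ E, ‖e‖ ≤ r → ‖g e‖ ≤ c) {e : V} (he : e ∈ E) :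
    ‖g e‖ ≤ c / r * ‖e‖ := by
  by_cases h0 : e = 0
  · simp [h0]
  have hn : 0 < ‖e‖ := norm_pos_iff.2 h0
  have h := hg (((r / ‖e‖ : ℝ) : ℂ) • e) (E.smul_mem _ he) (by
    rw [norm_smul, Complex.norm_real, Real.norm_of_nonneg (by positivity),
      div_mul_cancel₀ _ hn.ne'])
  rw [map_smul, norm_smul, Complex.norm_real, Real.norm_of_nonneg (by positivity),
    div_mul_eq_mul_div, div_le_iff₀ hn] at h
  rw [div_mul_eq_mul_div, le_div_iff₀ hr]
  linarith

/-- The bimodule map `∑ hᵢ (id ⊗ gᵢ)` on `A ⊗_min V`. -/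
def sliceSum {ι : Type*} [Fintype ι]
    (h : ι → C(WeakDual.characterSpace ℂ (bimoduleMultipliers A), ℝ)) (g : ι → StrongDual ℂ V) :
    MinTensor A V →L[ℂ] A :=
  ∑ i, (functionAction (complexify (h i))).comp (minSlice A (g i))

lemma sliceSum_apply {ι : Type*} [Fintype ι]
    (h : ι → C(WeakDual.characterSpace ℂ (bimoduleMultipliers A), ℝ)) (g : ι → StrongDual ℂ V)
    (x : MinTensor A V) :
    sliceSum h g x = ∑ i, functionAction (complexify (h i)) (minSlice A (g i) x) := by
  rw [sliceSum, _root_.sum_apply]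
  rfl

lemma isBilinearOver_sliceSum {ι : Type*} [Fintype ι]
    (h : ι → C(WeakDual.characterSpace ℂ (bimoduleMultipliers A), ℝ)) (g : ι → StrongDual ℂ V) :
    IsBilinearOver A (sliceSum h g) :=
  IsBilinearOver.sum _ fun i _ => (isBilinearOver_minSlice (g i)).action_comp _

lemma sliceSum_minTmul {ι : Type*} [Fintype ι]
    (h : ι → C(WeakDual.characterSpace ℂ (bimoduleMultipliers A), ℝ)) (g : ι → StrongDual ℂ V)
    (a : A) (v : V) :
    sliceSum h g (minTmul a v) = bimoduleMultiplierAction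
      (∑ i, g i v • (gelfandStarTransform (bimoduleMultipliers A)).symm (complexify (h i))) a := by
  rw [sliceSum_apply, map_sum, _root_.sum_apply]
  refine Finset.sum_congr rfl fun i _ => ?_
  rw [minSlice_minTmul, map_smul, map_smul, functionAction_apply]
  rfl

/-- Tail estimate. On `E` each `g i` has norm at most `c / r`, so every slice of a tensor of norm at
most `r` is bounded by `c`, and gluing by a partition of unity costs nothing. The bound depends
neither on the number of summands nor on the length of the tensor. -/
lemma norm_sliceSum_le {ι : Type*} [Fintype ι]
    (h : ι → C(WeakDual.characterSpace ℂ (bimoduleMultipliers A), ℝ)) (g : ι → StrongDual ℂ V)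
    (hh0 : ∀ i t, 0 ≤ h i t) (hh1 : ∀ t, ∑ i, h i t = 1) {E : Submodule ℂ V} {r c : ℝ}
    (hr : 0 < r) (hc : 0 ≤ c) (hg : ∀ i, ∀ v ∈ E, ‖v‖ ≤ r → ‖g i v‖ ≤ c) {n : ℕ}
    (a : Fin n → A) (e : Fin n → V) (he : ∀ j, e j ∈ E)
    (hx : ‖∑ j, minTmul (a j) (e j)‖ ≤ r) : ‖sliceSum h g (∑ j, minTmul (a j) (e j))‖ ≤ c := by
  rw [sliceSum_apply]
  refine norm_sum_functionAction_le h hh0 hh1 _ hc fun i => ?_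
  refine (norm_minSlice_sum_le (g i) E (c := c / r) (by positivity)
    (fun v hv => norm_apply_le_of_bounded_on_ball hr (hg i) hv) a e he).trans ?_
  rw [div_mul_eq_mul_div, div_le_iff₀ hr]
  exact mul_le_mul_of_nonneg_left hx hc

lemma norm_bimoduleMultiplierAction_sub_le {m m' : bimoduleMultipliers A} {η : ℝ}
    (h : ‖m - m'‖ ≤ η) (a : A) :
    ‖bimoduleMultiplierAction m a - bimoduleMultiplierAction m' a‖ ≤ η * ‖a‖ := by
  have e : bimoduleMultiplierAction m a - bimoduleMultiplierAction m' a =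
      bimoduleMultiplierAction (m - m') a := by rw [map_sub]; rfl
  rw [e]
  refine (ContinuousLinearMap.le_opNorm _ _).trans ?_
  rw [norm_bimoduleMultiplierAction]
  exact mul_le_mul_of_nonneg_right h (norm_nonneg _)

/-! ### Approximate extension of bimodule maps to `A ⊗_min V`. -/

namespace GaugeData

variable (d : GaugeData A (MinTensor A V))

lemma mem_boundedSpace {E : Submodule ℂ V} {r : ℝ} (hr : 0 < r)
    (hE : ∀ (a : A), ∀ v ∈ E, ‖a‖ ≤ 1 → ‖v‖ ≤ r → minTmul a v ∈ d.ball)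
    (hEs : ∀ (a : A), ∀ v ∈ E, minTmul a v ∈ d.space) {v : V} (hv : v ∈ E) :
    v ∈ d.boundedSpace := by
  refine ⟨(‖v‖ + 1) / r, fun a => ⟨hEs a v hv, ?_⟩⟩
  by_cases ha : a = 0
  · subst ha
    have e : d.ofMem (minTmul (0 : A) v) (hEs 0 v hv) = 0 := d.incl_injective (by
      rw [incl_ofMem, map_zero]
      exact ((minTmulL A V).flip v).map_zero)
    rw [e, norm_zero, norm_zero, mul_zero]
  have han : 0 < ‖a‖ := norm_pos_iff.2 ha
  have hpos : 0 < (‖v‖ + 1) / r * ‖a‖ := by positivity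
  obtain ⟨k, hk, hkv⟩ := mem_smul_of_norm_mul_le hr d.zero_mem_ball hE hv hpos (a := a) (by
    rw [mul_right_comm, div_mul_cancel₀ _ hr.ne']
    nlinarith)
  exact d.norm_le_of_eq_smul hpos.le hk hkv

/-- The vectors `v` of norm at most `R` for which `a ⊗ v` is in the unit ball of the gauge whenever
`a` is in the unit ball of `A`. -/
def vectorBall (R : ℝ) : Set V :=
  {v | ‖v‖ ≤ R ∧ ∀ a : A, ‖a‖ ≤ 1 → minTmul a v ∈ d.ball}

lemma isClosed_vectorBall (R : ℝ) : IsClosed (d.vectorBall R) := by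
  have h : d.vectorBall R = {v | ‖v‖ ≤ R} ∩
      ⋂ (a : A) (_ : ‖a‖ ≤ 1), (fun v => minTmul a v) ⁻¹' d.ball := by
    ext v
    simp [vectorBall]
  rw [h]
  exact (isClosed_le continuous_norm continuous_const).inter (isClosed_iInter fun a =>
    isClosed_iInter fun _ => d.isClosed_ball.preimage (continuous_minTmul_right a))

lemma convex_vectorBall (R : ℝ) : Convex ℝ (d.vectorBall R) := by
  rintro v ⟨hv, hv'⟩ w ⟨hw, hw'⟩ s t hs ht hst
  refine ⟨?_, fun a ha => ?_⟩
  · have := convex_closedBall (0 : V) R (mem_closedBall_zero_iff.2 hv)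
      (mem_closedBall_zero_iff.2 hw) hs ht hst
    exact mem_closedBall_zero_iff.1 this
  · have := d.isAConvex_ball.convex d.isClosed_ball (hv' a ha) (hw' a ha) hs ht hst
    simpa only [← Complex.coe_smul, ← minTmul_smul, ← minTmul_add] using this

lemma balanced_vectorBall (R : ℝ) : Balanced ℂ (d.vectorBall R) := by
  rintro c hc _ ⟨v, ⟨hv, hv'⟩, rfl⟩
  refine ⟨?_, fun a ha => ?_⟩
  · simp only [norm_smul]
    exact (mul_le_of_le_one_left (norm_nonneg _) hc).trans hv
  · simp only [minTmul_smul]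
    exact (d.isAConvex_ball.balanced d.isClosed_ball).smul_mem hc (hv' a ha)

lemma zero_mem_vectorBall {R : ℝ} (hR : 0 ≤ R) : (0 : V) ∈ d.vectorBall R :=
  ⟨by simpa using hR, fun a _ => by rw [minTmul_zero]; exact d.zero_mem_ball⟩

-- Head estimate: on each elementary tensor both maps act on the first factor through multipliers,
-- and these differ by at most `η`.
variable {d} in
lemma norm_sliceSum_sub_le {ι : Type*} [Fintype ι]
    (h : ι → C(WeakDual.characterSpace ℂ (bimoduleMultipliers A), ℝ)) (g : ι → StrongDual ℂ V)
    {φ : d.Carrier →L[ℂ] A} (hφ : IsBilinearOver A φ) {n : ℕ} (a : Fin n → A)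
    (e : Fin n → d.boundedSpace) {η : ℝ} (hη : ∀ j, ‖∑ i, g i (e j : V) •
      (gelfandStarTransform (bimoduleMultipliers A)).symm (complexify (h i)) -
        symbol hφ (e j)‖ ≤ η) :
    ‖sliceSum h g (∑ j, minTmul (a j) (e j : V)) - φ (∑ j, d.tmul (a j) (e j))‖ ≤
      η * ∑ j, ‖a j‖ := by
  rw [map_sum, map_sum, ← Finset.sum_sub_distrib, Finset.mul_sum]
  refine (norm_sum_le _ _).trans (Finset.sum_le_sum fun j _ => ?_)
  rw [sliceSum_minTmul, ← action_symbol hφ]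
  exact norm_bimoduleMultiplierAction_sub_le (hη j) (a j)

/-- A bimodule map on a gauge space is approximated on a weighted sequence of algebraic tensors by a
bimodule map on `A ⊗_min V`. -/
lemma exists_approximate_extension (E : ℕ → Submodule ℂ V) [∀ k, FiniteDimensional ℂ (E k)]
    {r : ℕ → ℝ} (hr : ∀ k, 0 < r k) {R : ℝ} (hrR : ∀ k, r k ≤ R)
    (hE : ∀ k, ∀ (a : A), ∀ v ∈ E k, ‖a‖ ≤ 1 → ‖v‖ ≤ r k → minTmul a v ∈ d.ball)
    (hEs : ∀ k, ∀ (a : A), ∀ v ∈ E k, minTmul a v ∈ d.space) {w : ℕ → d.Carrier}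
    (hw : ∀ k, ‖w k‖ ≤ 1) (hwr : ∀ k, ‖d.incl (w k)‖ ≤ r k) {n : ℕ → ℕ}
    (a : ∀ k, Fin (n k) → A) (e : ∀ k, Fin (n k) → V) (he : ∀ k j, e k j ∈ E k)
    (hwe : ∀ k, d.incl (w k) = ∑ j, minTmul (a k j) (e k j)) {l : ℕ → ℝ} (hl0 : ∀ k, 0 ≤ l k)
    (hl : Filter.Tendsto l Filter.atTop (𝓝 0)) {φ : d.Carrier →L[ℂ] A} (hφ : IsBilinearOver A φ)
    {η : ℝ} (hη : 0 < η) :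
    ∃ Ψ : MinTensor A V →L[ℂ] A, IsBilinearOver A Ψ ∧
      ∀ k, l k * ‖Ψ (d.incl (w k)) - φ (w k)‖ ≤ η := by
  set C : ℝ := ‖φ‖ + 1 with hCdef
  have hC : 0 < C := by positivity
  have hR0 : 0 ≤ R := (hr 0).le.trans (hrR 0)
  -- The constant `3 C` is `2 C` for the extension plus `C` for `φ` on the unit ball; from `N` on,
  -- the weight `l k` makes this crude bound sufficient.
  obtain ⟨N, hN⟩ := (hl.eventually
    (gt_mem_nhds (div_pos hη (by positivity : 0 < 3 * C)))).exists_forall_of_atTop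
  -- Only the finitely many remaining stages must be matched accurately, and their vectors span a
  -- finite-dimensional space.
  let EN : Submodule ℂ V := ⨆ k : Fin N, E k
  have hEb : EN ≤ d.boundedSpace := iSup_le fun k _ hv =>
    d.mem_boundedSpace (hr k) (hE k) (hEs k) hv
  let M : EN →ₗ[ℂ] bimoduleMultipliers A := (symbol hφ).comp (Submodule.inclusion hEb)
  let S : Set EN := ⋃ k : Fin N, Set.range fun j : Fin (n k) =>
    (⟨e k j, Submodule.mem_iSup_of_mem k (he k j)⟩ : EN)
  have hS : S.Finite := Set.finite_iUnion fun k => Set.finite_range _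
  -- `B` is the total weight of the chosen tensor representations, so accuracy `η / (B + 1)` on the
  -- symbol gives `η` on every weighted head term.
  let B : ℝ := ∑ k : Fin N, l k * ∑ j, ‖a k j‖
  have hB : 0 ≤ B := Finset.sum_nonneg fun k _ => mul_nonneg (hl0 k)
    (Finset.sum_nonneg fun j _ => norm_nonneg _)
  obtain ⟨s, h, g, hh0, hh1, hg, hM⟩ := exists_partition_approximation (d.isClosed_vectorBall R)
    (d.convex_vectorBall R) (d.balanced_vectorBall R) (d.zero_mem_vectorBall hR0)
    (fun x hx => hx.1) EN M hC (fun v hv =>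
      (norm_symbol_le hφ _ hv.2).trans (by rw [hCdef]; linarith)) hS
    (η := η / (B + 1)) (by positivity)
  refine ⟨sliceSum h g, isBilinearOver_sliceSum h g, fun k => ?_⟩
  by_cases hk : k < N
  · have hmem : ∀ j, e k j ∈ EN := fun j =>
      Submodule.mem_iSup_of_mem (⟨k, hk⟩ : Fin N) (he k j)
    have hwk : w k = ∑ j, d.tmul (a k j) ⟨e k j, hEb (hmem j)⟩ := d.incl_injective (by
      rw [hwe, map_sum]
      rfl)
    have hle : ‖sliceSum h g (d.incl (w k)) - φ (w k)‖ ≤ η / (B + 1) * ∑ j, ‖a k j‖ := by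
      rw [hwe, hwk]
      have hS' : ∀ j, (⟨e k j, hmem j⟩ : EN) ∈ S := fun j =>
        Set.mem_iUnion.2 ⟨⟨k, hk⟩, j, rfl⟩
      exact norm_sliceSum_sub_le h g hφ (a k) (fun j => ⟨e k j, hEb (hmem j)⟩) fun j =>
        hM ⟨e k j, hmem j⟩ (hS' j)
    have hkB : l k * ∑ j, ‖a k j‖ ≤ B :=
      Finset.single_le_sum (f := fun k : Fin N => l k * ∑ j, ‖a k j‖)
        (fun k _ => mul_nonneg (hl0 k) (Finset.sum_nonneg fun j _ => norm_nonneg _))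
        (Finset.mem_univ ⟨k, hk⟩)
    calc l k * ‖sliceSum h g (d.incl (w k)) - φ (w k)‖
        ≤ l k * (η / (B + 1) * ∑ j, ‖a k j‖) := mul_le_mul_of_nonneg_left hle (hl0 k)
      _ = η / (B + 1) * (l k * ∑ j, ‖a k j‖) := by ring
      _ ≤ η / (B + 1) * (B + 1) := by gcongr; linarith
      _ = η := div_mul_cancel₀ _ (by positivity)
  · have h1 : ‖sliceSum h g (d.incl (w k))‖ ≤ 2 * C := by
      -- Vectors of the `r k`-ball of `E k` lie in `vectorBall R`, so the functionals are bounded by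
      -- `2 C` on them even though `E k` need not be contained in `EN`.
      rw [hwe]
      exact norm_sliceSum_le h g hh0 hh1 (hr k) (by positivity) (fun i v hv hvr =>
        hg i v ⟨hvr.trans (hrR k), fun b hb => hE k b v hv hb hvr⟩) _ _ (he k)
        (hwe k ▸ hwr k)
    have h2 : ‖φ (w k)‖ ≤ C := (φ.le_opNorm _).trans (by
      have := mul_le_mul_of_nonneg_left (hw k) (norm_nonneg φ)
      rw [hCdef]; linarith)
    have h3 : ‖sliceSum h g (d.incl (w k)) - φ (w k)‖ ≤ 3 * C :=
      (norm_sub_le _ _).trans (by linarith)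
    calc l k * ‖sliceSum h g (d.incl (w k)) - φ (w k)‖ ≤ η / (3 * C) * (3 * C) := by
          have := hN k (not_lt.1 hk)
          gcongr
      _ = η := div_mul_cancel₀ _ (by positivity)

end GaugeData

end Extension

/-! ### The approximation property over an algebra with a unit ball generator -/

section ApproximationProperty

/-! ### Null sequences from a dense subspace. -/

section NullSequence

variable {A : Type*} [NonUnitalCStarAlgebra A] [PartialOrder A] [StarOrderedRing A]
variable {X : Type*} [NormedAddCommGroup X] [NormedSpace ℂ X] [CStarOperatorSpace A X]

/-- A null sequence is contained in the closed `A`-convex hull of a null sequence from a given dense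
subspace. -/
lemma exists_null_sequence_dense (D : Submodule ℂ X) (hD : Dense (D : Set X)) {x : ℕ → X}
    (hx : Filter.Tendsto x Filter.atTop (𝓝 0)) :
    ∃ y : ℕ → X, Filter.Tendsto y Filter.atTop (𝓝 0) ∧ (∀ k, y k ∈ D) ∧
      ∀ n, x n ∈ closedAConvexHull A (Set.range y) := by
  let c : ℕ → ℝ := fun n => ‖x n‖ + 1 / (n + 1)
  have hc : ∀ n, 0 < c n := fun n => by positivity
  have hc0 : Filter.Tendsto c Filter.atTop (𝓝 0) := by
    simpa [c] using hx.norm.add tendsto_one_div_add_atTop_nhds_zero_nat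
  -- Starting at 0, allowed since `‖x n‖ ≤ c n`, makes the telescoping sum of the differences
  -- converge to `x n` itself.
  have hex : ∀ n k, ∃ v ∈ D, ‖x n - v‖ ≤ c n * (1 / 4) ^ k ∧ (k = 0 → v = 0) := by
    intro n k
    by_cases hk : k = 0
    · refine ⟨0, D.zero_mem, ?_, fun _ => rfl⟩
      have : (0 : ℝ) ≤ 1 / (n + 1) := by positivity
      simp only [hk, c, sub_zero, pow_zero, mul_one]
      linarith
    · have hpos : 0 < c n * (1 / 4) ^ k := mul_pos (hc n) (by positivity)
      obtain ⟨v, hv, hvx⟩ := hD.exists_dist_lt (x n) hpos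
      exact ⟨v, hv, by rw [← dist_eq_norm]; exact hvx.le, fun h => absurd h hk⟩
  choose v hvD hv hv0 using hex
  -- The rate `4⁻ᵏ` leaves room for the factor `2ᵏ⁺¹`: the `Y (n, k)` still vanish at infinity,
  -- while `x n = ∑ 2⁻ᵏ⁻¹ Y (n, k)`.
  let Y : ℕ × ℕ → X := fun p => ((2 ^ (p.2 + 1) : ℝ) : ℂ) • (v p.1 (p.2 + 1) - v p.1 p.2)
  have hYn : ∀ p, ‖Y p‖ ≤ 4 * (c p.1 * (1 / 2) ^ p.2) := by
    rintro ⟨n, k⟩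
    have h1 : ‖v n (k + 1) - v n k‖ ≤ c n * (1 / 4) ^ (k + 1) + c n * (1 / 4) ^ k := by
      have : v n (k + 1) - v n k = (x n - v n k) - (x n - v n (k + 1)) := by abel
      rw [this]
      refine (norm_sub_le _ _).trans ?_
      linarith [hv n k, hv n (k + 1)]
    have h2 : (2 : ℝ) ^ (k + 1) * (1 / 4) ^ k = 2 * (1 / 2) ^ k := by
      rw [pow_succ, mul_right_comm, ← mul_pow, mul_comm]
      norm_num
    simp only [Y]
    rw [norm_smul, Complex.norm_real, Real.norm_of_nonneg (by positivity)]
    calc (2 : ℝ) ^ (k + 1) * ‖v n (k + 1) - v n k‖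
        ≤ 2 ^ (k + 1) * (c n * (1 / 4) ^ (k + 1) + c n * (1 / 4) ^ k) := by gcongr
      _ = 5 / 4 * c n * (2 ^ (k + 1) * (1 / 4) ^ k) := by ring
      _ = 5 / 2 * (c n * (1 / 2) ^ k) := by rw [h2]; ring
      _ ≤ 4 * (c n * (1 / 2) ^ k) := by
        have := hc n
        gcongr
        norm_num
  have hY0 : Filter.Tendsto Y Filter.cofinite (𝓝 0) := by
    refine squeeze_zero_norm hYn ?_
    have h2 : Filter.Tendsto (fun k : ℕ => (1 / 2 : ℝ) ^ k) Filter.cofinite (𝓝 0) := by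
      rw [Nat.cofinite_eq_atTop]
      exact tendsto_pow_atTop_nhds_zero_of_lt_one (by norm_num) (by norm_num)
    rw [← Nat.cofinite_eq_atTop] at hc0
    simpa using (tendsto_mul_cofinite_nhds_zero hc0 h2).const_mul 4
  obtain ⟨y, hy, hyY⟩ := exists_null_sequence_range_eq hY0
  have hYD : ∀ p, Y p ∈ D := fun p => D.smul_mem _ (D.sub_mem (hvD _ _) (hvD _ _))
  refine ⟨y, hy, fun k => ?_, fun n => ?_⟩
  · obtain ⟨p, hp⟩ := hyY.le ⟨k, rfl⟩
    rw [← hp]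
    exact hYD p
  · rw [hyY]
    refine (isAConvex_closedAConvexHull (A := A) _).mem_of_tendsto_sum
      (isClosed_closedAConvexHull _) (y := fun k => Y (n, k))
      (fun k => subset_closedAConvexHull _ (Set.mem_range_self (n, k))) ?_
    have hsum : ∀ m, ∑ k ∈ Finset.range m, (((1 / 2) ^ (k + 1) : ℝ) : ℂ) • Y (n, k) = v n m := by
      intro m
      have : ∀ k, (((1 / 2) ^ (k + 1) : ℝ) : ℂ) • Y (n, k) = v n (k + 1) - v n k := by
        intro k
        simp only [Y]
        rw [smul_smul, ← Complex.ofReal_mul, ← mul_pow]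
        norm_num
      simp only [this]
      rw [Finset.sum_range_sub, hv0 n 0 rfl, sub_zero]
    simp only [hsum]
    rw [tendsto_iff_norm_sub_tendsto_zero]
    refine squeeze_zero (fun _ => norm_nonneg _) (fun m => (norm_sub_rev _ _).le.trans (hv n m)) ?_
    simpa using (tendsto_pow_atTop_nhds_zero_of_lt_one (by norm_num : (0 : ℝ) ≤ 1 / 4)
      (by norm_num)).const_mul (c n)

end NullSequence

/-! ### Algebraic tensors and maps of finite `A`-rank. -/

section Sufficiency

variable {A : Type*} [NonUnitalCStarAlgebra A] [PartialOrder A] [StarOrderedRing A]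
variable {V : Type*} [NormedAddCommGroup V] [NormedSpace ℂ V] [OperatorSpace V]

variable (A V) in
/-- The algebraic tensors in `A ⊗_min V`. -/
def algebraicTensors : Submodule ℂ (MinTensor A V) :=
  (UniformSpace.Completion.toComplL (𝕜 := ℂ) (E := AlgMinTensor A V)).toLinearMap.range

lemma dense_algebraicTensors : Dense (algebraicTensors A V : Set (MinTensor A V)) :=
  UniformSpace.Completion.denseRange_coe

lemma exists_sum_of_mem_algebraicTensors {x : MinTensor A V} (hx : x ∈ algebraicTensors A V) :
    ∃ (k : ℕ) (a : Fin k → A) (v : Fin k → V), x = ∑ i, minTmul (a i) (v i) := by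
  obtain ⟨u, rfl⟩ := hx
  exact coe_algMinTensor_eq_sum u

variable (A) in
/-- The bounded map `a ↦ a ⊗ v`. -/
def minTmulLeft (v : V) : A →L[ℂ] MinTensor A V :=
  ((minTmulL A V).flip v).mkContinuous ‖v‖ fun a => by
    rw [mul_comm]; exact norm_minTmul_le a v

@[simp] lemma minTmulLeft_apply (v : V) (a : A) : minTmulLeft A v a = minTmul a v := rfl

lemma hasFiniteARank_sum {W : Type*} [NormedAddCommGroup W] [NormedSpace ℂ W]
    [CStarOperatorSpace A W] {k : ℕ} (f : Fin k → W →L[ℂ] A) (v : Fin k → V)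
    (hf : ∀ i, IsBilinearOver A (f i)) :
    HasFiniteARank (∑ i, (minTmulLeft A (v i)).comp (f i)) := by
  refine ⟨IsBilinearOver.sum _ fun i _ a b w => ?_, k, f, v, hf, fun w => ?_⟩
  · rw [ContinuousLinearMap.comp_apply, ContinuousLinearMap.comp_apply, hf, bimul_self,
      minTmulLeft_apply, minTmulLeft_apply, bimul_minTmul]
  · rw [_root_.sum_apply]
    rfl

/-- Composition with a finite rank map. -/
lemma HasFiniteARank.comp {W : Type*} [NormedAddCommGroup W] [NormedSpace ℂ W]
    [CStarOperatorSpace A W] {ψ : MinTensor A V →L[ℂ] MinTensor A V} (hψ : HasFiniteARank ψ)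
    {φ : W →L[ℂ] MinTensor A V} (hφ : IsBilinearOver A φ) : HasFiniteARank (ψ.comp φ) := by
  obtain ⟨hb, k, f, v, hf, hψ⟩ := hψ
  refine ⟨fun a b w => ?_, k, fun i => (f i).comp φ, v, fun i a b w => ?_, fun w => hψ _⟩
  · rw [ContinuousLinearMap.comp_apply, hφ, hb]; rfl
  · rw [ContinuousLinearMap.comp_apply, hφ, hf]; rfl

/-- `ψ - id` is again a bimodule map and balls are `A`-convex; hence an approximation valid on a
generating sequence is valid on its closed hull with the same `ε`. -/
lemma isAConvex_setOf_norm_sub_le {X : Type*} [NormedAddCommGroup X] [NormedSpace ℂ X]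
    [CStarOperatorSpace A X] {ψ : X →L[ℂ] X} (hψ : IsBilinearOver A ψ) (ε : ℝ) :
    IsAConvex A {v | ‖ψ v - v‖ ≤ ε} := by
  intro v₁ h₁ v₂ h₂ a₁ a₂ b₁ b₂ ha hb
  have e : ψ (bimul A a₁ v₁ b₁ + bimul A a₂ v₂ b₂) - (bimul A a₁ v₁ b₁ + bimul A a₂ v₂ b₂) =
      bimul A a₁ (ψ v₁ - v₁) b₁ + bimul A a₂ (ψ v₂ - v₂) b₂ := by
    rw [map_add, hψ, hψ, bimul_sub, bimul_sub]
    abel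
  exact (congrArg norm e).trans_le (norm_bimul_add_bimul_le ha hb h₁ h₂)

end Sufficiency

/-- Approximation of the inclusion of the compact gauge spaces implies the approximation
property. -/
theorem hasAApproximationProperty_of_isUnitBallGenerator {A : Type u} [NonUnitalCStarAlgebra A]
    [PartialOrder A] [StarOrderedRing A] {V : Type u} [NormedAddCommGroup V] [NormedSpace ℂ V]
    [OperatorSpace V] {p : A} (hp : IsUnitBallGenerator p)
    (H : ∀ (W : Type u) [NormedAddCommGroup W] [NormedSpace ℂ W] [CStarOperatorSpace A W]
        (φ : W →L[ℂ] MinTensor A V), IsACompactMap A φ →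
        ∀ ε : ℝ, 0 < ε → ∃ ψ : W →L[ℂ] MinTensor A V, HasFiniteARank ψ ∧ ‖φ - ψ‖ ≤ ε) :
    HasAApproximationProperty A V := by
  rintro S ⟨-, x, hx, hSx⟩ ε hε
  obtain ⟨y, hy, hyD, hxy⟩ := exists_null_sequence_dense (A := A) (algebraicTensors A V)
    dense_algebraicTensors hx
  -- The square root splits the decay of `y` between `l` and `z`, with `‖z k‖ ≤ √‖y k‖`; the second
  -- summand keeps `l k` invertible.
  let l : ℕ → ℝ := fun k => √‖y k‖ + 1 / (k + 1)
  have hl : ∀ k, 0 < l k := fun k => by positivity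
  have hl0 : Filter.Tendsto l Filter.atTop (𝓝 0) := by
    simpa [l] using hy.norm.sqrt.add tendsto_one_div_add_atTop_nhds_zero_nat
  let z : ℕ → MinTensor A V := fun k => (((l k)⁻¹ : ℝ) : ℂ) • y k
  have hyz : ∀ k, y k = ((l k : ℝ) : ℂ) • z k := fun k => by
    simp only [z]
    rw [smul_smul, ← Complex.ofReal_mul, mul_inv_cancel₀ (hl k).ne', Complex.ofReal_one, one_smul]
  have hz : Filter.Tendsto z Filter.atTop (𝓝 0) := by
    refine squeeze_zero_norm (a := fun k => √‖y k‖) (fun k => ?_) (by simpa using hy.norm.sqrt)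
    have hsq : √‖y k‖ ≤ l k := by
      have : (0 : ℝ) ≤ 1 / (k + 1) := by positivity
      simp only [l]; linarith
    simp only [z]
    rw [norm_smul, Complex.norm_real, Real.norm_of_nonneg (inv_nonneg.2 (hl k).le),
      inv_mul_le_iff₀ (hl k)]
    calc ‖y k‖ = √‖y k‖ * √‖y k‖ := (Real.mul_self_sqrt (norm_nonneg _)).symm
      _ ≤ l k * √‖y k‖ := by gcongr
  have hzD : ∀ k, z k ∈ algebraicTensors A V := fun k => Submodule.smul_mem _ _ (hyD k)
  choose n a e hze using fun k => exists_sum_of_mem_algebraicTensors (hzD k)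
  let E : ℕ → Submodule ℂ V := fun k => Submodule.span ℂ (Set.range (e k))
  have hEfin : ∀ k, FiniteDimensional ℂ (E k) := fun k =>
    FiniteDimensional.span_of_finite ℂ (Set.finite_range _)
  have he : ∀ k j, e k j ∈ E k := fun k j => Submodule.subset_span ⟨j, rfl⟩
  obtain ⟨r, t, hr, hzr, hr0, ht, hzt, hEt⟩ := exists_hull_of_null_sequence hp E z hz
  obtain ⟨R, hR⟩ := ht.norm.bddAbove_range
  obtain ⟨R', hR'⟩ := hr0.bddAbove_range
  obtain ⟨L, hL⟩ := hl0.bddAbove_range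
  have hLpos : 0 < L := (hl 0).trans_le (hL ⟨0, rfl⟩)
  set K := closedAConvexHull A (Set.range t) with hK
  have hKcl : IsClosed K := isClosed_closedAConvexHull _
  have hKcv : IsAConvex A K := isAConvex_closedAConvexHull _
  have hKR : ∀ w ∈ K, ‖w‖ ≤ R := fun w hw => mem_closedBall_zero_iff.1
    (closedAConvexHull_subset Metric.isClosed_closedBall (isAConvex_closedBall (A := A) R)
      (by rintro _ ⟨k, rfl⟩; exact mem_closedBall_zero_iff.2 (hR ⟨k, rfl⟩)) hw)
  let d := tensorGaugeData E r hr K hKcl hKcv ((hKcv.balanced hKcl).zero_mem ⟨_, hzt 0⟩) R hKR hEt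
  have hEs : ∀ k, ∀ (b : A), ∀ v ∈ E k, minTmul b v ∈ d.space := fun k b v hv =>
    Submodule.subset_span ⟨k, b, v, hv, rfl⟩
  have hzs : ∀ k, z k ∈ d.space := fun k => by
    rw [hze k]
    exact Submodule.sum_mem _ fun j _ => hEs k _ _ (he k j)
  let w : ℕ → d.Carrier := fun k => d.ofMem (z k) (hzs k)
  -- The unit ball of the gauge space lies in `K`, the closed hull of the null sequence `t`.
  have hcompact : IsACompactMap A d.inclL := by
    refine ⟨d.isBilinearOver_inclL, isClosed_closure, t, ht, closure_minimal ?_ hKcl⟩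
    rintro _ ⟨v, hv, rfl⟩
    exact d.norm_le_one_iff.1 (mem_closedBall_zero_iff.1 hv)
  obtain ⟨ψ₀, ⟨-, m, f, v, hf, hψ₀⟩, hclose⟩ := H d.Carrier d.inclL hcompact (ε / (2 * L))
    (by positivity)
  have hη : 0 < ε / (2 * (∑ i, ‖v i‖ + 1)) := by
    have : 0 ≤ ∑ i, ‖v i‖ := Finset.sum_nonneg fun i _ => norm_nonneg _
    positivity
  -- Each coordinate functional is replaced separately, with accuracy chosen so that after tensoring
  -- with the `v i` the total error is at most `ε / 2`.
  choose Ψ hΨb hΨ using fun i => d.exists_approximate_extension E hr (fun k => hR' ⟨k, rfl⟩) hEt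
    hEs (w := w) (fun k => d.norm_le_one_iff.2 (hzt k)) hzr a e he hze (fun k => (hl k).le) hl0
    (hf i) hη
  let ψ : MinTensor A V →L[ℂ] MinTensor A V := ∑ i, (minTmulLeft A (v i)).comp (Ψ i)
  have hψ : HasFiniteARank ψ := hasFiniteARank_sum Ψ v hΨb
  have hψz : ∀ k, ψ (z k) - z k = (ψ₀ (w k) - d.inclL (w k)) +
      ∑ i, minTmul (Ψ i (z k) - f i (w k)) (v i) := by
    intro k
    have h1 : ψ (z k) = ∑ i, minTmul (Ψ i (z k)) (v i) := by
      simp only [ψ]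
      rw [_root_.sum_apply]
      rfl
    rw [h1, hψ₀]
    simp only [minTmul_sub, Finset.sum_sub_distrib]
    change _ - z k = _ - z k + _
    abel
  have hk : ∀ k, ‖ψ (y k) - y k‖ ≤ ε := by
    intro k
    have h1 : l k * ‖ψ₀ (w k) - d.inclL (w k)‖ ≤ ε / 2 := by
      have hw1 : ‖w k‖ ≤ 1 := d.norm_le_one_iff.2 (hzt k)
      have h2 : ‖ψ₀ (w k) - d.inclL (w k)‖ ≤ ε / (2 * L) := by
        rw [norm_sub_rev]
        exact ((d.inclL - ψ₀).le_opNorm_of_le hw1).trans (by rwa [mul_one])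
      calc l k * ‖ψ₀ (w k) - d.inclL (w k)‖ ≤ L * (ε / (2 * L)) := by
            have := hL ⟨k, rfl⟩
            gcongr
        _ = ε / 2 := by field_simp
    have h2 : l k * ‖∑ i, minTmul (Ψ i (z k) - f i (w k)) (v i)‖ ≤ ε / 2 := by
      calc l k * ‖∑ i, minTmul (Ψ i (z k) - f i (w k)) (v i)‖
          ≤ l k * ∑ i, ‖Ψ i (z k) - f i (w k)‖ * ‖v i‖ := by
            have := (hl k).le
            gcongr
            exact (norm_sum_le _ _).trans (Finset.sum_le_sum fun i _ => norm_minTmul_le _ _)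
        _ = ∑ i, l k * ‖Ψ i (z k) - f i (w k)‖ * ‖v i‖ := by
            rw [Finset.mul_sum]
            simp only [mul_assoc]
        _ ≤ ∑ i, ε / (2 * (∑ i, ‖v i‖ + 1)) * ‖v i‖ := Finset.sum_le_sum fun i _ =>
            mul_le_mul_of_nonneg_right (hΨ i k) (norm_nonneg _)
        _ = ε / (2 * (∑ i, ‖v i‖ + 1)) * ∑ i, ‖v i‖ := by rw [Finset.mul_sum]
        _ ≤ ε / (2 * (∑ i, ‖v i‖ + 1)) * (∑ i, ‖v i‖ + 1) := by
            gcongr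
            linarith
        _ = ε / 2 := by
            have : 0 ≤ ∑ i, ‖v i‖ := Finset.sum_nonneg fun i _ => norm_nonneg _
            field_simp
    rw [hyz k, map_smul, ← smul_sub, norm_smul, Complex.norm_real, Real.norm_of_nonneg (hl k).le,
      hψz k]
    refine (mul_le_mul_of_nonneg_left (norm_add_le _ _) (hl k).le).trans ?_
    linarith
  have hclosed : IsClosed {v | ‖ψ v - v‖ ≤ ε} :=
    isClosed_le (ψ.continuous.sub continuous_id).norm continuous_const
  have hyS : closedAConvexHull A (Set.range y) ⊆ {v | ‖ψ v - v‖ ≤ ε} :=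
    closedAConvexHull_subset hclosed (isAConvex_setOf_norm_sub_le hψ.1 ε)
      (by rintro _ ⟨k, rfl⟩; exact hk k)
  refine ⟨ψ, hψ, fun s hs => hyS ?_⟩
  exact closedAConvexHull_mono (by rintro _ ⟨k, rfl⟩; exact hxy k) (hSx hs)

/-- The approximation property passes to compact maps. -/
theorem HasAApproximationProperty.exists_hasFiniteARank {A : Type*} [NonUnitalCStarAlgebra A]
    [PartialOrder A] [StarOrderedRing A] {V : Type*} [NormedAddCommGroup V] [NormedSpace ℂ V]
    [OperatorSpace V] (h : HasAApproximationProperty A V) {W : Type*} [NormedAddCommGroup W]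
    [NormedSpace ℂ W] [CStarOperatorSpace A W] {φ : W →L[ℂ] MinTensor A V}
    (hφ : IsACompactMap A φ) {ε : ℝ} (hε : 0 < ε) :
    ∃ ψ : W →L[ℂ] MinTensor A V, HasFiniteARank ψ ∧ ‖φ - ψ‖ ≤ ε := by
  obtain ⟨ψ, hψ, hle⟩ := h _ hφ.2 ε hε
  refine ⟨ψ.comp φ, hψ.comp hφ.1, ContinuousLinearMap.opNorm_le_of_unit_norm hε.le fun w hw => ?_⟩
  have := hle (φ w) (subset_closure ⟨w, mem_closedBall_zero_iff.2 hw.le, rfl⟩)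
  rw [_root_.sub_apply, norm_sub_rev]
  exact this

end ApproximationProperty

/-! ### The operator space structure of a unital C*-algebra -/

section RectangularNorm

variable {B : Type*} [NonUnitalCStarAlgebra B] [PartialOrder B] [StarOrderedRing B]
variable {m n : Type*} [Fintype m] [Fintype n]

lemma CStarMatrix.norm_conjTranspose_le (M : CStarMatrix m n B) : ‖M.conjTranspose‖ ≤ ‖M‖ := by
  refine CStarMatrix.norm_le_of_forall_inner_le (C := ⟨‖M‖, norm_nonneg _⟩) fun v w => ?_
  refine (congrArg norm (CStarMatrix.inner_toCLM_conjTranspose_right (M := M))).trans_le ?_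
  refine (CStarModule.norm_inner_le _).trans ?_
  have := (CStarMatrix.toCLM M).le_opNorm w
  calc ‖CStarMatrix.toCLM M w‖ * ‖v‖ ≤ ‖M‖ * ‖w‖ * ‖v‖ := by
        gcongr
        exact this
    _ = ‖M‖ * ‖v‖ * ‖w‖ := by ring

/-- The C*-inequality for rectangular matrices comes from `⟨Mv, Mv⟩ = ⟨v, M*Mv⟩`; as `toCLM`
reverses products, the matrix that appears is `M * M.conjTranspose`. -/
lemma CStarMatrix.norm_sq_le_norm_mul_conjTranspose (M : CStarMatrix m n B) :
    ‖M‖ ^ 2 ≤ ‖M * M.conjTranspose‖ := by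
  have h : ‖M‖ ≤ √‖M * M.conjTranspose‖ := by
    refine ContinuousLinearMap.opNorm_le_bound _ (Real.sqrt_nonneg _) fun v => ?_
    refine abs_le_of_sq_le_sq' ?_ (by positivity) |>.2
    rw [mul_pow, Real.sq_sqrt (norm_nonneg _), CStarModule.norm_sq_eq B,
      ← CStarMatrix.inner_toCLM_conjTranspose_right]
    refine (CStarModule.norm_inner_le _).trans ?_
    have e : CStarMatrix.toCLM (Matrix.conjTranspose M) (CStarMatrix.toCLM M v) =
        CStarMatrix.toCLM (M * M.conjTranspose) v := by
      rw [CStarMatrix.toCLM_mul]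
      rfl
    rw [e]
    calc ‖v‖ * ‖CStarMatrix.toCLM (M * M.conjTranspose) v‖
        ≤ ‖v‖ * (‖M * M.conjTranspose‖ * ‖v‖) := by
          gcongr
          exact (CStarMatrix.toCLM (M * M.conjTranspose)).le_opNorm v
      _ = ‖M * M.conjTranspose‖ * ‖v‖ ^ 2 := by ring
  calc ‖M‖ ^ 2 ≤ √‖M * M.conjTranspose‖ ^ 2 := by gcongr
    _ = _ := Real.sq_sqrt (norm_nonneg _)

end RectangularNorm

/-! ### Ruan's axioms for matrices over a C*-algebra. -/

section OperatorSpaceStructure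

variable {B : Type*} [CStarAlgebra B] [PartialOrder B] [StarOrderedRing B]

/-- A scalar matrix as a matrix with entries in `B`. -/
def scalarMatrix (B : Type*) [CStarAlgebra B] {m n : ℕ} (α : Matrix (Fin m) (Fin n) ℂ) :
    CStarMatrix (Fin m) (Fin n) B :=
  CStarMatrix.ofMatrix (α.map (algebraMap ℂ B))

/-- On square matrices the entrywise inclusion of scalars is a *-homomorphism, hence contractive;
passing to `α α*` reduces the rectangular case to it. -/
lemma norm_scalarMatrix_le {m n : ℕ} (α : Matrix (Fin m) (Fin n) ℂ) :
    ‖scalarMatrix B α‖ ≤ ‖CStarMatrix.ofMatrix α‖ := by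
  let Φ : CStarMatrix (Fin m) (Fin m) ℂ →⋆ₙₐ[ℂ] CStarMatrix (Fin m) (Fin m) B :=
    CStarMatrix.mapₙₐ ((StarAlgHom.ofId ℂ B : ℂ →⋆ₐ[ℂ] B) : ℂ →⋆ₙₐ[ℂ] B)
  have e : scalarMatrix B α * (scalarMatrix B α).conjTranspose =
      Φ (CStarMatrix.ofMatrix α * (CStarMatrix.ofMatrix α).conjTranspose) := by
    refine CStarMatrix.ext fun i j => ?_
    simp [scalarMatrix, Φ, CStarMatrix.mul_apply, CStarMatrix.mapₙₐ,
      CStarMatrix.conjTranspose_apply, map_sum]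
    exact Finset.sum_congr rfl fun k _ =>
      congrArg _ (algebraMap_star_comm (A := B) (α j k)).symm
  refine abs_le_of_sq_le_sq' ?_ (norm_nonneg _) |>.2
  calc ‖scalarMatrix B α‖ ^ 2 ≤ ‖scalarMatrix B α * (scalarMatrix B α).conjTranspose‖ :=
        CStarMatrix.norm_sq_le_norm_mul_conjTranspose _
    _ ≤ ‖CStarMatrix.ofMatrix α * (CStarMatrix.ofMatrix α).conjTranspose‖ := by
        rw [e]
        exact NonUnitalStarAlgHom.norm_apply_le Φ _
    _ ≤ ‖CStarMatrix.ofMatrix α‖ * ‖(CStarMatrix.ofMatrix α).conjTranspose‖ :=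
        CStarMatrix.norm_rectangular_mul_le _ _
    _ ≤ ‖CStarMatrix.ofMatrix α‖ ^ 2 := by
        rw [sq]
        exact mul_le_mul_of_nonneg_left (CStarMatrix.norm_conjTranspose_le _) (norm_nonneg _)

lemma ofMatrix_scalarConj {m n : ℕ} (α : Matrix (Fin m) (Fin n) ℂ) (x : Matrix (Fin n) (Fin n) B)
    (β : Matrix (Fin n) (Fin m) ℂ) : CStarMatrix.ofMatrix (scalarConj α x β) =
      scalarMatrix B α * CStarMatrix.ofMatrix x * scalarMatrix B β := by
  refine CStarMatrix.ext fun i j => ?_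
  simp only [scalarConj, scalarMatrix, CStarMatrix.mul_apply, CStarMatrix.ofMatrix_apply,
    Matrix.map_apply, Finset.sum_mul]
  rw [Matrix.of_apply, Finset.sum_comm]
  refine Finset.sum_congr rfl fun k _ => Finset.sum_congr rfl fun l _ => ?_
  simp only [Algebra.algebraMap_eq_smul_one, smul_mul_assoc, mul_smul_comm, one_mul, mul_one,
    smul_smul, mul_comm]

variable (B) in
/-- The block diagonal embedding. -/
def directSumHom (n m : ℕ) : CStarMatrix (Fin n) (Fin n) B × CStarMatrix (Fin m) (Fin m) B →⋆ₙₐ[ℂ]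
    CStarMatrix (Fin (n + m)) (Fin (n + m)) B where
  toFun p := CStarMatrix.ofMatrix
    (directSumMatrix (CStarMatrix.ofMatrix.symm p.1) (CStarMatrix.ofMatrix.symm p.2))
  map_smul' c p := by
    refine CStarMatrix.ext fun i j => ?_
    refine Fin.addCases (fun i => ?_) (fun i => ?_) i <;>
    refine Fin.addCases (fun j => ?_) (fun j => ?_) j <;> simp [directSumMatrix]
  map_zero' := by
    refine CStarMatrix.ext fun i j => ?_
    refine Fin.addCases (fun i => ?_) (fun i => ?_) i <;>
    refine Fin.addCases (fun j => ?_) (fun j => ?_) j <;> simp [directSumMatrix]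
  map_add' p q := by
    refine CStarMatrix.ext fun i j => ?_
    refine Fin.addCases (fun i => ?_) (fun i => ?_) i <;>
    refine Fin.addCases (fun j => ?_) (fun j => ?_) j <;> simp [directSumMatrix]
  map_mul' p q := by
    refine CStarMatrix.ext fun i j => ?_
    refine Fin.addCases (fun i => ?_) (fun i => ?_) i <;>
    refine Fin.addCases (fun j => ?_) (fun j => ?_) j <;>
    simp [directSumMatrix, CStarMatrix.mul_apply, Fin.sum_univ_add]
  map_star' p := by
    refine CStarMatrix.ext fun i j => ?_
    refine Fin.addCases (fun i => ?_) (fun i => ?_) i <;>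
    refine Fin.addCases (fun j => ?_) (fun j => ?_) j <;>
    simp [directSumMatrix, CStarMatrix.star_apply]

/-- Injective *-homomorphisms are isometric and the product carries the maximum norm, whence Ruan's
direct sum axiom. -/
lemma directSumHom_injective (n m : ℕ) : Function.Injective (directSumHom B n m) := by
  intro p q h
  refine Prod.ext (CStarMatrix.ext fun i j => ?_) (CStarMatrix.ext fun i j => ?_)
  · have := congrArg (fun M : CStarMatrix (Fin (n + m)) (Fin (n + m)) B =>
      M (Fin.castAdd m i) (Fin.castAdd m j)) h
    simpa [directSumHom, directSumMatrix] using this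
  · have := congrArg (fun M : CStarMatrix (Fin (n + m)) (Fin (n + m)) B =>
      M (Fin.natAdd n i) (Fin.natAdd n j)) h
    simpa [directSumHom, directSumMatrix] using this

lemma diagHom_one_injective : Function.Injective (diagHom (A := B) 1) := by
  intro a b h
  have := congrArg (fun M : CStarMatrix (Fin 1) (Fin 1) B => M 0 0) h
  simpa [diagHom_apply] using this

variable (B) in
/-- The canonical operator space structure of a unital C*-algebra. -/
abbrev CStarAlgebra.operatorSpace : OperatorSpace B where
  matNorm n := (normSeminorm ℂ (CStarMatrix (Fin n) (Fin n) B)).comp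
    (CStarMatrix.ofMatrixₗ (R := ℂ)).toLinearMap
  matNorm_one x := by
    change ‖CStarMatrix.ofMatrix x‖ = _
    have e : CStarMatrix.ofMatrix x = diagHom 1 (x 0 0) := by
      refine CStarMatrix.ext fun i j => ?_
      rw [diagHom_apply, if_pos (Subsingleton.elim i j), Subsingleton.elim i 0,
        Subsingleton.elim j 0]
      rfl
    rw [e]
    exact NonUnitalStarAlgHom.norm_map _ diagHom_one_injective _
  matNorm_directSum {n m} x y :=
    NonUnitalStarAlgHom.norm_map _ (directSumHom_injective (B := B) n m)
      (CStarMatrix.ofMatrix x, CStarMatrix.ofMatrix y)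
  matNorm_scalarConj_le {m n} α x β := by
    change ‖CStarMatrix.ofMatrix (scalarConj α x β)‖ ≤ _ * ‖CStarMatrix.ofMatrix x‖ * _
    rw [ofMatrix_scalarConj]
    refine (CStarMatrix.norm_rectangular_mul_le _ _).trans ?_
    refine mul_le_mul ((CStarMatrix.norm_rectangular_mul_le _ _).trans ?_)
      (norm_scalarMatrix_le β) (norm_nonneg _) (by positivity)
    exact mul_le_mul_of_nonneg_right (norm_scalarMatrix_le α) (norm_nonneg _)

end OperatorSpaceStructure

/-! ### Injective C*-algebras are unital -/

section Unit

/-- The matrix with rows `(x, u)` and `(-u, x)`. -/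
def rotationMatrix {B : Type*} [Neg B] (x u : B) : Matrix (Fin 2) (Fin 2) B := !![x, u; -u, x]

/-- The rotation form makes `D D*` diagonal with entry `(1 - u)² + u²`, and `1` minus this entry is
`2 u (1 - u) ≥ 0`. -/
lemma norm_rotationMatrix_le {B : Type*} [CStarAlgebra B] [PartialOrder B] [StarOrderedRing B]
    {u : B} (hu0 : 0 ≤ u) (hu1 : u ≤ 1) :
    ‖CStarMatrix.ofMatrix (rotationMatrix (1 - u) u)‖ ≤ 1 := by
  have hs : star u = u := hu0.isSelfAdjoint.star_eq
  set D := CStarMatrix.ofMatrix (rotationMatrix (1 - u) u) with hD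
  have e : D * star D = diagHom 2 ((1 - u) * (1 - u) + u * u) := by
    refine CStarMatrix.ext fun i j => ?_
    rw [diagHom_apply]
    fin_cases i <;> fin_cases j <;>
    simp [hD, rotationMatrix, CStarMatrix.mul_apply, CStarMatrix.star_apply, hs, mul_sub, sub_mul]
    abel
  have h1u : 0 ≤ 1 - u := sub_nonneg.2 hu1
  have hpos : 0 ≤ (1 - u) * (1 - u) + u * u :=
    add_nonneg (h1u.isSelfAdjoint.mul_self_nonneg) (hu0.isSelfAdjoint.mul_self_nonneg)
  have hle : (1 - u) * (1 - u) + u * u ≤ 1 := by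
    have h : 0 ≤ u * (1 - u) := (((Commute.one_right u).sub_right (Commute.refl u))).mul_nonneg
      hu0 h1u
    have e : 1 - ((1 - u) * (1 - u) + u * u) = u * (1 - u) + u * (1 - u) := by noncomm_ring
    rw [← sub_nonneg, e]
    exact add_nonneg h h
  have hn := CStarRing.norm_self_mul_star (x := D)
  rw [e] at hn
  have h2 := (norm_diagHom_le 2 ((1 - u) * (1 - u) + u * u)).trans
    ((CStarAlgebra.norm_le_one_iff_of_nonneg _ hpos).2 hle)
  rw [hn] at h2
  nlinarith [norm_nonneg D]

variable {A : Type u} [NonUnitalCStarAlgebra A] [PartialOrder A] [StarOrderedRing A]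

lemma norm_row_rotationMatrix_le {x u : A}
    (h : ‖CStarMatrix.ofMatrix (rotationMatrix x u)‖ ≤ 1) : ‖x * star x + u * star u‖ ≤ 1 := by
  set D := CStarMatrix.ofMatrix (rotationMatrix x u) with hD
  have e : (D * star D) 0 0 = x * star x + u * star u := by
    simp [hD, rotationMatrix, CStarMatrix.mul_apply, CStarMatrix.star_apply]
  rw [← e]
  refine CStarMatrix.norm_entry_le_norm.trans ?_
  rw [CStarRing.norm_self_mul_star]
  nlinarith [norm_nonneg D]

/-- An injective C*-algebra has an element `e` such that the row `(e - u, u)` is contractive for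
every positive contraction `u`, like the row `(1 - u, u)` in the unitization. -/
lemma IsInjectiveCStarAlgebra.exists_row_contraction (hA : IsInjectiveCStarAlgebra A) :
    ∃ e : A, ∀ u : A, 0 ≤ u → ‖u‖ ≤ 1 →
      ‖(e - u) * star (e - u) + u * star u‖ ≤ 1 := by
  let _ : PartialOrder (Unitization ℂ A) := CStarAlgebra.spectralOrder _
  have : StarOrderedRing (Unitization ℂ A) := CStarAlgebra.spectralOrderedRing _
  let _ : OperatorSpace (Unitization ℂ A) := CStarAlgebra.operatorSpace (Unitization ℂ A)
  let E : Submodule ℂ (Unitization ℂ A) := (Unitization.inrHom ℂ ℂ A).range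
  let φ : E →ₗ[ℂ] A := (Unitization.sndHom ℂ ℂ A).comp E.subtype
  have hφ : IsCompletelyContractive φ := by
    intro n x
    let ι : CStarMatrix (Fin n) (Fin n) A →⋆ₙₐ[ℂ] CStarMatrix (Fin n) (Fin n) (Unitization ℂ A) :=
      CStarMatrix.mapₙₐ (Unitization.inrNonUnitalStarAlgHom ℂ A)
    have hι : Function.Injective ι := by
      intro x y hxy
      ext i j
      have := congrArg (fun M : CStarMatrix (Fin n) (Fin n) (Unitization ℂ A) => M i j) hxy
      simpa [ι, CStarMatrix.mapₙₐ] using this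
    rw [← NonUnitalStarAlgHom.norm_map ι hι]
    refine le_of_eq (congrArg norm (CStarMatrix.ext fun i j => ?_))
    obtain ⟨a, ha⟩ := (x i j).2
    change ((φ (x i j) : A) : Unitization ℂ A) = x i j
    change (((x i j : Unitization ℂ A).snd : A) : Unitization ℂ A) = x i j
    rw [← ha]
    rfl
  -- The identity of `A` extends to a complete contraction on the unitization; the image of `1` is
  -- the candidate for a unit of `A`.
  obtain ⟨ψ, hψ, hψφ⟩ := hA (Unitization ℂ A) E φ hφ
  have hψi : ∀ a : A, ψ a = a := fun a => hψφ ⟨a, a, rfl⟩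
  refine ⟨ψ 1, fun u hu0 hu1 => norm_row_rotationMatrix_le ?_⟩
  have hu0' : (0 : Unitization ℂ A) ≤ u := Unitization.inr_nonneg_iff.2 hu0
  have hu1' : (u : Unitization ℂ A) ≤ 1 := by
    rw [← CStarAlgebra.norm_le_one_iff_of_nonneg _ hu0', Unitization.norm_inr]
    exact hu1
  refine le_trans (le_of_eq (congrArg norm (CStarMatrix.ext fun i j => ?_)))
    ((hψ 2 (rotationMatrix (1 - (u : Unitization ℂ A)) u)).trans
      (norm_rotationMatrix_le hu0' hu1'))
  change rotationMatrix (ψ 1 - u) u i j = ψ (rotationMatrix (1 - (u : Unitization ℂ A)) u i j)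
  fin_cases i <;> fin_cases j <;> simp [rotationMatrix, hψi]

/-- The hypothesis bounds `a (e - u) (e - u)* a*` by `a a* - a u u* a*`. Along an approximate unit
`u` this tends to 0, while the left side tends to `(a e - a) (a e - a)*`. -/
lemma mul_eq_of_row_contraction {e : A} (he : ∀ u : A, 0 ≤ u → ‖u‖ ≤ 1 →
    ‖(e - u) * star (e - u) + u * star u‖ ≤ 1) (a : A) : a * e = a := by
  have hu := CStarAlgebra.increasingApproximateUnit A
  have h1 : Filter.Tendsto (fun u => a * (e - u)) (CStarAlgebra.approximateUnit A)
      (𝓝 (a * e - a)) := by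
    simp only [mul_sub]
    exact tendsto_const_nhds.sub (hu.tendsto_mul_left a)
  have h2 : Filter.Tendsto (fun u => a * star a - a * u * star (a * u))
      (CStarAlgebra.approximateUnit A) (𝓝 (a * star a - a * star a)) :=
    tendsto_const_nhds.sub ((hu.tendsto_mul_left a).mul (hu.tendsto_mul_left a).star)
  rw [sub_self] at h2
  have h3 : Filter.Tendsto (fun u => a * (e - u) * star (a * (e - u)))
      (CStarAlgebra.approximateUnit A) (𝓝 0) := by
    refine squeeze_zero_norm' ?_ (by simpa using h2.norm)
    filter_upwards [hu.eventually_nonneg, hu.eventually_norm] with u hu0 hu1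
    refine CStarAlgebra.norm_le_norm_of_nonneg_of_le (mul_star_self_nonneg _) ?_
    have hpos : 0 ≤ (e - u) * star (e - u) + u * star u :=
      add_nonneg (mul_star_self_nonneg _) (mul_star_self_nonneg _)
    have h := CStarAlgebra.star_right_conjugate_le_norm_smul (a := a)
      (b := (e - u) * star (e - u) + u * star u) hpos.isSelfAdjoint
    have h' : ‖(e - u) * star (e - u) + u * star u‖ • (a * star a) ≤ a * star a := by
      have := smul_le_smul_of_nonneg_right (he u hu0 hu1) (mul_star_self_nonneg a)
      rwa [one_smul] at this
    rw [le_sub_iff_add_le]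
    refine le_trans (le_of_eq ?_) (h.trans h')
    simp only [star_mul, mul_add, add_mul, mul_assoc]
  have h4 : (a * e - a) * star (a * e - a) = 0 := tendsto_nhds_unique (h1.mul h1.star) h3
  exact sub_eq_zero.1 ((CStarRing.mul_star_self_eq_zero_iff _).1 h4)

/-- The unit of an injective C*-algebra generates its unit ball. -/
lemma IsInjectiveCStarAlgebra.exists_isUnitBallGenerator (hA : IsInjectiveCStarAlgebra A) :
    ∃ p : A, IsUnitBallGenerator p := by
  obtain ⟨e, he⟩ := hA.exists_row_contraction
  have hr := mul_eq_of_row_contraction he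
  -- Adjoints turn the right unit `e` into the left unit `star e`, so the two coincide and `a = a e
  -- e` is in the hull of `e`.
  have hl : ∀ a, star e * a = a := fun a => by
    rw [← star_star a, ← star_mul, hr]
  have hs : star e = e := by rw [← hr (star e), hl]
  have hn : ‖e‖ ≤ 1 := by
    have h := CStarRing.norm_star_mul_self (x := e)
    rw [hl] at h
    by_contra hlt
    push Not at hlt
    nlinarith
  refine ⟨e, fun a ha => ?_⟩
  have h := (isAConvex_closedAConvexHull (A := A) {e}).bimul_mem
    (subset_closedAConvexHull _ (Set.mem_singleton e)) ha hn
  rwa [bimul_self, hr, hr] at h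

end Unit

/-! ### The algebra of compact operators -/

section CompactOperators

variable {H : Type*} [NormedAddCommGroup H] [InnerProductSpace ℂ H] [CompleteSpace H]

/-- Composition with a compact operator turns bounded pointwise convergence into norm
convergence. -/
lemma tendsto_comp_of_isCompactOperator {P : ℕ → H →L[ℂ] H} (hP : ∀ n, ‖P n‖ ≤ 1)
    (hlim : ∀ x, Filter.Tendsto (fun n => P n x) Filter.atTop (𝓝 x)) {S : H →L[ℂ] H}
    (hS : IsCompactOperator S) :
    Filter.Tendsto (fun n => P n ∘L S) Filter.atTop (𝓝 S) := by
  rw [Metric.tendsto_nhds]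
  intro ε hε
  have hcomp := IsCompactOperator.isCompact_closure_image_closedBall (f := (S : H →ₗ[ℂ] H)) hS 1
  obtain ⟨t, -, htf, ht⟩ := hcomp.finite_cover_balls (by positivity : 0 < ε / 4)
  have hev : ∀ᶠ n in Filter.atTop, ∀ y ∈ t, ‖P n y - y‖ < ε / 4 := by
    rw [Filter.eventually_all_finite htf]
    intro y _
    have := (tendsto_iff_norm_sub_tendsto_zero.1 (hlim y)).eventually
      (gt_mem_nhds (by positivity : 0 < ε / 4))
    exact this
  filter_upwards [hev] with n hn
  rw [dist_eq_norm]
  refine lt_of_le_of_lt (ContinuousLinearMap.opNorm_le_of_unit_norm (C := 3 * (ε / 4))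
    (by positivity) fun x hx => ?_) (by linarith)
  have hSx : S x ∈ closure ((S : H →ₗ[ℂ] H) '' Metric.closedBall 0 1) :=
    subset_closure ⟨x, mem_closedBall_zero_iff.2 hx.le, rfl⟩
  obtain ⟨y, hyt, hy⟩ := Set.mem_iUnion₂.1 (ht hSx)
  rw [mem_ball_iff_norm] at hy
  have e : (P n ∘L S - S) x = P n (S x - y) + (P n y - y) - (S x - y) := by
    rw [_root_.sub_apply, ContinuousLinearMap.comp_apply, map_sub]
    abel
  have h1 : ‖P n (S x - y)‖ ≤ ‖S x - y‖ := (P n).le_of_opNorm_le (hP n) _ |>.trans_eq (one_mul _)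
  rw [e]
  refine (norm_sub_le _ _).trans ?_
  have := norm_add_le (P n (S x - y)) (P n y - y)
  linarith [hn y hyt]

open InnerProductSpace

lemma isCompactOperator_rankOne (x y : H) : IsCompactOperator (rankOne ℂ x y) :=
  ((isCompactOperator_of_locallyCompactSpace_rng
    (ContinuousLinearMap.toSpanSingleton ℂ x)).comp_clm (innerSL ℂ y) :)

/-- The projections onto the span of the first basis vectors. -/
def basisProjection (b : HilbertBasis ℕ ℂ H) (n : ℕ) : H →L[ℂ] H :=
  ∑ k ∈ Finset.range n, rankOne ℂ (b k) (b k)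

variable (b : HilbertBasis ℕ ℂ H)

lemma basisProjection_succ (n : ℕ) :
    basisProjection b (n + 1) = basisProjection b n + rankOne ℂ (b n) (b n) :=
  Finset.sum_range_succ _ _

lemma rankOne_basis_mul (i j k l : ℕ) :
    rankOne ℂ (b i) (b j) * rankOne ℂ (b k) (b l) =
      if j = k then rankOne ℂ (b i) (b l) else 0 := by
  rw [ContinuousLinearMap.mul_def, rankOne_comp_rankOne, orthonormal_iff_ite.1 b.orthonormal]
  split_ifs <;> simp

lemma basisProjection_mul_self (n : ℕ) :
    basisProjection b n * basisProjection b n = basisProjection b n := by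
  simp only [basisProjection, Finset.sum_mul_sum, rankOne_basis_mul]
  refine Finset.sum_congr rfl fun i hi => ?_
  rw [Finset.sum_ite_eq, if_pos hi]

lemma star_basisProjection (n : ℕ) : star (basisProjection b n) = basisProjection b n := by
  simp [basisProjection, ContinuousLinearMap.star_eq_adjoint]

lemma norm_basisProjection_le (n : ℕ) : ‖basisProjection b n‖ ≤ 1 := by
  have h := CStarRing.norm_star_mul_self (x := basisProjection b n)
  rw [star_basisProjection, basisProjection_mul_self] at h
  by_contra hlt
  push Not at hlt
  nlinarith

lemma tendsto_basisProjection_apply (x : H) :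
    Filter.Tendsto (fun n => basisProjection b n x) Filter.atTop (𝓝 x) := by
  have h := (b.hasSum_repr x).tendsto_sum_nat
  refine h.congr fun n => ?_
  rw [basisProjection, _root_.sum_apply]
  refine Finset.sum_congr rfl fun k _ => ?_
  rw [rankOne_apply, b.repr_apply_apply]

lemma isCompactOperator_basisProjection (n : ℕ) : IsCompactOperator (basisProjection b n) := by
  induction n with
  | zero =>
    have : basisProjection b 0 = 0 := Finset.sum_range_zero _
    rw [this]
    exact isCompactOperator_zero
  | succ n ih =>
    rw [basisProjection_succ]
    exact ih.add (isCompactOperator_rankOne _ _)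

variable {A : Type*} [NonUnitalCStarAlgebra A] [PartialOrder A] [StarOrderedRing A]

/-- A minimal projection generates the unit ball of the algebra of compact operators. -/
lemma exists_isUnitBallGenerator_of_range_eq (b : HilbertBasis ℕ ℂ H) (π : A →⋆ₙₐ[ℂ] (H →L[ℂ] H))
    (hinj : Function.Injective π) (hπ : Set.range π = {T : H →L[ℂ] H | IsCompactOperator T}) :
    ∃ p : A, IsUnitBallGenerator p := by
  have hnorm : ∀ a, ‖π a‖ = ‖a‖ := NonUnitalStarAlgHom.norm_map π hinj
  have hcomp : ∀ a, IsCompactOperator (π a) := fun a => hπ.le ⟨a, rfl⟩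
  choose e he using fun i j : ℕ =>
    (hπ.ge (isCompactOperator_rankOne (b i) (b j)) : rankOne ℂ (b i) (b j) ∈ Set.range π)
  choose q hq using fun n =>
    (hπ.ge (isCompactOperator_basisProjection b n) : basisProjection b n ∈ Set.range π)
  have hqn : ∀ n, ‖q n‖ ≤ 1 := fun n => by
    rw [← hnorm, hq]; exact norm_basisProjection_le b n
  have hqq : ∀ n, q n * q n = q n := fun n => hinj (by
    rw [map_mul, hq, basisProjection_mul_self])
  have hqs : ∀ n, star (q n) = q n := fun n => hinj (by
    rw [map_star, hq, star_basisProjection])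
  have hes : ∀ i j, star (e i j) = e j i := fun i j => hinj (by
    rw [map_star, he, he, ContinuousLinearMap.star_eq_adjoint, adjoint_rankOne])
  have hee : ∀ i j k, e i j * e j k = e i k := fun i j k => hinj (by
    rw [map_mul, he, he, he, rankOne_basis_mul, if_pos rfl])
  have hqe : ∀ n, q n + e n n = q (n + 1) := fun n => hinj (by
    rw [map_add, hq, he, hq, basisProjection_succ])
  set C := closedAConvexHull A {e 0 0} with hC
  have hCcl : IsClosed C := isClosed_closedAConvexHull _
  have hCcv : IsAConvex A C := isAConvex_closedAConvexHull _
  have hpC : e 0 0 ∈ C := subset_closedAConvexHull _ rfl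
  -- Induction through `q (n + 1) = q n q n q n + e n 0 e 0 0 e 0 n`, whose row and column squares
  -- both equal the projection `q (n + 1)`.
  have hqC : ∀ n, q n ∈ C := by
    intro n
    induction n with
    | zero =>
      have h0 : q 0 = 0 := hinj (by rw [hq, map_zero]; exact Finset.sum_range_zero _)
      rw [h0]
      exact (hCcv.balanced hCcl).zero_mem ⟨_, hpC⟩
    | succ n ih =>
      have h := hCcv _ ih _ hpC (q n) (e n 0) (q n) (e 0 n)
        (by rw [hqs, hes, hqq, hee, hqe]; exact hqn _)
        (by rw [hqs, hes, hqq, hee, hqe]; exact hqn _)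
      rwa [bimul_self, bimul_self, hqq, hqq, hee, hee, hqe] at h
  refine ⟨e 0 0, fun a ha => ?_⟩
  -- Taking adjoints, this is `q n * star a → star a`, which holds because the image of `star a` is
  -- compact.
  have hlim : Filter.Tendsto (fun n => a * q n) Filter.atTop (𝓝 a) := by
    have h := tendsto_comp_of_isCompactOperator (norm_basisProjection_le b)
      (tendsto_basisProjection_apply b) (hcomp (star a))
    rw [tendsto_iff_norm_sub_tendsto_zero] at h ⊢
    refine h.congr fun n => ?_
    rw [← hq, ← ContinuousLinearMap.mul_def, ← map_mul, ← map_sub, hnorm, ← norm_star, star_sub,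
      star_mul, star_star, hqs]
  refine hCcl.mem_of_tendsto hlim (Filter.Eventually.of_forall fun n => ?_)
  have h := hCcv.bimul_mem (hqC n) ha (hqn n)
  rwa [bimul_self, mul_assoc, hqq] at h

end CompactOperators

lemma IsCompactOperatorAlgebra.exists_isUnitBallGenerator {A : Type*} [NonUnitalCStarAlgebra A]
    [PartialOrder A] [StarOrderedRing A] (hA : IsCompactOperatorAlgebra A) :
    ∃ p : A, IsUnitBallGenerator p := by
  obtain ⟨π, hinj, hπ⟩ := hA
  exact exists_isUnitBallGenerator_of_range_eq (HilbertBasis.ofRepr (.refl ℂ _)) π hinj hπ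

end

theorem mainTheorem6 (A : Type u) [NonUnitalCStarAlgebra A] [PartialOrder A]
    [StarOrderedRing A] (hA : IsInjectiveCStarAlgebra A ∨ IsCompactOperatorAlgebra A)
    (V : Type u) [NormedAddCommGroup V] [NormedSpace ℂ V] [OperatorSpace V] :
    HasAApproximationProperty A V ↔
      ∀ (W : Type u) [NormedAddCommGroup W] [NormedSpace ℂ W] [CStarOperatorSpace A W]
        (φ : W →L[ℂ] MinTensor A V), IsACompactMap A φ →
        ∀ ε : ℝ, 0 < ε → ∃ ψ : W →L[ℂ] MinTensor A V, HasFiniteARank ψ ∧ ‖φ - ψ‖ ≤ ε := by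
  -- The two classes of algebras enter only through such a generator, and only in the converse
  -- direction.
  obtain ⟨p, hp⟩ : ∃ p : A, IsUnitBallGenerator p :=
    hA.elim (fun h => h.exists_isUnitBallGenerator) fun h => h.exists_isUnitBallGenerator
  exact ⟨fun h W _ _ _ φ hφ ε hε => h.exists_hasFiniteARank hφ hε,
    hasAApproximationProperty_of_isUnitBallGenerator hp⟩
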